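/- Conventions. A vocabulary $\tau$ is a finite set of relation symbols (no constants, no function symbols). Structures are finite with non-empty universe; $\mathrm{STRUC}[\tau]$ is the class of finite $\tau$-structures, and a structure with $n$ elements is encoded by the bit string $1^n0$ followed by the truth tables of its relations; $\mathrm{length}(\mathcal S)$ is the length of this string. A parameterized problem is a set $Q\subseteq \mathrm{STRUC}[\tau]\times\mathbb N$ all of whose slices $\{\mathcal S\mid(\mathcal S,k)\in Q\}$ are closed under isomorphism; $k$ is the parameter. A pattern is a word $p\in\{a,e\}^*$; $p\preceq q$ means that $p$ is a (not necessarily contiguous) subsequence of $q$, and $p\preceq e^*a$ means that $p\preceq e^ma$ for some $m\ge 0$. For a pattern $p$ and $s\ge 0$, $\mathrm{FD}(E_s^{=}p)$ is the class of all problems (over all vocabularies $\tau$) $$\{(\mathcal S,k)\mid \text{there is } C\subseteq U^s,\ U \text{ the universe of } \mathcal S,\text{ with } |C|=k \text{ and } \mathcal S\models\phi(C)\},$$ where $\phi(X)$ is a first-order formula with equality over $\tau$ and one additional $s$-ary relation variable $X$, in prenex form, whose quantifier prefix is $p$ ($a$ for $\forall$, $e$ for $\exists$). An undirected graph is a structure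 with one binary symmetric relation; it is basic if it has no self-loops. $\mathrm{FD}_{\mathrm{undirected}}(E_1^{=}p)$ and $\mathrm{FD}_{\mathrm{basic}}(E_1^{=}p)$ consist of the intersections of the problems of $\mathrm{FD}(E_1^{=}p)$ over the vocabulary of digraphs with the class of all $(\mathcal G,k)$ for which $\mathcal G$ is an undirected, respectively basic, graph. $Q\in\text{para-}\mathrm{AC}^0$ means: there are a family $(C_{n,k})_{n,k\in\mathbb N}$ of Boolean circuits of unbounded fan-in, of constant depth and of size at most $f(k)\cdot n^{O(1)}$ for a computable function $f$, such that for all $(\mathcal S,k)$ we have $(\mathcal S,k)\in Q$ if and only if $C_{\mathrm{length}(\mathcal S),k}$ outputs $1$ on the encoding of $\mathcal S$. An fpt-reduction is a many-one reduction $(\mathcal S,k)\mapsto(\mathcal S',k')$ that is computable (by a random access machine) in time $f(k)\cdot\mathrm{length}(\mathcal S)^{O(1)}$ with $k'\le g(k)$, for computable $f,g$. $\mathrm W[1]$ is the class of all parameterized problems that are fpt-reducible to a problem in $\mathrm{FD}(E_s^{=}a^\ell)$ for some $s,\ell\ge 0$ (the weighted Fagin-definable problems for $\Pi_1$-formulas).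 A problem is $\mathrm W[1]$-hard if every problem in $\mathrm W[1]$ is fpt-reducible to it. **Theorem (Complexity Dichotomy for $\mathrm{FD}(E_1^{=}p)$).** Let $p\in\{a,e\}^*$ be a pattern. 1. If $p\preceq e^*a$, then $\mathrm{FD}(E_1^{=}p)\subseteq\text{para-}\mathrm{AC}^0$. 2. If $aa\preceq p$ or $ae\preceq p$, then $\mathrm{FD}(E_1^{=}p)$ contains a $\mathrm W[1]$-hard problem. Both items also hold for $\mathrm{FD}_{\mathrm{undirected}}(E_1^{=}p)$ and for $\mathrm{FD}_{\mathrm{basic}}(E_1^{=}p)$ in place of $\mathrm{FD}(E_1^{=}p)$. -/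

import Mathlib

namespace ParamESO

/-! ### Finite relational structures -/

/-- A finite relational vocabulary: finitely many relation symbols, each with an arity. -/
structure Vocab where
  num : ℕ
  arity : Fin num → ℕ

/-- A finite structure over `τ` (non-empty universe, up to renaming `{0, …, card - 1}`). -/
structure FinStruct (τ : Vocab) where
  card : ℕ
  card_pos : 0 < card
  rel : (i : Fin τ.num) → (Fin (τ.arity i) → Fin card) → Bool

/-- Isomorphism of finite structures. -/
def FinStruct.Iso {τ : Vocab} (S T : FinStruct τ) : Prop :=
  ∃ e : Fin S.card ≃ Fin T.card, ∀ i v, S.rel i v = T.rel i (e ∘ v)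

/-- Sets of instances; a first component is the input, a second one the parameter. -/
abbrev Problem (τ : Vocab) : Type := Set (FinStruct τ × ℕ)

/-- Every slice of the problem is closed under isomorphisms. -/
def IsoClosed {τ : Vocab} (Q : Problem τ) : Prop :=
  ∀ (S T : FinStruct τ) (k : ℕ), S.Iso T → (S, k) ∈ Q → (T, k) ∈ Q

/-- The standard encoding of a structure with `n` elements as a bit string: `1ⁿ0`, followed by the
truth tables of the relations, the tuples being listed as the base-`n` numbers `0, 1, 2, …`. -/
def FinStruct.encode {τ : Vocab} (S : FinStruct τ) : List Bool :=
  List.replicate S.card true ++ false ::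
    (List.finRange τ.num).flatMap fun i =>
      List.ofFn fun t : Fin (S.card ^ τ.arity i) => S.rel i (finFunctionFinEquiv.symm t)

/-! ### Weighted existential second-order logic -/

/-- The first-order language with the symbols of `τ` and one more relation symbol of arity `s`,
which stands for the second-order variable `X`. -/
def Vocab.langX (τ : Vocab) (s : ℕ) : FirstOrder.Language.{0, 0} where
  Functions := fun _ => Empty
  Relations := fun n => {i : Fin τ.num // τ.arity i = n} ⊕ {_u : Unit // s = n}

/-- The structure `S` together with `C ⊆ Uˢ` as the interpretation of `X`. -/
@[reducible] def FinStruct.expand {τ : Vocab} (S : FinStruct τ) {s : ℕ} (C : Finset (Fin s → Fin S.card)) :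
    (τ.langX s).Structure (Fin S.card) where
  funMap := fun f => Empty.elim f
  RelMap := fun r v =>
    match r with
    | Sum.inl i => S.rel i.1 (fun j => v (Fin.cast i.2 j)) = true
    | Sum.inr h => (fun j => v (Fin.cast h.2 j)) ∈ C

/-- The two first-order quantifiers, as letters of patterns. -/
inductive Quant where
  | e
  | a
  deriving DecidableEq

/-- `HasPattern p φ`: the formula `φ` is in prenex form with quantifier prefix `p`. -/
inductive HasPattern {L : FirstOrder.Language.{0, 0}} :
    {n : ℕ} → List Quant → L.BoundedFormula Empty n → Prop
  | qf {n : ℕ} {φ : L.BoundedFormula Empty n} (h : φ.IsQF) : HasPattern [] φ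
  | ex {n : ℕ} {p : List Quant} {φ : L.BoundedFormula Empty (n + 1)} (h : HasPattern p φ) :
      HasPattern (Quant.e :: p) φ.ex
  | all {n : ℕ} {p : List Quant} {φ : L.BoundedFormula Empty (n + 1)} (h : HasPattern p φ) :
      HasPattern (Quant.a :: p) φ.all

/-- The problem described by `∃⁼X φ(X)`: all `(S, k)` such that `S ⊨ φ(C)` for some
`C ⊆ Uˢ` with exactly `k` elements. -/
def modelsEq {τ : Vocab} {s : ℕ} (φ : (τ.langX s).Sentence) : Problem τ :=
  {x | ∃ C : Finset (Fin s → Fin x.1.card), C.card = x.2 ∧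
    @FirstOrder.Language.Sentence.Realize (τ.langX s) (Fin x.1.card) (x.1.expand C) φ}

/-- The problems over `τ` in `FD(E_s⁼ p)`. -/
def FD (τ : Vocab) (s : ℕ) (p : List Quant) : Set (Problem τ) :=
  {Q | ∃ φ : (τ.langX s).Sentence, HasPattern p φ ∧ Q = modelsEq φ}

/-- The vocabulary of digraphs: one binary relation symbol. -/
def digraphVocab : Vocab where
  num := 1
  arity := fun _ => 2

/-- The edge relation. -/
def FinStruct.Adj (G : FinStruct digraphVocab) (x y : Fin G.card) : Prop :=
  G.rel (0 : Fin 1) (![x, y] : Fin 2 → Fin G.card) = true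

/-- Undirected graphs (self-loops are allowed). -/
def FinStruct.IsUndirected (G : FinStruct digraphVocab) : Prop :=
  ∀ x y, G.Adj x y → G.Adj y x

/-- Basic graphs: undirected graphs without self-loops. -/
def FinStruct.IsBasic (G : FinStruct digraphVocab) : Prop :=
  ∀ x y, G.Adj x y → x ≠ y ∧ G.Adj y x

/-- The class `FD_undirected(E_s⁼ p)`. -/
def FDUndirected (s : ℕ) (p : List Quant) : Set (Problem digraphVocab) :=
  {Q | ∃ φ : (digraphVocab.langX s).Sentence, HasPattern p φ ∧
    Q = modelsEq φ ∩ {x | x.1.IsUndirected}}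

/-- The class `FD_basic(E_s⁼ p)`. -/
def FDBasic (s : ℕ) (p : List Quant) : Set (Problem digraphVocab) :=
  {Q | ∃ φ : (digraphVocab.langX s).Sentence, HasPattern p φ ∧
    Q = modelsEq φ ∩ {x | x.1.IsBasic}}

/-! ### Unbounded fan-in circuits and para-AC⁰ -/

/-- A gate of a circuit with `n` inputs that may read `m` earlier gates. -/
inductive Gate (n m : ℕ) where
  | input (i : Fin n)
  | neg (j : Fin m)
  | conj (J : Finset (Fin m))
  | disj (J : Finset (Fin m))

/-- A sequence of `m` gates over `n` inputs in which every gate reads only earlier gates. -/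
inductive Gates (n : ℕ) : ℕ → Type where
  | nil : Gates n 0
  | snoc {m : ℕ} (C : Gates n m) (g : Gate n m) : Gates n (m + 1)

/-- The value of a gate, given the input and the values of the earlier gates. -/
def Gate.eval {n m : ℕ} (x : Fin n → Bool) (v : Fin m → Bool) : Gate n m → Bool
  | .input i => x i
  | .neg j => !v j
  | .conj J => decide (∀ j ∈ J, v j = true)
  | .disj J => decide (∃ j ∈ J, v j = true)

/-- The depth of a gate, given the depths of the earlier gates. -/
def Gate.depth {n m : ℕ} (d : Fin m → ℕ) : Gate n m → ℕ
  | .input _ => 0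
  | .neg j => d j + 1
  | .conj J => J.sup d + 1
  | .disj J => J.sup d + 1

/-- The values of all gates. -/
def Gates.eval {n : ℕ} (x : Fin n → Bool) : {m : ℕ} → Gates n m → Fin m → Bool
  | _, .nil => Fin.elim0
  | _, .snoc C g => Fin.snoc (α := fun _ => Bool) (C.eval x) (g.eval x (C.eval x))

/-- The depths of all gates. -/
def Gates.depth {n : ℕ} : {m : ℕ} → Gates n m → Fin m → ℕ
  | _, .nil => Fin.elim0
  | _, .snoc C g => Fin.snoc (α := fun _ => ℕ) C.depth (g.depth C.depth)

/-- A Boolean circuit with `n` inputs and unbounded fan-in; its last gate is the output. -/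
structure Circuit (n : ℕ) where
  last : ℕ
  gates : Gates n (last + 1)

/-- The number of gates. -/
def Circuit.size {n : ℕ} (C : Circuit n) : ℕ := C.last + 1

/-- The depth of the circuit: the largest depth of one of its gates. -/
def Circuit.depth {n : ℕ} (C : Circuit n) : ℕ := Finset.univ.sup C.gates.depth

/-- The output of the circuit. -/
def Circuit.eval {n : ℕ} (C : Circuit n) (x : Fin n → Bool) : Bool :=
  C.gates.eval x (Fin.last C.last)

/-- The class para-AC⁰: there is a family `(C_{n,k})` of unbounded fan-in circuits of constant depth
and of size `f(k) · n^O(1)`, for a computable `f`, such that `C_{n,k}` decides the instances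
`(S, k)` whose structure has an encoding of length `n`. -/
def InParaAC0 {τ : Vocab} (Q : Problem τ) : Prop :=
  ∃ (C : (n : ℕ) → ℕ → Circuit n) (d c : ℕ) (f : ℕ → ℕ), Computable f ∧
    (∀ n k, (C n k).depth ≤ d) ∧
    (∀ n k, 0 < n → (C n k).size ≤ f k * n ^ c) ∧
    ∀ (S : FinStruct τ) (k : ℕ),
      (S, k) ∈ Q ↔ (C S.encode.length k).eval S.encode.get = true

/-! ### Random access machines, fpt-reductions, W[1] -/

/-- The state of a random access machine: registers and an addressable memory. -/
@[ext] structure RAMState where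
  reg : ℕ → ℕ
  mem : ℕ → ℕ

/-- The state with `v` written to register `i`. -/
def RAMState.setReg (σ : RAMState) (i v : ℕ) : RAMState :=
  ⟨Function.update σ.reg i v, σ.mem⟩

/-- The state with `v` written to memory cell `i`. -/
def RAMState.setMem (σ : RAMState) (i v : ℕ) : RAMState :=
  ⟨σ.reg, Function.update σ.mem i v⟩

/-- Programs of a random access machine (structured; a program names only finitely many registers).
The arguments are register numbers, except for the constant `c`. -/
inductive Prog where
  | const (i c : ℕ)
  | add (i j l : ℕ)
  | sub (i j l : ℕ)
  | half (i j : ℕ)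
  | load (i j : ℕ)
  | store (i j : ℕ)
  | seq (P P' : Prog)
  | ite (i : ℕ) (P P' : Prog)
  | loop (i : ℕ) (P : Prog)

/-- `Runs P σ t σ'`: started in `σ`, the program `P` halts after `t` steps in `σ'`.
Every elementary instruction and every test counts as one step. -/
inductive Runs : Prog → RAMState → ℕ → RAMState → Prop
  | const (i c : ℕ) (σ : RAMState) : Runs (.const i c) σ 1 (σ.setReg i c)
  | add (i j l : ℕ) (σ : RAMState) :
      Runs (.add i j l) σ 1 (σ.setReg i (σ.reg j + σ.reg l))
  | sub (i j l : ℕ) (σ : RAMState) :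
      Runs (.sub i j l) σ 1 (σ.setReg i (σ.reg j - σ.reg l))
  | half (i j : ℕ) (σ : RAMState) : Runs (.half i j) σ 1 (σ.setReg i (σ.reg j / 2))
  | load (i j : ℕ) (σ : RAMState) : Runs (.load i j) σ 1 (σ.setReg i (σ.mem (σ.reg j)))
  | store (i j : ℕ) (σ : RAMState) : Runs (.store i j) σ 1 (σ.setMem (σ.reg i) (σ.reg j))
  | seq {P P' : Prog} {σ σ' σ'' : RAMState} {t t' : ℕ} (h : Runs P σ t σ')
      (h' : Runs P' σ' t' σ'') : Runs (.seq P P') σ (t + t') σ''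
  | ite_pos {i : ℕ} {P P' : Prog} {σ σ' : RAMState} {t : ℕ} (hi : σ.reg i ≠ 0)
      (h : Runs P σ t σ') : Runs (.ite i P P') σ (t + 1) σ'
  | ite_neg {i : ℕ} {P P' : Prog} {σ σ' : RAMState} {t : ℕ} (hi : σ.reg i = 0)
      (h : Runs P' σ t σ') : Runs (.ite i P P') σ (t + 1) σ'
  | loop_done {i : ℕ} {P : Prog} {σ : RAMState} (hi : σ.reg i = 0) : Runs (.loop i P) σ 1 σ
  | loop_step {i : ℕ} {P : Prog} {σ σ' σ'' : RAMState} {t t' : ℕ} (hi : σ.reg i ≠ 0)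
      (h : Runs P σ t σ') (h' : Runs (.loop i P) σ' t' σ'') :
      Runs (.loop i P) σ (t + t' + 1) σ''

/-- The contents of a memory cell: `0` is blank, `1` and `2` are the symbols for the two bits. -/
def cell : Option Bool → ℕ
  | none => 0
  | some false => 1
  | some true => 2

/-- How an instance is presented to a machine, and how a machine presents its result: register `0`
holds the length of the encoding of the structure, register `1` the parameter, the memory the
encoding, and everything else is `0`. -/
def instanceState {τ : Vocab} (x : FinStruct τ × ℕ) : RAMState where
  reg := fun i => if i = 0 then x.1.encode.length else if i = 1 then x.2 else 0
  mem := fun i => cell (x.1.encode[i]?)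

/-- `Q` is fpt-reducible to `Q'`: there is a many-one reduction that is computable in time
`f(k) · |x|^O(1)` and maps the parameter `k` to a parameter of size at most `g(k)`, for computable
functions `f` and `g`. -/
def FPTReducible {τ τ' : Vocab} (Q : Problem τ) (Q' : Problem τ') : Prop :=
  ∃ R : FinStruct τ × ℕ → FinStruct τ' × ℕ,
    (∀ x, x ∈ Q ↔ R x ∈ Q') ∧
    (∃ (P : Prog) (f : ℕ → ℕ) (c : ℕ), Computable f ∧
      ∀ x, ∃ t, t ≤ f x.2 * x.1.encode.length ^ c ∧
        Runs P (instanceState x) t (instanceState (R x))) ∧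
    ∃ g : ℕ → ℕ, Computable g ∧ ∀ x, (R x).2 ≤ g x.2

/-- The class W[1]: the closure under fpt-reductions of the weighted Fagin-definable problems of
universal first-order formulas `φ(X)` with a relation variable `X` of some arity. -/
def InW1 {τ : Vocab} (Q : Problem τ) : Prop :=
  IsoClosed Q ∧ ∃ (τ' : Vocab) (s l : ℕ),
    ∃ Q' ∈ FD τ' s (List.replicate l Quant.a), FPTReducible Q Q'

/-- `Q` is W[1]-hard: every problem in W[1] is fpt-reducible to `Q`. -/
def W1Hard {τ : Vocab} (Q : Problem τ) : Prop :=
  ∀ (τ' : Vocab) (Q' : Problem τ'), InW1 Q' → FPTReducible Q' Q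

end ParamESO

namespace ParamESO

open FirstOrder

/-! ### Quantifier-free formulas and prefixes -/

/-! Upper bound. Let the prefix be `eᵐa`. Guess the values `y₁, …, yₘ` and bits `b₁, …, bₘ` that say
which of them lie in `C`. For a fixed `z` the matrix then depends on `C` only through whether `z ∈
C`. So each `z`, independently of all others, may be inside (`I`), may be outside (`O`), both, or
neither. A set of size `k` exists iff no `z` is excluded from both sides, at least `k` elements may
be inside, and at most `k` elements may not be outside (`exists_set_iff`). All of this has constant
depth once counting up to `k` has. For the counting, `k` distinct numbers below `n` are told apart
by `k²` of their binary digits (`le_card_iff_exists_hash`), and the `(log n)^(k²)` choices of digit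
positions number at most `f(k) · n` (`size_pow_le`).

Lower bound. The pattern `aa` expresses the clique problem and `ae` the total domination problem;
longer patterns are reached by vacuous quantifiers. Since fpt-reductions compose, it suffices to
reduce every universal Fagin-definable problem to clique, and clique to total domination.

For the first reduction, a set of `k` tuples is an increasing sequence `0 = c₀ < c₁ < … < cₖ < cₖ₊₁
= nˢ + 1`. Whether a tuple belongs to it is witnessed either by one term that hits its number or by
two consecutive terms around it. The matrix under one assignment contains boundedly many atoms of
`X`, so it is settled by a fixed number `q` of terms, and the universal sentence is a condition on
all `q`-tuples of terms (`exists_set_iff_exists_isSelection`). Vertices are guesses of `q` terms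
together with their indices, and edges join valid and consistent guesses. A clique of size `(k +
2)^q` has exactly one guess for every tuple of indices, which is a whole sequence
(`exists_isSelection_iff_clique`).

For the second reduction, each of `k + 2` indices must select one point, and a vertex for every bad
pair of points is dominated exactly if not both of its points are selected
(`exists_clique_iff_totalDomination`). Both reductions produce basic graphs, so they serve all three
graph classes at once.

That the reductions run on the machine follows from a calculus: the functions in `RC` are closed
under arithmetic, memory access and bounded sums, hence under bounded quantifiers, and
`exists_prog_of_rc` turns such descriptions of output bits into a program. -/

/-- Quantifier-free formulas over `τ` and an `s`-ary relation variable, with variables from `V`. -/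
inductive QForm (τ : Vocab) (s : ℕ) (V : Type) : Type where
  | fls
  | eq (i j : V)
  | rel (i : Fin τ.num) (v : Fin (τ.arity i) → V)
  | mem (v : Fin s → V)
  | imp (φ ψ : QForm τ s V)

/-- The truth value of a quantifier-free formula; `Y` gives the truth values of the atoms of the
relation variable. -/
def QForm.eval {τ : Vocab} {s : ℕ} {V : Type} (S : FinStruct τ) (x : V → Fin S.card)
    (Y : (Fin s → V) → Prop) : QForm τ s V → Prop
  | .fls => False
  | .eq i j => x i = x j
  | .rel i v => S.rel i (x ∘ v) = true
  | .mem v => Y v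
  | .imp φ ψ => φ.eval S x Y → ψ.eval S x Y

/-- Renaming of variables. -/
def QForm.map {τ : Vocab} {s : ℕ} {V W : Type} (g : V → W) : QForm τ s V → QForm τ s W
  | .fls => .fls
  | .eq i j => .eq (g i) (g j)
  | .rel i v => .rel i (g ∘ v)
  | .mem v => .mem (g ∘ v)
  | .imp φ ψ => .imp (φ.map g) (ψ.map g)

theorem QForm.eval_map {τ : Vocab} {s : ℕ} {V W : Type} (g : V → W) (S : FinStruct τ)
    (x : W → Fin S.card) (Y : (Fin s → W) → Prop) (φ : QForm τ s V) :
    (φ.map g).eval S x Y ↔ φ.eval S (x ∘ g) (fun v => Y (g ∘ v)) := by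
  induction φ with
  | imp φ ψ h h' => simp only [QForm.map, QForm.eval, h, h']
  | _ => simp [QForm.map, QForm.eval, Function.comp_assoc]

theorem QForm.eval_congr {τ : Vocab} {s : ℕ} {V : Type} (S : FinStruct τ) {x x' : V → Fin S.card}
    {Y Y' : (Fin s → V) → Prop} (hx : x = x') (hY : ∀ v, Y v ↔ Y' v) (φ : QForm τ s V) :
    φ.eval S x Y ↔ φ.eval S x' Y' := by
  subst hx
  rw [show Y = Y' from funext fun v => propext (hY v)]

/-- The realization of a formula of the language of `τ` and `X`. -/
def realizeX {τ : Vocab} {s n : ℕ} (S : FinStruct τ) (C : Finset (Fin s → Fin S.card))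
    (φ : (τ.langX s).BoundedFormula Empty n) (x : Fin n → Fin S.card) : Prop :=
  @Language.BoundedFormula.Realize (τ.langX s) (Fin S.card) (S.expand C) Empty n φ default x

/-- The language has no function symbols and the formulas have no free variables, so a term can only
be a bound variable. -/
theorem exists_var {τ : Vocab} {s n : ℕ} (t : (τ.langX s).Term (Empty ⊕ Fin n)) :
    ∃ i, t = Language.Term.var (Sum.inr i) := by
  cases t with
  | var i =>
    cases i with
    | inl i => exact i.elim
    | inr i => exact ⟨i, rfl⟩
  | func f _ => exact Empty.elim f

/-- Passing to `QForm` detaches the atoms of `X` from any concrete set: their truth values become a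
parameter, into which guessed values can be substituted. -/
theorem exists_qform {τ : Vocab} {s n : ℕ} {φ : (τ.langX s).BoundedFormula Empty n}
    (h : φ.IsQF) : ∃ ψ : QForm τ s (Fin n), ∀ (S : FinStruct τ) C x,
      realizeX S C φ x ↔ ψ.eval S x (fun v => x ∘ v ∈ C) := by
  induction h with
  | falsum => exact ⟨.fls, fun S C x => Iff.rfl⟩
  | of_isAtomic h =>
    cases h with
    | equal t t' =>
      obtain ⟨i, rfl⟩ := exists_var t
      obtain ⟨j, rfl⟩ := exists_var t'
      exact ⟨.eq i j, fun S C x => Iff.rfl⟩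
    | @rel m R ts =>
      choose v hv using fun i => exists_var (ts i)
      obtain rfl : ts = fun i => Language.Term.var (Sum.inr (v i)) := funext hv
      rcases R with ⟨i, hi⟩ | ⟨u, hu⟩
      · subst hi
        exact ⟨.rel i v, fun S C x => Iff.rfl⟩
      · subst hu
        exact ⟨.mem v, fun S C x => Iff.rfl⟩
  | imp h h' ih ih' =>
    obtain ⟨ψ, hψ⟩ := ih
    obtain ⟨ψ', hψ'⟩ := ih'
    exact ⟨.imp ψ ψ', fun S C x => imp_congr (hψ S C x) (hψ' S C x)⟩

theorem exists_isQF {τ : Vocab} {s n : ℕ} (ψ : QForm τ s (Fin n)) :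
    ∃ φ : (τ.langX s).BoundedFormula Empty n, φ.IsQF ∧ ∀ (S : FinStruct τ) C x,
      realizeX S C φ x ↔ ψ.eval S x (fun v => x ∘ v ∈ C) := by
  induction ψ with
  | fls => exact ⟨⊥, .falsum, fun S C x => Iff.rfl⟩
  | eq i j =>
    exact ⟨_, .of_isAtomic (.equal (Language.Term.var (Sum.inr i)) (Language.Term.var (Sum.inr j))),
      fun S C x => Iff.rfl⟩
  | rel i v =>
    exact ⟨_, .of_isAtomic (.rel (Sum.inl ⟨i, rfl⟩) fun j => Language.Term.var (Sum.inr (v j))),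
      fun S C x => Iff.rfl⟩
  | mem v =>
    exact ⟨_, .of_isAtomic (.rel (Sum.inr ⟨(), rfl⟩) fun j => Language.Term.var (Sum.inr (v j))),
      fun S C x => Iff.rfl⟩
  | imp ψ ψ' ih ih' =>
    obtain ⟨φ, h, hφ⟩ := ih
    obtain ⟨φ', h', hφ'⟩ := ih'
    exact ⟨_, h.imp h', fun S C x => imp_congr (hφ S C x) (hφ' S C x)⟩

theorem realizeX_all {τ : Vocab} {s n : ℕ} {S : FinStruct τ} {C : Finset (Fin s → Fin S.card)}
    {φ : (τ.langX s).BoundedFormula Empty (n + 1)} {x : Fin n → Fin S.card} :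
    realizeX S C φ.all x ↔ ∀ y, realizeX S C φ (Fin.snoc x y) := Iff.rfl

theorem realizeX_ex {τ : Vocab} {s n : ℕ} {S : FinStruct τ} {C : Finset (Fin s → Fin S.card)}
    {φ : (τ.langX s).BoundedFormula Empty (n + 1)} {x : Fin n → Fin S.card} :
    realizeX S C φ.ex x ↔ ∃ y, realizeX S C φ (Fin.snoc x y) :=
  @Language.BoundedFormula.realize_ex (τ.langX s) (Fin S.card) (S.expand C) Empty n φ default x

/-- Quantifiers over unused variables can be inserted into a prefix. -/
theorem exists_pattern_of_sublist {τ : Vocab} {s : ℕ} {q p : List Quant} (h : q.Sublist p) :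
    ∀ {n m : ℕ} (φ : (τ.langX s).BoundedFormula Empty n) (_ : HasPattern q φ) (g : Fin n → Fin m),
      ∃ φ' : (τ.langX s).BoundedFormula Empty m, HasPattern p φ' ∧
        ∀ S C x, realizeX S C φ' x ↔ realizeX S C φ (x ∘ g) := by
  induction h with
  | slnil =>
    intro n m φ hφ g
    cases hφ with
    | qf hφ =>
      obtain ⟨ψ, hψ⟩ := exists_qform hφ
      obtain ⟨φ', h, hφ'⟩ := exists_isQF (ψ.map g)
      refine ⟨φ', .qf h, fun S C x => ?_⟩
      rw [hφ', hψ, QForm.eval_map]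
      rfl
  | cons c _ ih =>
    intro n m φ hφ g
    obtain ⟨φ', h, hφ'⟩ := ih φ hφ (fun i => (g i).castSucc)
    cases c with
    | a =>
      refine ⟨φ'.all, .all h, fun S C x => ?_⟩
      -- A vacuous quantifier is harmless only because the universe is non-empty.
      have := S.card_pos
      simp only [realizeX_all, hφ']
      exact ⟨fun h => by simpa [Function.comp_def] using h ⟨0, this⟩,
        fun h y => by simpa [Function.comp_def] using h⟩
    | e =>
      refine ⟨φ'.ex, .ex h, fun S C x => ?_⟩
      have := S.card_pos
      simp only [realizeX_ex, hφ']
      exact ⟨fun ⟨y, h⟩ => by simpa [Function.comp_def] using h,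
        fun h => ⟨⟨0, this⟩, by simpa [Function.comp_def] using h⟩⟩
  | cons_cons c _ ih =>
    intro n m φ hφ g
    have key : ∀ (U : Type) (x : Fin m → U) (y : U),
        (Fin.snoc x y : Fin (m + 1) → U) ∘ (Fin.snoc (fun i => (g i).castSucc) (Fin.last m) :
          Fin (n + 1) → Fin (m + 1)) = (Fin.snoc (x ∘ g) y : Fin (n + 1) → U) := by
      intro U x y
      ext i
      refine Fin.lastCases ?_ (fun i => ?_) i <;> simp
    cases hφ with
    | ex hφ =>
      obtain ⟨φ', h, hφ'⟩ := ih _ hφ (Fin.snoc (fun i => (g i).castSucc) (Fin.last m))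
      refine ⟨φ'.ex, .ex h, fun S C x => ?_⟩
      simp only [realizeX_ex, hφ', key]
    | all hφ =>
      obtain ⟨φ', h, hφ'⟩ := ih _ hφ (Fin.snoc (fun i => (g i).castSucc) (Fin.last m))
      refine ⟨φ'.all, .all h, fun S C x => ?_⟩
      simp only [realizeX_all, hφ', key]

theorem mem_modelsEq {τ : Vocab} {s : ℕ} {φ : (τ.langX s).Sentence} {S : FinStruct τ} {k : ℕ} :
    (S, k) ∈ modelsEq φ ↔ ∃ C, C.card = k ∧ realizeX S C φ Fin.elim0 := by
  have : (default : Fin 0 → Fin S.card) = Fin.elim0 := Subsingleton.elim _ _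
  rw [← this]
  rfl

/-- The matrix of a formula whose prefix is `aˡ`. -/
theorem exists_matrix_all {τ : Vocab} {s l : ℕ} : ∀ {n : ℕ}
    (φ : (τ.langX s).BoundedFormula Empty n), HasPattern (List.replicate l Quant.a) φ →
    ∃ ψ : QForm τ s (Fin n ⊕ Fin l), ∀ S C x, realizeX S C φ x ↔
      ∀ y : Fin l → Fin S.card, ψ.eval S (Sum.elim x y) (fun v => Sum.elim x y ∘ v ∈ C) := by
  induction l with
  | zero =>
    intro n φ hφ
    cases hφ with
    | qf hφ =>
      obtain ⟨ψ, hψ⟩ := exists_qform hφ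
      refine ⟨ψ.map Sum.inl, fun S C x => ?_⟩
      simp [hψ, QForm.eval_map, ← Function.comp_assoc]
  | succ l ih =>
    intro n φ hφ
    cases hφ with
    | all hφ =>
      obtain ⟨ψ, hψ⟩ := ih _ hφ
      -- The variable just quantified is the last of the outer variables and becomes the first one
      -- of the block.
      let g : Fin (n + 1) ⊕ Fin l → Fin n ⊕ Fin (l + 1) :=
        Sum.elim (Fin.snoc Sum.inl (Sum.inr 0)) (fun j => Sum.inr j.succ)
      have key : ∀ (U : Type) (x : Fin n → U) (z : U) (y : Fin l → U),
          Sum.elim x (Fin.cons z y : Fin (l + 1) → U) ∘ g =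
            Sum.elim (Fin.snoc x z : Fin (n + 1) → U) y := by
        intro U x z y
        ext i
        rcases i with i | i
        · refine Fin.lastCases ?_ (fun i => ?_) i <;> simp [g]
        · simp [g]
      refine ⟨ψ.map g, fun S C x => ?_⟩
      simp only [realizeX_all, hψ, QForm.eval_map, ← Function.comp_assoc, Fin.forall_fin_succ_pi,
        key]

/-- The matrix of a formula whose prefix is `eᵐa`. -/
theorem exists_matrix_ex_all {τ : Vocab} {s m : ℕ} : ∀ {n : ℕ}
    (φ : (τ.langX s).BoundedFormula Empty n),
    HasPattern (List.replicate m Quant.e ++ [Quant.a]) φ →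
    ∃ ψ : QForm τ s (Fin n ⊕ Option (Fin m)), ∀ S C x, realizeX S C φ x ↔
      ∃ y : Fin m → Fin S.card, ∀ z, ψ.eval S (Sum.elim x (fun o => o.elim z y))
        (fun v => Sum.elim x (fun o => o.elim z y) ∘ v ∈ C) := by
  induction m with
  | zero =>
    intro n φ hφ
    cases hφ with
    | all hφ =>
      cases hφ with
      | qf hφ =>
        obtain ⟨ψ, hψ⟩ := exists_qform hφ
        let g : Fin (n + 1) → Fin n ⊕ Option (Fin 0) := Fin.snoc Sum.inl (Sum.inr none)
        have key : ∀ (U : Type) (x : Fin n → U) (z : U) (y : Fin 0 → U),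
            Sum.elim x (fun o : Option (Fin 0) => o.elim z y) ∘ g =
              (Fin.snoc x z : Fin (n + 1) → U) := by
          intro U x z y
          ext i
          refine Fin.lastCases ?_ (fun i => ?_) i <;> simp [g]
        refine ⟨ψ.map g, fun S C x => ?_⟩
        simp only [realizeX_all, hψ, QForm.eval_map, ← Function.comp_assoc, key]
        exact ⟨fun h => ⟨Fin.elim0, h⟩, fun ⟨_, h⟩ => h⟩
  | succ m ih =>
    intro n φ hφ
    cases hφ with
    | ex hφ =>
      obtain ⟨ψ, hψ⟩ := ih _ hφ
      let g : Fin (n + 1) ⊕ Option (Fin m) → Fin n ⊕ Option (Fin (m + 1)) :=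
        Sum.elim (Fin.snoc Sum.inl (Sum.inr (some 0))) (fun j => Sum.inr (j.map Fin.succ))
      have key : ∀ (U : Type) (x : Fin n → U) (w z : U) (y : Fin m → U),
          Sum.elim x (fun o => o.elim z (Fin.cons w y : Fin (m + 1) → U)) ∘ g =
            Sum.elim (Fin.snoc x w : Fin (n + 1) → U) (fun o => o.elim z y) := by
        intro U x w z y
        ext i
        rcases i with i | i
        · refine Fin.lastCases ?_ (fun i => ?_) i <;> simp [g]
        · cases i <;> simp [g]
      refine ⟨ψ.map g, fun S C x => ?_⟩
      simp only [realizeX_ex, hψ, QForm.eval_map, ← Function.comp_assoc, Fin.exists_fin_succ_pi,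
        key]

end ParamESO

namespace ParamESO

/-! ### Building circuits -/

/-- `emb` embeds the gates of `C` into those of `C'`; the new gates have depth at most `d`. -/
structure GatesExt {N m m' : ℕ} (C : Gates N m) (C' : Gates N m') (d : ℕ)
    (emb : Fin m → Fin m') : Prop where
  eval : ∀ x i, C'.eval x (emb i) = C.eval x i
  depth : ∀ i, C'.depth (emb i) = C.depth i
  new : ∀ j, (∃ i, j = emb i) ∨ C'.depth j ≤ d

theorem GatesExt.refl {N m : ℕ} (C : Gates N m) (d : ℕ) : GatesExt C C d id :=
  ⟨fun _ _ => rfl, fun _ => rfl, fun j => .inl ⟨j, rfl⟩⟩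

theorem GatesExt.trans {N m m' m'' : ℕ} {C : Gates N m} {C' : Gates N m'} {C'' : Gates N m''}
    {d : ℕ} {emb : Fin m → Fin m'} {emb' : Fin m' → Fin m''} (h : GatesExt C C' d emb)
    (h' : GatesExt C' C'' d emb') : GatesExt C C'' d (emb' ∘ emb) where
  eval x i := by simp [h'.eval, h.eval]
  depth i := by simp [h'.depth, h.depth]
  new j := by
    rcases h'.new j with ⟨i, rfl⟩ | hj
    · rcases h.new i with ⟨i, rfl⟩ | hj
      · exact .inl ⟨i, rfl⟩
      · exact .inr (by rwa [h'.depth])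
    · exact .inr hj

theorem GatesExt.mono {N m m' : ℕ} {C : Gates N m} {C' : Gates N m'} {d d' : ℕ}
    {emb : Fin m → Fin m'} (h : GatesExt C C' d emb) (hd : d ≤ d') : GatesExt C C' d' emb :=
  ⟨h.eval, h.depth, fun j => (h.new j).imp_right fun h => h.trans hd⟩

theorem GatesExt.snoc {N m : ℕ} (C : Gates N m) (g : Gate N m) {d : ℕ}
    (hd : g.depth C.depth ≤ d) : GatesExt C (C.snoc g) d Fin.castSucc where
  eval x i := by simp [Gates.eval]
  depth i := by simp [Gates.depth]
  new j := by
    refine Fin.lastCases (.inr ?_) (fun i => .inl ⟨i, rfl⟩) j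
    simpa [Gates.depth] using hd

/-- The Boolean function `g` is computed by `s` gates of depth at most `d`, which can be added to
any circuit. -/
def HasCkt (N s d : ℕ) (g : (Fin N → Bool) → Prop) : Prop :=
  ∀ (m : ℕ) (C : Gates N m), ∃ m' ≤ m + s, ∃ (C' : Gates N m') (emb : Fin m → Fin m'),
    GatesExt C C' d emb ∧ ∃ j, C'.depth j ≤ d ∧ ∀ x, C'.eval x j = true ↔ g x

theorem HasCkt.mono {N s d s' d' : ℕ} {g : (Fin N → Bool) → Prop} (h : HasCkt N s d g)
    (hs : s ≤ s') (hd : d ≤ d') : HasCkt N s' d' g := by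
  intro m C
  obtain ⟨m', hm, C', emb, h, j, hj, hg⟩ := h m C
  exact ⟨m', by omega, C', emb, h.mono hd, j, hj.trans hd, hg⟩

theorem HasCkt.congr {N s d : ℕ} {g g' : (Fin N → Bool) → Prop} (h : HasCkt N s d g)
    (hg : ∀ x, g x ↔ g' x) : HasCkt N s d g' := by
  rwa [show g' = g from funext fun x => propext (hg x).symm]

theorem HasCkt.input {N : ℕ} (i : Fin N) : HasCkt N 1 0 (fun x => x i = true) := fun _ C =>
  ⟨_, le_rfl, C.snoc (.input i), _, .snoc C _ (by simp [Gate.depth]), Fin.last _,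
    by simp [Gates.depth, Gate.depth], by simp [Gates.eval, Gate.eval]⟩

theorem HasCkt.not {N s d : ℕ} {g : (Fin N → Bool) → Prop} (h : HasCkt N s d g) :
    HasCkt N (s + 1) (d + 1) (fun x => ¬ g x) := by
  intro m C
  obtain ⟨m', hm, C', emb, h, j, hj, hg⟩ := h m C
  refine ⟨m' + 1, by omega, C'.snoc (.neg j), _,
    (h.mono (Nat.le_succ d)).trans (.snoc C' _ (by simpa [Gate.depth] using hj)), Fin.last _,
    by simpa [Gates.depth, Gate.depth] using hj, fun x => ?_⟩
  simp [Gates.eval, Gate.eval, ← hg]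

/-- The circuits are appended one after another; the embeddings carry the output gates of the
earlier ones along, so that a single gate can finally read all of them. -/
theorem HasCkt.exists_family {N s d : ℕ} {ι : Type*} [Nonempty ι]
    {g : ι → (Fin N → Bool) → Prop} (h : ∀ i, HasCkt N s d (g i)) (t : Finset ι) (m : ℕ)
    (C : Gates N m) : ∃ m' ≤ m + t.card * s, ∃ (C' : Gates N m') (emb : Fin m → Fin m'),
      GatesExt C C' d emb ∧
        ∀ i ∈ t, ∃ j, C'.depth j ≤ d ∧ ∀ x, C'.eval x j = true ↔ g i x := by
  classical
  induction t using Finset.induction_on with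
  | empty => exact ⟨m, by simp, C, id, .refl C d, by simp⟩
  | insert i t hi ih =>
    obtain ⟨m', hm, C', emb, hC, ht⟩ := ih
    obtain ⟨m'', hm', C'', emb', hC', j, hj, hg⟩ := h i m' C'
    refine ⟨m'', ?_, C'', _, hC.trans hC', fun i' hi' => ?_⟩
    · rw [Finset.card_insert_of_notMem hi, Nat.add_mul]
      omega
    · rcases Finset.mem_insert.1 hi' with rfl | hi'
      · exact ⟨j, hj, hg⟩
      · obtain ⟨j, hj, hg⟩ := ht i' hi'
        exact ⟨emb' j, by rwa [hC'.depth], fun x => by rw [hC'.eval, hg]⟩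

theorem HasCkt.all {N s d : ℕ} {ι : Type*} [Fintype ι] {g : ι → (Fin N → Bool) → Prop}
    (h : ∀ i, HasCkt N s d (g i)) :
    HasCkt N (Fintype.card ι * s + 1) (d + 1) (fun x => ∀ i, g i x) := by
  intro m C
  rcases isEmpty_or_nonempty ι with hι | hι
  · exact ⟨m + 1, by omega, C.snoc (.conj ∅), _, .snoc C _ (by simp [Gate.depth]), Fin.last _,
      by simp [Gates.depth, Gate.depth], by simp [Gates.eval, Gate.eval]⟩
  obtain ⟨m', hm, C', emb, hC, ht⟩ := HasCkt.exists_family h Finset.univ m C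
  choose J hJ hg using fun i => ht i (Finset.mem_univ i)
  have hd : (Gate.conj (n := N) (Finset.univ.image J)).depth C'.depth ≤ d + 1 := by
    simpa [Gate.depth, Finset.sup_le_iff] using hJ
  refine ⟨m' + 1, ?_, C'.snoc (.conj (Finset.univ.image J)), _,
    (hC.mono (Nat.le_succ d)).trans (.snoc C' _ hd), Fin.last _, by simpa [Gates.depth] using hd,
    fun x => ?_⟩
  · rw [Finset.card_univ] at hm
    omega
  · simp [Gates.eval, Gate.eval, ← hg]

theorem HasCkt.ex {N s d : ℕ} {ι : Type*} [Fintype ι] {g : ι → (Fin N → Bool) → Prop}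
    (h : ∀ i, HasCkt N s d (g i)) :
    HasCkt N (Fintype.card ι * s + 1) (d + 1) (fun x => ∃ i, g i x) := by
  intro m C
  rcases isEmpty_or_nonempty ι with hι | hι
  · exact ⟨m + 1, by omega, C.snoc (.disj ∅), _, .snoc C _ (by simp [Gate.depth]), Fin.last _,
      by simp [Gates.depth, Gate.depth], by simp [Gates.eval, Gate.eval]⟩
  obtain ⟨m', hm, C', emb, hC, ht⟩ := HasCkt.exists_family h Finset.univ m C
  choose J hJ hg using fun i => ht i (Finset.mem_univ i)
  have hd : (Gate.disj (n := N) (Finset.univ.image J)).depth C'.depth ≤ d + 1 := by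
    simpa [Gate.depth, Finset.sup_le_iff] using hJ
  refine ⟨m' + 1, ?_, C'.snoc (.disj (Finset.univ.image J)), _,
    (hC.mono (Nat.le_succ d)).trans (.snoc C' _ hd), Fin.last _, by simpa [Gates.depth] using hd,
    fun x => ?_⟩
  · rw [Finset.card_univ] at hm
    omega
  · simp [Gates.eval, Gate.eval, ← hg]

/-- Constants are gates of fan-in zero: the empty conjunction and the empty disjunction. -/
theorem HasCkt.const {N : ℕ} (P : Prop) : HasCkt N 1 1 (fun _ => P) := by
  by_cases hP : P
  · exact ((HasCkt.all (ι := Empty) (s := 0) (d := 0) (g := fun _ _ => True)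
      (fun i => i.elim)).mono (by simp) le_rfl).congr (by simp [hP])
  · exact ((HasCkt.ex (ι := Empty) (s := 0) (d := 0) (g := fun _ _ => True)
      (fun i => i.elim)).mono (by simp) le_rfl).congr (by simp [hP])

theorem HasCkt.and {N s s' d : ℕ} {g g' : (Fin N → Bool) → Prop} (h : HasCkt N s d g)
    (h' : HasCkt N s' d g') : HasCkt N (2 * (s + s') + 1) (d + 1) (fun x => g x ∧ g' x) :=
  ((HasCkt.all (ι := Bool) (g := fun b => if b then g else g') (s := s + s') (d := d) (by
    rintro (_ | _)
    · exact h'.mono (by omega) le_rfl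
    · exact h.mono (by omega) le_rfl)).mono (by simp) le_rfl).congr (by simp [and_comm])

theorem HasCkt.or {N s s' d : ℕ} {g g' : (Fin N → Bool) → Prop} (h : HasCkt N s d g)
    (h' : HasCkt N s' d g') : HasCkt N (2 * (s + s') + 1) (d + 1) (fun x => g x ∨ g' x) :=
  ((HasCkt.ex (ι := Bool) (g := fun b => if b then g else g') (s := s + s') (d := d) (by
    rintro (_ | _)
    · exact h'.mono (by omega) le_rfl
    · exact h.mono (by omega) le_rfl)).mono (by simp) le_rfl).congr (by simp [or_comm])

/-- The result may sit anywhere among the gates, so a one-input conjunction copies it to the last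
position. -/
theorem HasCkt.exists_circuit {N s d : ℕ} {g : (Fin N → Bool) → Prop} (h : HasCkt N s d g) :
    ∃ C : Circuit N, C.size ≤ s + 1 ∧ C.depth ≤ d + 1 ∧ ∀ x, C.eval x = true ↔ g x := by
  obtain ⟨m', hm, C', emb, h, j, hj, hg⟩ := h 0 .nil
  refine ⟨⟨m', C'.snoc (.conj {j})⟩, ?_, ?_, fun x => ?_⟩
  · simpa [Circuit.size] using hm
  · refine Finset.sup_le fun i _ => ?_
    refine Fin.lastCases ?_ (fun i => ?_) i
    · simpa [Gates.depth, Gate.depth] using hj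
    · rcases h.new i with ⟨i, -⟩ | hi
      · exact i.elim0
      · simpa [Gates.depth] using hi.trans (Nat.le_succ d)
  · simp [Circuit.eval, Gates.eval, Gate.eval, ← hg]

/-! ### Threshold functions -/

theorem exists_testBit_ne {n a b : ℕ} (ha : a < n) (hb : b < n) (hab : a ≠ b) :
    ∃ i < n.size, a.testBit i ≠ b.testBit i := by
  by_contra! h
  refine hab (Nat.eq_of_testBit_eq fun i => ?_)
  by_cases hi : i < n.size
  · exact h i hi
  · have hn : n < 2 ^ i := (Nat.lt_size_self n).trans_le (Nat.pow_le_pow_right (by norm_num) (by omega))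
    rw [Nat.testBit_lt_two_pow (ha.trans hn), Nat.testBit_lt_two_pow (hb.trans hn)]

/-- At least `k` positions satisfy `P` iff some choice of `k²` bit positions tells `k` of them
apart. -/
theorem le_card_iff_exists_hash {n k : ℕ} (P : Fin n → Prop) [DecidablePred P] :
    k ≤ (Finset.univ.filter P).card ↔
      ∃ pc : (Fin k × Fin k → Fin n.size) × {c : Fin k → (Fin k × Fin k → Bool) //
        Function.Injective c},
        ∀ j, ∃ i : {i : Fin n // ∀ r, i.1.testBit (pc.1 r) = pc.2.1 j r}, P i.1 := by
  constructor
  · intro h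
    obtain ⟨t, ht, hk⟩ := Finset.exists_subset_card_eq h
    let e := (t.equivFinOfCardEq hk).symm
    have hn : k ≠ 0 → 0 < n.size := by
      intro hk
      rw [Nat.size_pos]
      exact (e ⟨0, by omega⟩).1.pos
    -- One digit position for each pair of the `k` elements, where the two differ; this is where
    -- `k²` comes from. Diagonal pairs get an arbitrary position.
    have : ∀ r : Fin k × Fin k, ∃ i : Fin n.size, r.1 ≠ r.2 →
        (e r.1).1.1.testBit i ≠ (e r.2).1.1.testBit i := by
      intro r
      by_cases hr : r.1 = r.2
      · exact ⟨⟨0, hn (by have := r.1.2; omega)⟩, fun h => (h hr).elim⟩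
      · obtain ⟨i, hi, h⟩ := exists_testBit_ne (e r.1).1.2 (e r.2).1.2
          (fun h => hr (e.injective (Subtype.ext (Fin.ext h))))
        exact ⟨⟨i, hi⟩, fun _ => h⟩
    choose pos hpos using this
    refine ⟨⟨pos, fun j r => (e j).1.1.testBit (pos r), fun j j' h => ?_⟩, fun j =>
      ⟨⟨(e j).1, fun r => rfl⟩, (Finset.mem_filter.1 (ht (e j).2)).2⟩⟩
    by_contra hjj
    exact hpos (j, j') hjj (congrFun h (j, j'))
  · rintro ⟨⟨pos, c, hc⟩, h⟩
    choose i hi using h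
    -- Witnesses for different `j` show different digit patterns, hence are different elements.
    have hinj : Function.Injective fun j => (i j).1 := by
      intro j j' h
      refine hc (funext fun r => ?_)
      have h1 := (i j).2 r
      have h2 := (i j').2 r
      simp only at h h1 h2
      rw [← h1, ← h2, h]
    calc k = (Finset.univ.image fun j => (i j).1).card := by
          rw [Finset.card_image_of_injective _ hinj, Finset.card_fin]
      _ ≤ _ := Finset.card_le_card fun a ha => by
          obtain ⟨j, -, rfl⟩ := Finset.mem_image.1 ha
          simpa using hi j

/-- The hashing criterion is a disjunction of conjunctions of disjunctions, so it costs three levels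
regardless of `k`; the outer disjunction ranges over digit positions and injective assignments of
patterns. -/
theorem HasCkt.threshold {N n s d k : ℕ} {g : Fin n → (Fin N → Bool) → Prop}
    [∀ x, DecidablePred fun i => g i x] (h : ∀ i, HasCkt N s d (g i)) :
    HasCkt N (n.size ^ (k * k) * (2 ^ (k * k)) ^ k * (k * (n * s + 1) + 1) + 1) (d + 3)
      (fun x => k ≤ (Finset.univ.filter fun i => g i x).card) := by
  classical
  refine HasCkt.congr (g := fun x => ∃ pc : (Fin k × Fin k → Fin n.size) ×
    {c : Fin k → (Fin k × Fin k → Bool) // Function.Injective c},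
      ∀ j, ∃ i : {i : Fin n // ∀ r, i.1.testBit (pc.1 r) = pc.2.1 j r}, g i.1 x) ?_
    (fun x => (le_card_iff_exists_hash fun i => g i x).symm)
  have h1 : ∀ (pc : (Fin k × Fin k → Fin n.size) ×
    {c : Fin k → (Fin k × Fin k → Bool) // Function.Injective c}) (j : Fin k),
      HasCkt N (n * s + 1) (d + 1)
        (fun x => ∃ i : {i : Fin n // ∀ r, i.1.testBit (pc.1 r) = pc.2.1 j r}, g i.1 x) := by
    intro pc j
    refine (HasCkt.ex (ι := {i : Fin n // ∀ r, i.1.testBit (pc.1 r) = pc.2.1 j r})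
      fun i => h i.1).mono ?_ le_rfl
    have := Fintype.card_subtype_le fun i : Fin n => ∀ r, i.1.testBit (pc.1 r) = pc.2.1 j r
    rw [Fintype.card_fin] at this
    gcongr
  refine (HasCkt.ex fun pc => HasCkt.all fun j => h1 pc j).mono ?_ le_rfl
  rw [Fintype.card_prod, Fintype.card_fin]
  have := Fintype.card_subtype_le
    fun c : Fin k → (Fin k × Fin k → Bool) => Function.Injective c
  simp only [Fintype.card_fun, Fintype.card_prod, Fintype.card_fin, Fintype.card_bool] at this ⊢
  gcongr

/-- Divide `L` into `e` parts: `L ≤ e * (L / e + 1) ≤ e * 2 ^ (L / e)`, and take the `e`-th power.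
-/
theorem pow_le_pow_self_mul_two_pow (L e : ℕ) : L ^ e ≤ e ^ e * 2 ^ L := by
  rcases Nat.eq_zero_or_pos e with rfl | he
  · simpa using Nat.one_le_two_pow
  have h1 : L ≤ e * 2 ^ (L / e) := by
    have h2 : L / e + 1 ≤ 2 ^ (L / e) := Nat.lt_two_pow_self
    calc L ≤ e * (L / e + 1) := (Nat.lt_mul_div_succ L he).le
      _ ≤ _ := Nat.mul_le_mul_left e h2
  calc L ^ e ≤ (e * 2 ^ (L / e)) ^ e := Nat.pow_le_pow_left h1 e
    _ = e ^ e * 2 ^ (L / e * e) := by rw [mul_pow, pow_mul]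
    _ ≤ _ := by
      gcongr
      · norm_num
      · exact Nat.div_mul_le_self L e

/-- A power of the logarithm whose exponent depends on the parameter is still of the form `f(k) ·
n`. -/
theorem size_pow_le (n e : ℕ) (hn : 0 < n) : n.size ^ e ≤ e ^ e * (2 * n) := by
  refine (pow_le_pow_self_mul_two_pow _ _).trans (Nat.mul_le_mul_left _ ?_)
  have h : 2 ^ (n.size - 1) ≤ n := Nat.lt_size.1 (by have := Nat.size_pos.2 hn; omega)
  calc 2 ^ n.size = 2 * 2 ^ (n.size - 1) := by
        rw [← pow_succ', Nat.sub_add_cancel (Nat.size_pos.2 hn)]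
    _ ≤ _ := by omega

/-! ### The encoding of structures -/

theorem getElem?_flatMap_finRange {β : Type*} {m : ℕ} (f : Fin m → List β) (i : Fin m) (t : ℕ)
    (ht : t < (f i).length) :
    ((List.finRange m).flatMap f)[(∑ j, if j < i then (f j).length else 0) + t]? = (f i)[t]? := by
  induction m with
  | zero => exact i.elim0
  | succ m ih =>
    rw [List.finRange_succ, List.flatMap_cons, List.flatMap_map, Fin.sum_univ_succ]
    refine Fin.cases ?_ (fun i => ?_) i (motive := fun i => t < (f i).length →
      (f 0 ++ (List.finRange m).flatMap fun j => f j.succ)[(if 0 < i then (f 0).length else 0) +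
        (∑ j : Fin m, if j.succ < i then (f j.succ).length else 0) + t]? = (f i)[t]?) ht
    · intro ht
      simp [List.getElem?_append_left ht]
    · intro ht
      rw [if_pos i.succ_pos, add_assoc, List.getElem?_append_right (Nat.le_add_right _ _),
        Nat.add_sub_cancel_left]
      simpa using ih (fun j => f j.succ) i ht

/-- The length of the encoding of a structure with `n` elements. -/
def structLen (τ : Vocab) (n : ℕ) : ℕ := n + 1 + ∑ i, n ^ τ.arity i

/-- The position of the truth table of the relation `i` in the encoding of a structure with `n`
elements. -/
def relPos (τ : Vocab) (n : ℕ) (i : Fin τ.num) : ℕ :=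
  n + 1 + ∑ j, if j < i then n ^ τ.arity j else 0

theorem length_encode {τ : Vocab} (S : FinStruct τ) :
    S.encode.length = structLen τ S.card := by
  have : ∀ m (f : Fin m → ℕ), (List.map f (List.finRange m)).sum = ∑ i, f i := by
    intro m f
    rw [← List.ofFn_eq_map, List.sum_ofFn]
  simp [FinStruct.encode, structLen, List.length_flatMap, this]
  ring

/-- The length of an encoding determines the number of elements, so a circuit for a given length
knows the universe. -/
theorem structLen_strictMono (τ : Vocab) : StrictMono (structLen τ) := by
  intro a b h
  have : ∑ i, a ^ τ.arity i ≤ ∑ i, b ^ τ.arity i :=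
    Finset.sum_le_sum fun i _ => Nat.pow_le_pow_left h.le _
  simp only [structLen]
  omega

theorem encode_getElem?_rel {τ : Vocab} (S : FinStruct τ) (i : Fin τ.num)
    (v : Fin (τ.arity i) → Fin S.card) :
    S.encode[relPos τ S.card i + finFunctionFinEquiv v]? = some (S.rel i v) := by
  have h := getElem?_flatMap_finRange (fun i => List.ofFn fun t : Fin (S.card ^ τ.arity i) =>
    S.rel i (finFunctionFinEquiv.symm t)) i (finFunctionFinEquiv v)
    (by rw [List.length_ofFn]; exact (finFunctionFinEquiv v).2)
  simp only [List.length_ofFn] at h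
  rw [FinStruct.encode, List.getElem?_append_right (by simp [relPos]; omega),
    List.length_replicate, relPos, show S.card + 1 + (∑ j, if j < i then S.card ^ τ.arity j else 0) +
      (finFunctionFinEquiv v : ℕ) - S.card = ((∑ j, if j < i then S.card ^ τ.arity j else 0) +
      (finFunctionFinEquiv v : ℕ)) + 1 by omega, List.getElem?_cons_succ, h,
    List.getElem?_ofFn, dif_pos (finFunctionFinEquiv v).2]
  simp only [Fin.eta, Equiv.symm_apply_apply]

theorem encode_getElem?_lt {τ : Vocab} (S : FinStruct τ) {j : ℕ} (hj : j < S.card) :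
    S.encode[j]? = some true := by
  rw [FinStruct.encode, List.getElem?_append_left (by simpa using hj)]
  simp [hj]

theorem encode_getElem?_card {τ : Vocab} (S : FinStruct τ) :
    S.encode[S.card]? = some false := by
  rw [FinStruct.encode, List.getElem?_append_right (by simp)]
  simp

/-! ### The upper bound -/

/-- The structure with `n` elements that is encoded by `x`. -/
def ofBits (τ : Vocab) (n : ℕ) (hn : 0 < n) (x : ℕ → Bool) : FinStruct τ where
  card := n
  card_pos := hn
  rel i v := x (relPos τ n i + finFunctionFinEquiv v)

/-- A word, continued by zeros. -/
def extendBits {N : ℕ} (x : Fin N → Bool) (i : ℕ) : Bool := if h : i < N then x ⟨i, h⟩ else false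

theorem ofBits_encode {τ : Vocab} (S : FinStruct τ) :
    ofBits τ S.card S.card_pos (extendBits S.encode.get) = S := by
  rcases S with ⟨n, hn, r⟩
  simp only [ofBits, FinStruct.mk.injEq, heq_eq_eq, true_and]
  funext i v
  have h := encode_getElem?_rel ⟨n, hn, r⟩ i v
  obtain ⟨h1, h2⟩ := List.getElem?_eq_some_iff.1 h
  simp only [extendBits]
  rw [dif_pos h1]
  exact h2

/-- Since the values of the variables are fixed in advance, equalities and atoms of `X` are
constants and a relation atom is a single input bit; size and depth depend on `ψ` alone. -/
theorem HasCkt.qform {τ : Vocab} {s : ℕ} {V : Type} (ψ : QForm τ s V) : ∃ s₀ d₀, ∀ (N n : ℕ)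
    (hn : 0 < n) (y : V → Fin n) (Y : (Fin s → V) → Prop),
      HasCkt N s₀ d₀ (fun x => ψ.eval (ofBits τ n hn (extendBits x)) y Y) := by
  induction ψ with
  | fls => exact ⟨1, 1, fun _ _ _ _ _ => .const _⟩
  | eq i j => exact ⟨1, 1, fun _ _ _ y _ => .const (y i = y j)⟩
  | mem v => exact ⟨1, 1, fun _ _ _ _ _ => .const _⟩
  | rel i v =>
    refine ⟨1, 1, fun N n hn y Y => ?_⟩
    simp only [QForm.eval, ofBits, extendBits]
    split_ifs with h
    · exact (HasCkt.input _).mono le_rfl zero_le_one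
    · exact .const _
  | imp φ ψ h h' =>
    obtain ⟨s, d, h⟩ := h
    obtain ⟨s', d', h'⟩ := h'
    refine ⟨_, _, fun N n hn y Y => (((h N n hn y Y).not.mono le_rfl (le_max_left (d + 1) d')).or
      ((h' N n hn y Y).mono le_rfl (le_max_right (d + 1) d'))).congr fun x => ?_⟩
    simp only [QForm.eval]
    exact imp_iff_not_or.symm

/-- A set of `k` elements that satisfies `∃x₁…∃xₘ∀y ψ` exists iff it can be found between the
elements that must belong to it and the elements that may belong to it. -/
theorem exists_set_iff {τ : Vocab} {m : ℕ} (ψ : QForm τ 1 (Option (Fin m))) (S : FinStruct τ)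
    (k : ℕ) (I O : (Fin m → Fin S.card) → (Fin m → Bool) → Fin S.card → Prop)
    (hI : ∀ y b z, I y b z ↔ (∀ i, y i = z → b i = true) ∧
      ψ.eval S (fun o => o.elim z y) (fun v => (v 0).elim True (fun i => b i = true)))
    (hO : ∀ y b z, O y b z ↔ (∀ i, y i = z → b i = false) ∧
      ψ.eval S (fun o => o.elim z y) (fun v => (v 0).elim False (fun i => b i = true)))
    [∀ y b, DecidablePred (I y b)] [∀ y b, DecidablePred (O y b)] :
    (∃ C : Finset (Fin 1 → Fin S.card), C.card = k ∧ ∃ y : Fin m → Fin S.card, ∀ z,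
      ψ.eval S (fun o => o.elim z y) (fun v => (fun o => o.elim z y) ∘ v ∈ C)) ↔
    ∃ yb : (Fin m → Fin S.card) × (Fin m → Bool), ((∀ z, I yb.1 yb.2 z ∨ O yb.1 yb.2 z) ∧
      k ≤ (Finset.univ.filter fun z => I yb.1 yb.2 z).card) ∧
      ¬ k + 1 ≤ (Finset.univ.filter fun z => ¬ O yb.1 yb.2 z).card := by
  classical
  have key : ∀ (C : Finset (Fin 1 → Fin S.card)) (y : Fin m → Fin S.card) (z : Fin S.card)
      (v : Fin 1 → Option (Fin m)), ((fun o : Option (Fin m) => o.elim z y) ∘ v ∈ C) ↔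
        (v 0).elim ((fun _ => z) ∈ C) (fun i => (fun _ => y i) ∈ C) := by
    intro C y z v
    have : (fun o : Option (Fin m) => o.elim z y) ∘ v = fun _ => (v 0).elim z y := by
      funext i
      rw [Subsingleton.elim i 0]
      rfl
    rw [this]
    cases v 0 <;> rfl
  constructor
  · rintro ⟨C, rfl, y, h⟩
    -- The correct guess is the actual membership of the `y i` in `C`.
    let b : Fin m → Bool := fun i => decide ((fun _ => y i) ∈ C)
    have hin : ∀ z, (fun _ => z) ∈ C → I y b z := by
      intro z hz
      refine (hI _ _ _).2 ⟨?_, ?_⟩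
      · rintro i rfl
        simpa [b] using hz
      · refine (QForm.eval_congr S rfl (fun v => ?_) ψ).1 (h z)
        rw [key]
        cases v 0 <;> simp [b, hz]
    have hout : ∀ z, (fun _ => z) ∉ C → O y b z := by
      intro z hz
      refine (hO _ _ _).2 ⟨?_, ?_⟩
      · rintro i rfl
        simpa [b] using hz
      · refine (QForm.eval_congr S rfl (fun v => ?_) ψ).1 (h z)
        rw [key]
        cases v 0 <;> simp [b, hz]
    have hC : (Finset.univ.filter fun z : Fin S.card => (fun _ => z) ∈ C).card = C.card := by
      refine Finset.card_bij (fun z _ _ => z) (fun z hz => by simpa using hz)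
        (fun z _ z' _ h => congrFun h 0) (fun c hc => ⟨c 0, ?_, ?_⟩)
      · simpa [show (fun _ => c 0) = c from funext fun i => by rw [Subsingleton.elim i 0]] using hc
      · exact funext fun i => by rw [Subsingleton.elim i 0]
    refine ⟨⟨y, b⟩, ⟨fun z => ?_, ?_⟩, ?_⟩
    · by_cases hz : (fun _ => z) ∈ C
      · exact .inl (hin z hz)
      · exact .inr (hout z hz)
    · rw [← hC]
      exact Finset.card_le_card fun z hz => by simpa using hin z (by simpa using hz)
    · rw [Nat.succ_le_iff, not_lt, ← hC]
      refine Finset.card_le_card fun z hz => ?_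
      simp only [Finset.mem_filter, Finset.mem_univ, true_and] at hz ⊢
      exact by_contra fun h => hz (hout z h)
  · rintro ⟨⟨y, b⟩, ⟨h1, h2⟩, h3⟩
    -- The elements that may not be outside are among those that may be inside, so a set of size
    -- exactly `k` fits between the two.
    obtain ⟨D, hD1, hD2, hD3⟩ := Finset.exists_subsuperset_card_eq
      (s := Finset.univ.filter fun z => ¬ O y b z) (t := Finset.univ.filter fun z => I y b z)
      (n := k) (fun z hz => by
        simp only [Finset.mem_filter, Finset.mem_univ, true_and] at hz ⊢
        exact (h1 z).resolve_right hz) (Nat.lt_succ_iff.1 (not_le.1 h3)) h2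
    refine ⟨D.image fun z _ => z, ?_, y, fun z => ?_⟩
    · rw [Finset.card_image_of_injective _ fun z z' h => congrFun h 0, hD3]
    have hmem : ∀ z : Fin S.card, (fun _ => z) ∈ (D.image fun z (_ : Fin 1) => z) ↔ z ∈ D := by
      intro z
      simp only [Finset.mem_image]
      exact ⟨fun ⟨a, ha, h⟩ => by rwa [← congrFun h 0], fun h => ⟨z, h, rfl⟩⟩
    -- The clauses on the bits in `I` and `O` force `D` to agree with the guess on every `y i`; thus
    -- the truth values used in `I` and `O` are those of `D`.
    have hb : ∀ i, y i ∈ D ↔ b i = true := by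
      intro i
      constructor
      · intro h
        have := hD2 h
        simp only [Finset.mem_filter, Finset.mem_univ, true_and, hI] at this
        exact this.1 i rfl
      · intro h
        refine hD1 ?_
        simp only [Finset.mem_filter, Finset.mem_univ, true_and, hO]
        exact fun h' => by simpa [h] using h'.1 i rfl
    by_cases hz : z ∈ D
    · have := hD2 hz
      simp only [Finset.mem_filter, Finset.mem_univ, true_and, hI] at this
      refine (QForm.eval_congr S rfl (fun v => ?_) ψ).1 this.2
      rw [key]
      cases v 0 <;> simp [hz, hmem, hb]
    · have : O y b z := by_contra fun h => hz (hD1 (by simpa using h))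
      rw [hO] at this
      refine (QForm.eval_congr S rfl (fun v => ?_) ψ).1 this.2
      rw [key]
      cases v 0 <;> simp [hz, hmem, hb]

/-- A bound for the sizes of the threshold circuits. -/
def thresholdBound (s k : ℕ) : ℕ :=
  (k * k) ^ (k * k) * 2 * (2 ^ (k * k)) ^ k * (k + 1) * (s + 2) + 1

theorem HasCkt.threshold' {N n s d k : ℕ} (hn : 0 < n) {g : Fin n → (Fin N → Bool) → Prop}
    [∀ x, DecidablePred fun i => g i x] (h : ∀ i, HasCkt N s d (g i)) :
    HasCkt N (thresholdBound s k * n ^ 2) (d + 3)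
      (fun x => k ≤ (Finset.univ.filter fun i => g i x).card) := by
  refine (HasCkt.threshold h).mono ?_ le_rfl
  have h1 := size_pow_le n (k * k) hn
  have h2 : k * (n * s + 1) + 1 ≤ (k + 1) * (s + 2) * n := by nlinarith [Nat.zero_le (k * n)]
  calc _ ≤ (k * k) ^ (k * k) * (2 * n) * (2 ^ (k * k)) ^ k * ((k + 1) * (s + 2) * n) + 1 * n ^ 2 := by
        gcongr
        nlinarith
    _ = _ := by rw [thresholdBound]; ring

theorem computable_pow {f g : ℕ → ℕ} (hf : Primrec f) (hg : Primrec g) :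
    Primrec fun k => f k ^ g k := by
  have h : Primrec (Nat.unpaired fun a b : ℕ => a ^ b) := Primrec.nat_iff.2 Nat.Primrec.pow
  have := h.comp ((Primrec₂.natPair).comp hf hg)
  simpa using this

theorem primrec_thresholdBound (s : ℕ) : Primrec (thresholdBound s) := by
  have hk : Primrec fun k : ℕ => k * k := Primrec.nat_mul.comp .id .id
  exact Primrec.nat_add.comp (Primrec.nat_mul.comp (Primrec.nat_mul.comp (Primrec.nat_mul.comp
    (Primrec.nat_mul.comp (computable_pow hk hk) (.const 2))
    (computable_pow (computable_pow (.const 2) hk) .id)) (Primrec.nat_add.comp .id (.const 1)))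
    (.const (s + 2))) (.const 1)

/-- It suffices to give circuits for each universe size `n`, because the input length recovers `n`,
and `n` is at most that length. -/
theorem inParaAC0_of_circuits {τ : Vocab} {Q : Problem τ} {d c : ℕ} {f : ℕ → ℕ}
    (hf : Computable f) (h : ∀ n k, 0 < n → ∃ g : (Fin (structLen τ n) → Bool) → Prop,
      HasCkt (structLen τ n) (f k * n ^ c) d g ∧ ∀ x : Fin (structLen τ n) → Bool, ∀ hn : 0 < n,
        g x ↔ (ofBits τ n hn (extendBits x), k) ∈ Q) :
    InParaAC0 Q := by
  have main : ∀ N k, ∃ C : Circuit N, C.depth ≤ d + 2 ∧ (0 < N → C.size ≤ (f k + 2) * N ^ c) ∧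
      ∀ S : FinStruct τ, ∀ hS : structLen τ S.card = N, ∀ x : Fin N → Bool,
        (∀ i, S.encode[i.1]? = some (x i)) → ((S, k) ∈ Q ↔ C.eval x = true) := by
    intro N k
    by_cases hN : ∃ n, 0 < n ∧ structLen τ n = N
    · obtain ⟨n, hn, rfl⟩ := hN
      obtain ⟨g, hg, hQ⟩ := h n k hn
      obtain ⟨C, hs, hd, hC⟩ := hg.exists_circuit
      refine ⟨C, hd.trans (Nat.le_succ _), fun hN => hs.trans ?_, fun S hS x hx => ?_⟩
      · have h1 : n ^ c ≤ structLen τ n ^ c := Nat.pow_le_pow_left (by rw [structLen]; omega) c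
        have h2 : 1 ≤ structLen τ n ^ c := Nat.one_le_pow _ _ hN
        nlinarith [Nat.mul_le_mul_left (f k) h1]
      · obtain rfl := (structLen_strictMono τ).injective hS
        rw [hC, hQ x S.card_pos, show extendBits x = extendBits S.encode.get from ?_, ofBits_encode]
        funext i
        simp only [extendBits, ← length_encode]
        split_ifs with hi
        · have := hx ⟨i, by rwa [← length_encode]⟩
          rw [List.getElem?_eq_getElem hi] at this
          exact (Option.some.inj this).symm
        · rfl
    -- No structure has an encoding of this length, so any circuit will do.
    · obtain ⟨C, hs, hd, -⟩ := (HasCkt.const (N := N) True).exists_circuit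
      refine ⟨C, hd.trans (by omega), fun h => hs.trans ?_,
        fun S hS => (hN ⟨_, S.card_pos, hS⟩).elim⟩
      have := Nat.one_le_pow c N h
      nlinarith [Nat.zero_le (f k * N ^ c)]
  choose C hd hs hC using main
  refine ⟨C, d + 2, c, fun k => f k + 2, ?_, hd, fun n k => hs n k, fun S k => ?_⟩
  · exact (Primrec.nat_add.comp .id (.const 2)).to_comp.comp hf
  · refine hC _ k S (length_encode S).symm _ fun i => ?_
    rw [List.getElem?_eq_getElem i.2]
    rfl

/-- The guess of `y` and `b` is a disjunction over `n ^ m * 2 ^ m` cases of the criterion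
`exists_set_iff`. The predicate `P` is the restriction to a class of graphs. -/
theorem hasPattern_inParaAC0 {τ : Vocab} {m : ℕ} {φ : (τ.langX 1).Sentence}
    (hφ : HasPattern (List.replicate m Quant.e ++ [Quant.a]) φ) (P : FinStruct τ → Prop)
    {sP dP cP : ℕ} (hP : ∀ n (hn : 0 < n), HasCkt (structLen τ n) (sP * n ^ cP) dP
      (fun x => P (ofBits τ n hn (extendBits x)))) :
    InParaAC0 (modelsEq φ ∩ {x | P x.1}) := by
  classical
  obtain ⟨ψ₀, hψ₀⟩ := exists_matrix_ex_all φ hφ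
  let ψ : QForm τ 1 (Option (Fin m)) := ψ₀.map (Sum.elim Fin.elim0 id)
  have hψ : ∀ S C, realizeX S C φ Fin.elim0 ↔ ∃ y : Fin m → Fin S.card, ∀ z,
      ψ.eval S (fun o => o.elim z y) (fun v => (fun o => o.elim z y) ∘ v ∈ C) := by
    intro S C
    rw [hψ₀]
    refine exists_congr fun y => forall_congr' fun z => ?_
    have : (fun o : Option (Fin m) => o.elim z y) ∘ (Sum.elim Fin.elim0 id) =
        Sum.elim Fin.elim0 (fun o : Option (Fin m) => o.elim z y) := by
      funext i
      rcases i with i | i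
      · exact i.elim0
      · rfl
    rw [QForm.eval_map]
    simp only [← Function.comp_assoc, this]
  obtain ⟨s₀, d₀, h₀⟩ := HasCkt.qform ψ
  let s₁ := 2 * (1 + s₀) + 1 + 1
  -- The generous constants absorb the factors `2` of the nested binary connectives.
  let T : ℕ → ℕ := fun k => 100 * s₁ + 10 * thresholdBound s₁ k + 10 * thresholdBound s₁ (k + 1)
  let d₁ := max 1 d₀ + 2
  let f : ℕ → ℕ := fun k => 2 * (2 ^ m * T k + 1 + sP) + 1
  have hf : Computable f := by
    have hT : Primrec T := Primrec.nat_add.comp (Primrec.nat_add.comp (.const _)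
      (Primrec.nat_mul.comp (.const 10) (primrec_thresholdBound _)))
      (Primrec.nat_mul.comp (.const 10) ((primrec_thresholdBound _).comp .succ))
    exact (Primrec.nat_add.comp (Primrec.nat_mul.comp (.const 2) (Primrec.nat_add.comp
      (Primrec.nat_add.comp (Primrec.nat_mul.comp (.const (2 ^ m)) hT) (.const 1)) (.const sP)))
      (.const 1)).to_comp
  refine inParaAC0_of_circuits (d := max (d₁ + 6) dP + 1) (c := m + 2 + cP) hf fun n k hn => ?_
  obtain ⟨I, hI₀⟩ : ∃ I : (Fin m → Fin n) → (Fin m → Bool) → Fin n →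
      (Fin (structLen τ n) → Bool) → Prop, ∀ y b z x, I y b z x ↔ (∀ i, y i = z → b i = true) ∧
        ψ.eval (ofBits τ n hn (extendBits x)) (fun o => o.elim z y)
          (fun v => (v 0).elim True (fun i => b i = true)) := ⟨_, fun _ _ _ _ => Iff.rfl⟩
  obtain ⟨O, hO₀⟩ : ∃ O : (Fin m → Fin n) → (Fin m → Bool) → Fin n →
      (Fin (structLen τ n) → Bool) → Prop, ∀ y b z x, O y b z x ↔ (∀ i, y i = z → b i = false) ∧
        ψ.eval (ofBits τ n hn (extendBits x)) (fun o => o.elim z y)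
          (fun v => (v 0).elim False (fun i => b i = true)) := ⟨_, fun _ _ _ _ => Iff.rfl⟩
  have hI : ∀ y b z, HasCkt (structLen τ n) s₁ d₁ (I y b z) := fun y b z =>
    ((((HasCkt.const (∀ i, y i = z → b i = true)).mono le_rfl (le_max_left _ _)).and
      ((h₀ _ n hn (fun o => o.elim z y) fun v => (v 0).elim True fun i => b i = true).mono le_rfl (le_max_right _ _))).mono (Nat.le_succ _) (Nat.le_succ _)).congr
        fun x => (hI₀ y b z x).symm
  -- One gate and one level are left over for the negation in `hnO`.
  have hO' : ∀ y b z, HasCkt (structLen τ n) (s₁ - 1) (d₁ - 1) (O y b z) := fun y b z =>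
    (((HasCkt.const (∀ i, y i = z → b i = false)).mono le_rfl (le_max_left _ _)).and
      ((h₀ _ n hn (fun o => o.elim z y) fun v => (v 0).elim False fun i => b i = true).mono le_rfl (le_max_right _ _))).congr fun x => (hO₀ y b z x).symm
  have hO : ∀ y b z, HasCkt (structLen τ n) s₁ d₁ (O y b z) := fun y b z =>
    (hO' y b z).mono (Nat.sub_le _ _) (Nat.sub_le _ _)
  have hnO : ∀ y b z, HasCkt (structLen τ n) s₁ d₁ (fun x => ¬ O y b z x) := fun y b z =>
    (hO' y b z).not
  refine ⟨fun x => (∃ yb : (Fin m → Fin n) × (Fin m → Bool), ((∀ z, I yb.1 yb.2 z x ∨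
    O yb.1 yb.2 z x) ∧ k ≤ (Finset.univ.filter fun z => I yb.1 yb.2 z x).card) ∧
      ¬ k + 1 ≤ (Finset.univ.filter fun z => ¬ O yb.1 yb.2 z x).card) ∧
      P (ofBits τ n hn (extendBits x)), ?_, fun x _ => ?_⟩
  · have hall : ∀ y b, HasCkt (structLen τ n) (n * (2 * (s₁ + s₁) + 1) + 1) (d₁ + 3)
        (fun x => ∀ z, I y b z x ∨ O y b z x) := fun y b =>
      (HasCkt.all fun z => (hI y b z).or (hO y b z)).mono (by rw [Fintype.card_fin]) (by omega)
    have h1 : ∀ yb : (Fin m → Fin n) × (Fin m → Bool), HasCkt (structLen τ n) (T k * n ^ 2) (d₁ + 5)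
        (fun x => ((∀ z, I yb.1 yb.2 z x ∨
    O yb.1 yb.2 z x) ∧ k ≤ (Finset.univ.filter fun z => I yb.1 yb.2 z x).card) ∧
      ¬ k + 1 ≤ (Finset.univ.filter fun z => ¬ O yb.1 yb.2 z x).card) := by
      rintro ⟨y, b⟩
      refine (((hall y b).and (HasCkt.threshold' (k := k) hn (hI y b))).and
        (HasCkt.threshold' (k := k + 1) hn (hnO y b)).not).mono ?_ le_rfl
      have hs : 1 ≤ s₁ := by omega
      have hnn : n ≤ n ^ 2 := by nlinarith
      have h4 : n * (2 * (s₁ + s₁) + 1) + 1 ≤ 6 * s₁ * n ^ 2 := by nlinarith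
      have h5 : 1 ≤ s₁ * n ^ 2 := Nat.mul_pos hs (by positivity)
      have h6 : T k * n ^ 2 = 100 * (s₁ * n ^ 2) + 10 * (thresholdBound s₁ k * n ^ 2) +
        10 * (thresholdBound s₁ (k + 1) * n ^ 2) := by simp only [T]; ring
      rw [h6]
      rw [mul_assoc] at h4
      omega
    refine (((HasCkt.ex h1).mono le_rfl (le_max_left _ _)).and
      ((hP n hn).mono le_rfl (le_max_right _ _))).mono ?_ (by omega)
    simp only [Fintype.card_prod, Fintype.card_fun, Fintype.card_fin, Fintype.card_bool]
    have h2 : n ^ m * n ^ 2 ≤ n ^ (m + 2 + cP) := by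
      rw [← pow_add]
      exact Nat.pow_le_pow_right hn (by omega)
    have h3 : n ^ cP ≤ n ^ (m + 2 + cP) := Nat.pow_le_pow_right hn (by omega)
    have h4 : 1 ≤ n ^ (m + 2 + cP) := Nat.one_le_pow _ _ hn
    have h5 : n ^ m * 2 ^ m * (T k * n ^ 2) ≤ 2 ^ m * T k * n ^ (m + 2 + cP) := by
      calc _ = 2 ^ m * T k * (n ^ m * n ^ 2) := by ring
        _ ≤ _ := Nat.mul_le_mul_left _ h2
    have h6 := Nat.mul_le_mul_left sP h3
    simp only [f]
    nlinarith
  · refine and_congr ?_ Iff.rfl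
    rw [mem_modelsEq]
    simp only [hψ]
    exact (exists_set_iff ψ (ofBits τ n hn (extendBits x)) k (fun y b z => I y b z x)
      (fun y b z => O y b z x) (fun y b z => hI₀ y b z x) (fun y b z => hO₀ y b z x)).symm

/-! ### Graph classes recognized by circuits, and the first item -/

/-- The atom `E(i, j)`. -/
def QForm.edge {V : Type} (s : ℕ) (i j : V) : QForm digraphVocab s V :=
  .rel (0 : Fin 1) (![i, j] : Fin 2 → V)

theorem QForm.eval_edge {s : ℕ} {V : Type} (G : FinStruct digraphVocab) (x : V → Fin G.card)
    (Y : (Fin s → V) → Prop) (i j : V) : (QForm.edge s i j).eval G x Y ↔ G.Adj (x i) (x j) := by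
  have : x ∘ (![i, j] : Fin 2 → V) = ![x i, x j] := by
    funext a
    fin_cases a <;> rfl
  simp only [QForm.edge, QForm.eval, FinStruct.Adj, ← this]
  rfl

/-- Being undirected and being basic are both quantifier-free conditions on all pairs of vertices.
-/
theorem HasCkt.forall_pair {τ : Vocab} (ψ : QForm τ 0 Bool) : ∃ s d, ∀ n (hn : 0 < n),
    HasCkt (structLen τ n) (s * n ^ 2) d (fun x => ∀ a b : Fin n,
      ψ.eval (ofBits τ n hn (extendBits x)) (fun i => if i then b else a) (fun _ => False)) := by
  obtain ⟨s, d, h⟩ := HasCkt.qform ψ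
  refine ⟨s + 1, d + 1, fun n hn => ((HasCkt.all fun ab : Fin n × Fin n => h (structLen τ n) n hn
    (fun i => if i then ab.2 else ab.1) fun _ => False).mono ?_ le_rfl).congr fun x => ?_⟩
  · rw [Fintype.card_prod, Fintype.card_fin]
    nlinarith
  · exact Prod.forall

theorem fd_inParaAC0 {p : List Quant} {m : ℕ}
    (hp : p.Sublist (List.replicate m Quant.e ++ [Quant.a])) {τ : Vocab} (φ : (τ.langX 1).Sentence)
    (hφ : HasPattern p φ) (P : FinStruct τ → Prop) {sP dP cP : ℕ}
    (hP : ∀ n (hn : 0 < n), HasCkt (structLen τ n) (sP * n ^ cP) dP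
      (fun x => P (ofBits τ n hn (extendBits x)))) :
    InParaAC0 (modelsEq φ ∩ {x | P x.1}) := by
  obtain ⟨φ', hφ', h⟩ := exists_pattern_of_sublist hp φ hφ (Fin.elim0 : Fin 0 → Fin 0)
  have : modelsEq φ = modelsEq φ' := by
    ext ⟨S, k⟩
    simp only [mem_modelsEq, h, Subsingleton.elim (Fin.elim0 ∘ Fin.elim0) (Fin.elim0 : Fin 0 → _)]
  rw [this]
  exact hasPattern_inParaAC0 hφ' P hP

theorem inParaAC0_of_sublist {p : List Quant} {m : ℕ}
    (hp : p.Sublist (List.replicate m Quant.e ++ [Quant.a])) :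
    (∀ τ : Vocab, ∀ Q ∈ FD τ 1 p, InParaAC0 Q) ∧ (∀ Q ∈ FDUndirected 1 p, InParaAC0 Q) ∧
      (∀ Q ∈ FDBasic 1 p, InParaAC0 Q) := by
  refine ⟨?_, ?_, ?_⟩
  · rintro τ Q ⟨φ, hφ, rfl⟩
    have := fd_inParaAC0 hp φ hφ (fun _ => True) (sP := 1) (cP := 0) (dP := 1)
      (fun n _ => (HasCkt.const True).mono (by simp) le_rfl)
    simpa using this
  · rintro Q ⟨φ, hφ, rfl⟩
    obtain ⟨s, d, h⟩ := HasCkt.forall_pair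
      (.imp (.edge 0 false true) (.edge 0 true false) : QForm digraphVocab 0 Bool)
    refine fd_inParaAC0 hp φ hφ FinStruct.IsUndirected (sP := s) (cP := 2) (dP := d)
      fun n hn => (h n hn).congr fun x => ?_
    refine forall_congr' fun a => forall_congr' fun b => ?_
    simp only [QForm.eval, QForm.eval_edge]
    exact Iff.rfl
  · rintro Q ⟨φ, hφ, rfl⟩
    obtain ⟨s, d, h⟩ := HasCkt.forall_pair
      (.imp (.edge 0 false true) (.imp (.imp (.edge 0 true false) (.eq false true)) .fls) :
        QForm digraphVocab 0 Bool)
    refine fd_inParaAC0 hp φ hφ FinStruct.IsBasic (sP := s) (cP := 2) (dP := d)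
      fun n hn => (h n hn).congr fun x => ?_
    refine forall_congr' fun a => forall_congr' fun b => ?_
    simp only [QForm.eval, QForm.eval_edge]
    have key : ∀ A B : Prop, ((A → B) → False) ↔ ¬ B ∧ A := by tauto
    exact imp_congr Iff.rfl ((key _ _).trans (and_congr Iff.rfl Iff.rfl))

/-! ### Programs for functions defined by bounded sums -/

theorem Runs.congr {P : Prog} {σ σ' σ'' : RAMState} {t t' : ℕ} (h : Runs P σ t σ')
    (ht : t = t') (hσ : σ' = σ'') : Runs P σ t' σ'' := ht ▸ hσ ▸ h

/-- Induction on the number of remaining rounds, since a run of a loop is unfolded at its first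
round. Each round pays one extra step for the test. -/
theorem Runs.loop_of_states {i : ℕ} {P : Prog} {T b : ℕ} (s : ℕ → RAMState)
    (h : ∀ j < T, (s j).reg i ≠ 0 ∧ ∃ t ≤ b, Runs P (s j) t (s (j + 1)))
    (hT : (s T).reg i = 0) : ∃ t ≤ T * (b + 1) + 1, Runs (.loop i P) (s 0) t (s T) := by
  have key : ∀ m ≤ T, ∃ t ≤ m * (b + 1) + 1, Runs (.loop i P) (s (T - m)) t (s T) := by
    intro m
    induction m with
    | zero => exact fun _ => ⟨1, by simp, .loop_done hT⟩
    | succ m ih =>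
      intro hm
      obtain ⟨t', ht', h'⟩ := ih (by omega)
      obtain ⟨hi, t, ht, h⟩ := h (T - (m + 1)) (by omega)
      rw [show T - (m + 1) + 1 = T - m by omega] at h
      exact ⟨t + t' + 1, by rw [add_mul]; omega, .loop_step hi h h'⟩
  simpa using key T le_rfl

/-- All time and size bounds are kept in the form `B ^ c`; as `2 ≤ B`, sums are absorbed by the
exponent. -/
theorem add_le_pow {B x y a b : ℕ} (hB : 2 ≤ B) (hx : x ≤ B ^ a) (hy : y ≤ B ^ b) :
    x + y ≤ B ^ (a + b + 1) := by
  have h1 : B ^ a ≤ B ^ (a + b) := Nat.pow_le_pow_right (by omega) (by omega)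
  have h2 : B ^ b ≤ B ^ (a + b) := Nat.pow_le_pow_right (by omega) (by omega)
  rw [pow_succ]
  nlinarith

theorem mul_le_pow {B x y a b : ℕ} (hx : x ≤ B ^ a) (hy : y ≤ B ^ b) :
    x * y ≤ B ^ (a + b) := by
  rw [pow_add]
  exact Nat.mul_le_mul hx hy

theorem const_le_pow {B : ℕ} (hB : 2 ≤ B) (k : ℕ) : k ≤ B ^ k :=
  Nat.lt_two_pow_self.le.trans (Nat.pow_le_pow_left hB k)

section

variable {α ι : Type}

/-- `B` bounds the values of the variables `V` and the contents of the memory `M`. -/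
structure Bounds (V : ι → α → ℕ) (M : α → ℕ → ℕ) (a : α) (B : ℕ) : Prop where
  two_le : 2 ≤ B
  var : ∀ i, V i a ≤ B
  mem : ∀ j, M a j ≤ B

/-- The function `F` of the variables `V` and the memory `M` is polynomially bounded and, wherever
the variables are stored, computed by a program in polynomial time. The program places the result
in a register `f` and uses only registers from `f` on, which it leaves blank. -/
def RC (V : ι → α → ℕ) (M : α → ℕ → ℕ) (F : α → ℕ) : Prop :=
  (∃ c, ∀ a B, Bounds V M a B → F a ≤ B ^ c) ∧
  ∀ (f : ℕ) (ρ : ι → ℕ), (∀ i, ρ i < f) → ∃ (P : Prog) (c : ℕ), ∀ a B σ, Bounds V M a B →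
    σ.mem = M a → (∀ i, σ.reg (ρ i) = V i a) → (∀ j, f ≤ j → σ.reg j = 0) →
    ∃ t ≤ B ^ c, Runs P σ t (σ.setReg f (F a))

/-- The variables `V` and a new one. -/
def extVar (V : ι → α → ℕ) (o : Option ι) (a : α × ℕ) : ℕ := o.elim a.2 fun i => V i a.1

/-- The memory, for functions with one more variable. -/
def extMem (M : α → ℕ → ℕ) (a : α × ℕ) : ℕ → ℕ := M a.1

variable {V : ι → α → ℕ} {M : α → ℕ → ℕ} {F G : α → ℕ}

theorem RC.congr (h : RC V M F) (hFG : ∀ a, F a = G a) : RC V M G := by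
  rwa [show G = F from funext fun a => (hFG a).symm]

theorem RC.var (i : ι) : RC V M (V i) := by
  refine ⟨⟨1, fun a B h => by simpa using h.var i⟩, fun f ρ hρ => ⟨.add f (ρ i) f, 0, ?_⟩⟩
  intro a B σ hB hM hV h0
  refine ⟨1, by simp, (Runs.add f (ρ i) f σ).congr rfl ?_⟩
  rw [hV, h0 f le_rfl, add_zero]

theorem RC.const (c : ℕ) : RC V M (fun _ => c) := by
  refine ⟨⟨c, fun a B h => const_le_pow h.two_le c⟩, fun f ρ hρ => ⟨.const f c, 0, ?_⟩⟩
  intro a B σ hB hM hV h0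
  exact ⟨1, by simp, Runs.const f c σ⟩

theorem RAMState.setReg_setReg (σ : RAMState) (i v w : ℕ) :
    (σ.setReg i v).setReg i w = σ.setReg i w := by
  simp [RAMState.setReg]

theorem RC.unary (op : ℕ → Prog) (u : α → ℕ → ℕ) (hF : RC V M F)
    (hop : ∀ f a σ, σ.mem = M a → Runs (op f) σ 1 (σ.setReg f (u a (σ.reg f))))
    (hu : ∃ c, ∀ a B, Bounds V M a B → u a (F a) ≤ B ^ c) : RC V M (fun a => u a (F a)) := by
  refine ⟨hu, fun f ρ hρ => ?_⟩
  obtain ⟨P, c, hP⟩ := hF.2 f ρ hρ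
  refine ⟨.seq P (op f), c + 1 + 1, fun a B σ hB hM hV h0 => ?_⟩
  obtain ⟨t, ht, h⟩ := hP a B σ hB hM hV h0
  refine ⟨t + 1, add_le_pow hB.two_le ht (const_le_pow hB.two_le 1),
    (h.seq (hop f a _ hM)).congr rfl ?_⟩
  rw [RAMState.setReg_setReg]
  simp [RAMState.setReg]

theorem RC.mem (hF : RC V M F) : RC V M (fun a => M a (F a)) :=
  hF.unary (fun f => .load f f) M (fun f a σ h => h ▸ Runs.load f f σ)
    ⟨1, fun a B h => by simpa using h.mem _⟩

/-- The first operand waits in register `f`, while the second is computed with `f + 1` as its first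
free register, which is blanked again at the end. -/
theorem RC.binary (op : ℕ → ℕ → Prog) (u : ℕ → ℕ → ℕ) (hF : RC V M F) (hG : RC V M G)
    (hop : ∀ f g σ, Runs (op f g) σ 1 (σ.setReg f (u (σ.reg f) (σ.reg g))))
    (hu : ∀ a b, u a b ≤ a + b) : RC V M (fun a => u (F a) (G a)) := by
  constructor
  · obtain ⟨c, hc⟩ := hF.1
    obtain ⟨c', hc'⟩ := hG.1
    exact ⟨_, fun a B h => (hu _ _).trans (add_le_pow h.two_le (hc a B h) (hc' a B h))⟩
  intro f ρ hρ
  obtain ⟨P, c, hP⟩ := hF.2 f ρ hρ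
  obtain ⟨P', c', hP'⟩ := hG.2 (f + 1) ρ (fun i => (hρ i).trans (Nat.lt_succ_self f))
  refine ⟨.seq P (.seq P' (.seq (op f (f + 1)) (.const (f + 1) 0))), c + (c' + 2 + 1) + 1,
    fun a B σ hB hM hV h0 => ?_⟩
  obtain ⟨t, ht, h⟩ := hP a B σ hB hM hV h0
  obtain ⟨t', ht', h'⟩ := hP' a B (σ.setReg f (F a)) hB hM
    (fun i => by simpa [RAMState.setReg, (hρ i).ne] using hV i)
    (fun j hj => by simpa [RAMState.setReg, show j ≠ f by omega] using h0 j (by omega))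
  refine ⟨t + (t' + 2), add_le_pow hB.two_le ht
    (add_le_pow hB.two_le ht' (const_le_pow hB.two_le 2)),
    (h.seq (h'.seq ((hop f (f + 1) _).seq (.const _ _ _)))).congr rfl ?_⟩
  refine RAMState.ext (funext fun r => ?_) rfl
  have := h0 (f + 1) (Nat.le_succ f)
  by_cases h1 : r = f + 1 <;> by_cases h2 : r = f <;> simp [RAMState.setReg, h1, h2, this]

theorem RC.add (hF : RC V M F) (hG : RC V M G) : RC V M (fun a => F a + G a) :=
  hF.binary (fun f g => .add f f g) (· + ·) hG (fun f g σ => .add f f g σ) (fun _ _ => le_rfl)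

theorem RC.sub (hF : RC V M F) (hG : RC V M G) : RC V M (fun a => F a - G a) :=
  hF.binary (fun f g => .sub f f g) (· - ·) hG (fun f g σ => .sub f f g σ) (fun _ _ => by omega)

theorem RC.weaken (hF : RC V M F) : RC (extVar V) (extMem M) (fun a => F a.1) := by
  have hB : ∀ a B, Bounds (extVar V) (extMem M) a B → Bounds V M a.1 B := fun a B h =>
    ⟨h.two_le, fun i => h.var (some i), h.mem⟩
  obtain ⟨⟨c, hc⟩, h⟩ := hF
  refine ⟨⟨c, fun a B h => hc _ _ (hB a B h)⟩, fun f ρ hρ => ?_⟩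
  obtain ⟨P, c, hP⟩ := h f (fun i => ρ (some i)) (fun i => hρ _)
  exact ⟨P, c, fun a B σ h hM hV h0 => hP a.1 B σ (hB a B h) hM (fun i => hV (some i)) h0⟩

theorem RC.newVar : RC (extVar V) (extMem M) (fun a => a.2) := RC.var none

/-- A new variable of polynomial size only replaces the bound `B` by a power of `B`, so polynomial
bounds survive substitution. -/
theorem Bounds.ext {a : α} {B c i : ℕ} (h : Bounds V M a B) (hi : i ≤ B ^ c) :
    Bounds (extVar V) (extMem M) (a, i) (B ^ (c + 1)) := by
  have hB : B ≤ B ^ (c + 1) := Nat.le_self_pow (Nat.succ_ne_zero c) B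
  have h1 : B ^ c ≤ B ^ (c + 1) := Nat.pow_le_pow_right (by linarith [h.two_le]) (Nat.le_succ c)
  refine ⟨h.two_le.trans hB, fun o => ?_, fun j => (h.mem j).trans hB⟩
  cases o with
  | none => exact hi.trans h1
  | some o => exact (h.var o).trans hB

/-- Substitution of a value for a variable. -/
theorem RC.bind {H : α → ℕ → ℕ} (hH : RC (extVar V) (extMem M) (fun a => H a.1 a.2))
    (hG : RC V M G) : RC V M (fun a => H a (G a)) := by
  obtain ⟨⟨cH, hcH⟩, hH⟩ := hH
  obtain ⟨⟨cG, hcG⟩, hG⟩ := hG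
  refine ⟨⟨(cG + 1) * cH, fun a B hB => ?_⟩, fun f ρ hρ => ?_⟩
  · rw [pow_mul]
    exact hcH (a, G a) _ (hB.ext (hcG a B hB))
  obtain ⟨P, c, hP⟩ := hG f ρ hρ
  obtain ⟨P', c', hP'⟩ := hH (f + 1) (fun o => o.elim f ρ) (by
    rintro (_ | i)
    · exact Nat.lt_succ_self f
    · exact (hρ i).trans (Nat.lt_succ_self f))
  refine ⟨.seq P (.seq P' (.seq (.add f (f + 1) (f + 2)) (.const (f + 1) 0))),
    c + ((cG + 1) * c' + 2 + 1) + 1, fun a B σ hB hM hV h0 => ?_⟩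
  obtain ⟨t, ht, h⟩ := hP a B σ hB hM hV h0
  obtain ⟨t', ht', h'⟩ := hP' (a, G a) _ (σ.setReg f (G a)) (hB.ext (hcG a B hB)) hM
    (by
      rintro (_ | i)
      · simp [RAMState.setReg, extVar]
      · simpa [RAMState.setReg, (hρ i).ne, extVar] using hV i)
    (fun j hj => by simpa [RAMState.setReg, show j ≠ f by omega] using h0 j (by omega))
  rw [← pow_mul] at ht'
  refine ⟨t + (t' + 2), add_le_pow hB.two_le ht
    (add_le_pow hB.two_le ht' (const_le_pow hB.two_le 2)),
    (h.seq (h'.seq ((Runs.add f (f + 1) (f + 2) _).seq (.const _ _ _)))).congr rfl ?_⟩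
  refine RAMState.ext (funext fun r => ?_) rfl
  have h1 := h0 (f + 1) (by omega)
  have h2 := h0 (f + 2) (by omega)
  by_cases h3 : r = f + 1 <;> by_cases h4 : r = f <;> simp [RAMState.setReg, h1, h2, h3, h4]

/-- The source of all loops in the calculus. Register `f` accumulates the sum, `f + 1` counts the
remaining rounds, `f + 2` holds the summation index, and the summand appears in `f + 3`, which
afterwards serves as the constant `1`. -/
theorem RC.sum {T : α → ℕ} {H : α → ℕ → ℕ} (hT : RC V M T)
    (hH : RC (extVar V) (extMem M) (fun a => H a.1 a.2)) :
    RC V M (fun a => ∑ i ∈ Finset.range (T a), H a i) := by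
  obtain ⟨⟨cH, hcH⟩, hH⟩ := hH
  obtain ⟨⟨cT, hcT⟩, hT⟩ := hT
  refine ⟨⟨cT + (cT + 1) * cH, fun a B hB => ?_⟩, fun f ρ hρ => ?_⟩
  · have : ∀ i ∈ Finset.range (T a), H a i ≤ B ^ ((cT + 1) * cH) := by
      intro i hi
      rw [pow_mul]
      exact hcH (a, i) _ (hB.ext ((Finset.mem_range.1 hi).le.trans (hcT a B hB)))
    refine (Finset.sum_le_card_nsmul _ _ _ this).trans ?_
    rw [Finset.card_range, smul_eq_mul]
    exact mul_le_pow (hcT a B hB) le_rfl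
  obtain ⟨P, c, hP⟩ := hT (f + 1) ρ (fun i => (hρ i).trans (Nat.lt_succ_self f))
  obtain ⟨P', c', hP'⟩ := hH (f + 3) (fun o => o.elim (f + 2) ρ) (by
    rintro (_ | i)
    · exact Nat.lt_succ_self _
    · exact (hρ i).trans (by simp))
  refine ⟨.seq P (.seq (.loop (f + 1) (.seq P' (.seq (.add f f (f + 3)) (.seq (.const (f + 3) 1)
    (.seq (.sub (f + 1) (f + 1) (f + 3)) (.seq (.add (f + 2) (f + 2) (f + 3))
      (.const (f + 3) 0))))))) (.const (f + 2) 0)),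
    c + ((cT + ((cT + 1) * c' + 6 + 1)) + 2 + 1) + 1, fun a B σ hB hM hV h0 => ?_⟩
  obtain ⟨t, ht, h⟩ := hP a B σ hB hM hV (fun j hj => h0 j (by omega))
  let s : ℕ → RAMState := fun j => ((σ.setReg f (∑ i ∈ Finset.range j, H a i)).setReg (f + 1)
    (T a - j)).setReg (f + 2) j
  have hs0 : s 0 = σ.setReg (f + 1) (T a) := by
    refine RAMState.ext (funext fun r => ?_) rfl
    have h1 := h0 f (by omega)
    have h2 := h0 (f + 2) (by omega)
    by_cases h3 : r = f + 1 <;> by_cases h4 : r = f <;> by_cases h5 : r = f + 2 <;>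
      simp [s, RAMState.setReg, h1, h2, h3, h4, h5]
  have hstep : ∀ j < T a, (s j).reg (f + 1) ≠ 0 ∧ ∃ t ≤ B ^ ((cT + 1) * c') + 5,
      Runs (.seq P' (.seq (.add f f (f + 3)) (.seq (.const (f + 3) 1)
        (.seq (.sub (f + 1) (f + 1) (f + 3)) (.seq (.add (f + 2) (f + 2) (f + 3))
          (.const (f + 3) 0)))))) (s j) t (s (j + 1)) := by
    intro j hj
    refine ⟨by simp [s, RAMState.setReg]; omega, ?_⟩
    obtain ⟨t, ht, h⟩ := hP' (a, j) _ (s j) (hB.ext (hj.le.trans (hcT a B hB))) hM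
      (by
        rintro (_ | i)
        · simp [s, RAMState.setReg, extVar]
        · have := hρ i
          simpa [s, RAMState.setReg, this.ne, show ρ i ≠ f + 1 by omega,
            show ρ i ≠ f + 2 by omega, extVar] using hV i)
      (fun r hr => by simpa [s, RAMState.setReg, show r ≠ f by omega, show r ≠ f + 1 by omega,
            show r ≠ f + 2 by omega] using h0 r (by omega))
    rw [← pow_mul] at ht
    refine ⟨t + 5, by omega, (h.seq ((Runs.add _ _ _ _).seq ((Runs.const _ _ _).seq
      ((Runs.sub _ _ _ _).seq ((Runs.add _ _ _ _).seq (.const _ _ _)))))).congr rfl ?_⟩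
    refine RAMState.ext (funext fun r => ?_) rfl
    have h1 := h0 (f + 3) (by omega)
    by_cases h3 : r = f + 1 <;> by_cases h4 : r = f <;> by_cases h5 : r = f + 2 <;>
      by_cases h6 : r = f + 3 <;>
      simp [s, RAMState.setReg, h1, h3, h4, h5, h6,
        Finset.sum_range_succ, Nat.sub_sub]
  obtain ⟨t', ht', h'⟩ := Runs.loop_of_states s hstep (by simp [s, RAMState.setReg])
  rw [hs0] at h'
  refine ⟨t + (t' + 1), add_le_pow hB.two_le ht ?_, (h.seq (h'.seq (.const _ _ _))).congr rfl ?_⟩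
  · refine le_trans ?_ (add_le_pow hB.two_le (mul_le_pow (hcT a B hB)
      (add_le_pow hB.two_le le_rfl (const_le_pow hB.two_le 6))) (const_le_pow hB.two_le 2))
    rw [show B ^ ((cT + 1) * c') + 5 + 1 = B ^ ((cT + 1) * c') + 6 from rfl] at ht'
    omega
  · refine RAMState.ext (funext fun r => ?_) rfl
    have h1 := h0 (f + 1) (by omega)
    have h2 := h0 (f + 2) (by omega)
    by_cases h3 : r = f + 1 <;> by_cases h4 : r = f <;> by_cases h5 : r = f + 2 <;>
      simp [s, RAMState.setReg, h1, h2, h3, h4, h5]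

/-- The machine has no multiplication; a product is a sum of equal terms. -/
theorem RC.mul (hF : RC V M F) (hG : RC V M G) : RC V M (fun a => F a * G a) :=
  (hF.sum (H := fun a _ => G a) hG.weaken).congr fun a => by simp

theorem RC.pow (hF : RC V M F) (c : ℕ) : RC V M (fun a => F a ^ c) := by
  induction c with
  | zero => exact (RC.const 1).congr fun a => (pow_zero _).symm
  | succ c ih => exact (ih.mul hF).congr fun a => (pow_succ _ _).symm

theorem RC.finset_sum {κ : Type*} {H : κ → α → ℕ} (s : Finset κ) (h : ∀ i, RC V M (H i)) :
    RC V M (fun a => ∑ i ∈ s, H i a) := by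
  classical
  induction s using Finset.induction_on with
  | empty => exact (RC.const 0).congr fun a => by simp
  | insert i s hi ih => exact ((h i).add ih).congr fun a => by rw [Finset.sum_insert hi]

/-! ### Predicates -/

open Classical in
/-- The indicator of a proposition. -/
noncomputable def ind (p : Prop) : ℕ := if p then 1 else 0

/-- The predicate `p` is decided by a program. -/
def RCP (V : ι → α → ℕ) (M : α → ℕ → ℕ) (p : α → Prop) : Prop := RC V M fun a => ind (p a)

variable {p q : α → Prop}

theorem RCP.congr (h : RCP V M p) (hpq : ∀ a, p a ↔ q a) : RCP V M q := by
  rwa [show q = p from funext fun a => propext (hpq a).symm]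

theorem RCP.const (p : Prop) : RCP V M (fun _ => p) := RC.const _

theorem RCP.weaken (h : RCP V M p) : RCP (extVar V) (extMem M) (fun a => p a.1) := RC.weaken h

theorem RCP.not (h : RCP V M p) : RCP V M (fun a => ¬ p a) :=
  ((RC.const 1).sub h).congr fun a => by by_cases h : p a <;> simp [ind, h]

theorem RCP.and (h : RCP V M p) (h' : RCP V M q) : RCP V M (fun a => p a ∧ q a) :=
  (RC.mul h h').congr fun a => by by_cases h : p a <;> by_cases h' : q a <;> simp [ind, h, h']

theorem RCP.or (h : RCP V M p) (h' : RCP V M q) : RCP V M (fun a => p a ∨ q a) :=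
  (h.not.and h'.not).not.congr fun a => by tauto

theorem RCP.imp (h : RCP V M p) (h' : RCP V M q) : RCP V M (fun a => p a → q a) :=
  (h.not.or h').congr fun a => by tauto

theorem RCP.iff (h : RCP V M p) (h' : RCP V M q) : RCP V M (fun a => p a ↔ q a) :=
  ((h.imp h').and (h'.imp h)).congr fun a => by tauto

/-- With truncated subtraction, `1 - (F - G)` is the indicator of `F ≤ G`. -/
theorem RC.le (hF : RC V M F) (hG : RC V M G) : RCP V M (fun a => F a ≤ G a) :=
  ((RC.const 1).sub (hF.sub hG)).congr fun a => by
    by_cases h : F a ≤ G a <;> simp [ind, h]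
    omega

theorem RC.lt (hF : RC V M F) (hG : RC V M G) : RCP V M (fun a => F a < G a) :=
  (hG.le hF).not.congr fun a => by omega

theorem RC.eq (hF : RC V M F) (hG : RC V M G) : RCP V M (fun a => F a = G a) :=
  ((hF.le hG).and (hG.le hF)).congr fun a => by omega

/-- A bounded universal quantifier holds iff the number of counterexamples is zero. -/
theorem RCP.ball {T : α → ℕ} {r : α → ℕ → Prop} (hT : RC V M T)
    (h : RCP (extVar V) (extMem M) (fun a => r a.1 a.2)) :
    RCP V M (fun a => ∀ i < T a, r a i) :=
  ((hT.sum (H := fun a i => ind (¬ r a i)) h.not).eq (RC.const 0)).congr fun a => by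
    simp [Finset.sum_eq_zero_iff, ind]

theorem RCP.all {κ : Type*} [Finite κ] {r : κ → α → Prop} (h : ∀ i, RCP V M (r i)) :
    RCP V M (fun a => ∀ i, r i a) := by
  have := Fintype.ofFinite κ
  exact ((RC.finset_sum Finset.univ fun i => (h i).not).eq (RC.const 0)).congr fun a => by
    simp [Finset.sum_eq_zero_iff, ind]

theorem RCP.ex {κ : Type*} [Finite κ] {r : κ → α → Prop} (h : ∀ i, RCP V M (r i)) :
    RCP V M (fun a => ∃ i, r i a) :=
  (RCP.all fun i => (h i).not).not.congr fun a => by push Not; rfl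

/-- The quotient is the number of positive multiples of the divisor up to the dividend; the clause
`0 < G a` gives the value `0` for division by zero. -/
theorem RC.div (hF : RC V M F) (hG : RC V M G) : RC V M (fun a => F a / G a) := by
  refine (hF.sum (H := fun a i => ind (0 < G a ∧ (i + 1) * G a ≤ F a)) (RCP.and
    ((RC.const 0).lt hG.weaken) (((RC.newVar.add (RC.const 1)).mul hG.weaken).le
      hF.weaken))).congr fun a => ?_
  rcases Nat.eq_zero_or_pos (G a) with h | h
  · simp [h, ind]
  · simp only [ind, h, true_and, Finset.sum_boole, ← Nat.le_div_iff_mul_le h, Nat.cast_id]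
    rw [show (Finset.range (F a)).filter (fun i => i + 1 ≤ F a / G a) =
      Finset.range (F a / G a) from ?_, Finset.card_range]
    ext i
    have := Nat.div_le_self (F a) (G a)
    simp only [Finset.mem_filter, Finset.mem_range]
    omega

theorem RC.mod (hF : RC V M F) (hG : RC V M G) : RC V M (fun a => F a % G a) :=
  (hF.sub (hG.mul (hF.div hG))).congr fun a => by
    have := Nat.div_add_mod (F a) (G a)
    omega

end

/-! ### Programs that write a structure -/

/-- The number whose binary digits are `bit i, …, bit (i + m - 1)`, the first one being the least
significant one. -/
def binTail (bit : ℕ → ℕ) : ℕ → ℕ → ℕ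
  | 0, _ => 0
  | m + 1, i => bit i + 2 * binTail bit m (i + 1)

/-- The state with the given contents of the first six registers. -/
def sixReg (a b c d e f : ℕ) (m : ℕ → ℕ) : RAMState where
  reg
    | 0 => a
    | 1 => b
    | 2 => c
    | 3 => d
    | 4 => e
    | 5 => f
    | _ => 0
  mem := m

theorem sixReg_ext {a b c d e f : ℕ} {m : ℕ → ℕ} {σ : RAMState} (h0 : σ.reg 0 = a)
    (h1 : σ.reg 1 = b) (h2 : σ.reg 2 = c) (h3 : σ.reg 3 = d) (h4 : σ.reg 4 = e) (h5 : σ.reg 5 = f)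
    (h : ∀ r, σ.reg (r + 6) = 0) (hm : σ.mem = m) : σ = sixReg a b c d e f m := by
  refine RAMState.ext (funext fun r => ?_) hm
  rcases r with _ | _ | _ | _ | _ | _ | r <;> first | assumption | exact h _

theorem sixReg_blank {a b c d e f : ℕ} {m : ℕ → ℕ} {r : ℕ} (hr : 6 ≤ r) :
    (sixReg a b c d e f m).reg r = 0 := by
  obtain ⟨r, rfl⟩ := Nat.exists_eq_add_of_le' hr
  rfl

/-- The two numbers that a machine is given: the length of the input and the parameter. -/
def inputVar {τ : Vocab} (b : Bool) (x : FinStruct τ × ℕ) : ℕ :=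
  if b then x.1.encode.length else x.2

/-- The memory at the start. -/
def inputMem {τ : Vocab} (x : FinStruct τ × ℕ) (j : ℕ) : ℕ := cell x.1.encode[j]?

theorem cell_le_two (o : Option Bool) : cell o ≤ 2 := by
  rcases o with _ | _ | _ <;> simp [cell]

theorem bounds_input {τ : Vocab} (x : FinStruct τ × ℕ) :
    Bounds inputVar inputMem x (x.1.encode.length + x.2 + 2) := by
  refine ⟨by omega, fun b => ?_, fun j => (cell_le_two _).trans (by omega)⟩
  cases b <;> simp [inputVar] <;> omega

theorem instanceState_eq {τ : Vocab} (x : FinStruct τ × ℕ) :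
    instanceState x = sixReg x.1.encode.length x.2 0 0 0 0 (inputMem x) :=
  sixReg_ext rfl rfl rfl rfl rfl rfl (fun _ => rfl) rfl

/-- The program that collects the bits of the output in register `5`. -/
theorem exists_collect {τ : Vocab} {O : FinStruct τ × ℕ → ℕ → Prop}
    {L : FinStruct τ × ℕ → ℕ} (hL : RC inputVar inputMem L)
    (hO : RCP (extVar inputVar) (extMem inputMem) (fun a => O a.1 a.2)) :
    ∃ (P : Prog) (c : ℕ), ∀ x k', ∃ t ≤ (x.1.encode.length + x.2 + 2) ^ c,
      Runs P (sixReg x.1.encode.length x.2 (L x) k' (L x) 0 (inputMem x)) t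
        (sixReg x.1.encode.length x.2 (L x) k' 0 (binTail (fun i => ind (O x i)) (L x) 0)
          (inputMem x)) := by
  obtain ⟨⟨cL, hcL⟩, -⟩ := hL
  obtain ⟨P, c, hP⟩ := hO.2 6 (fun o => o.elim 4 fun b => if b then 0 else 1) (by
    rintro (_ | _ | _) <;> simp)
  let P₁ : Prog := .seq (.const 6 1) (.seq (.sub 4 4 6) (.const 6 0))
  let P₂ : Prog := .seq (.add 5 5 5) (.seq (.add 5 5 6) (.const 6 0))
  refine ⟨.loop 4 (.seq P₁ (.seq P P₂)), cL + ((cL + 1) * c + 7 + 1) + 1 + 1, fun x k' => ?_⟩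
  set B := x.1.encode.length + x.2 + 2 with hBdef
  have hB := bounds_input x
  rw [← hBdef] at hB
  -- The digits are collected from the most significant one downwards, by Horner's rule: after `j`
  -- rounds register `5` holds the last `j` digits.
  let s : ℕ → RAMState := fun j => sixReg x.1.encode.length x.2 (L x) k' (L x - j)
    (binTail (fun i => ind (O x i)) j (L x - j)) (inputMem x)
  obtain ⟨t, ht, h⟩ := Runs.loop_of_states (i := 4) (T := L x) (b := B ^ ((cL + 1) * c) + 6)
    (P := .seq P₁ (.seq P P₂)) s (by
      intro j hj
      refine ⟨by simp [s, sixReg]; omega, ?_⟩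
      obtain ⟨t, ht, h⟩ := hP (x, L x - (j + 1)) _ (sixReg x.1.encode.length x.2 (L x) k'
        (L x - (j + 1)) (binTail (fun i => ind (O x i)) j (L x - j)) (inputMem x))
        (hB.ext ((Nat.sub_le _ _).trans (hcL x B hB))) rfl (by rintro (_ | _ | _) <;> rfl)
        (fun r hr => sixReg_blank hr)
      rw [← pow_mul] at ht
      have h₁ : Runs P₁ (s j) 3 (sixReg x.1.encode.length x.2 (L x) k' (L x - (j + 1))
            (binTail (fun i => ind (O x i)) j (L x - j)) (inputMem x)) := by
        refine ((Runs.const _ _ _).seq ((Runs.sub _ _ _ _).seq (.const _ _ _))).congr rfl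
          (sixReg_ext ?_ ?_ ?_ ?_ ?_ ?_ (fun r => ?_) rfl)
        case refine_7 => rcases r with _ | r <;> simp [s, sixReg, RAMState.setReg]
        all_goals simp [s, sixReg, RAMState.setReg, Nat.sub_sub]
      refine ⟨3 + (t + 3), by omega, h₁.seq (h.seq (((Runs.add _ _ _ _).seq
          ((Runs.add _ _ _ _).seq (.const _ _ _))).congr rfl
            (sixReg_ext ?_ ?_ ?_ ?_ ?_ ?_ (fun r => ?_) rfl)))⟩
      case refine_6 =>
        simp [sixReg, RAMState.setReg, binTail, show L x - (j + 1) + 1 = L x - j by omega]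
        omega
      case refine_7 => rcases r with _ | r <;> simp [sixReg, RAMState.setReg]
      all_goals simp [sixReg, RAMState.setReg])
    (by simp [s, sixReg])
  refine ⟨t, ht.trans (add_le_pow hB.two_le (mul_le_pow (hcL x B hB) (show _ ≤ B ^ _ from add_le_pow
    (x := B ^ ((cL + 1) * c)) (y := 7) hB.two_le le_rfl (const_le_pow hB.two_le 7))) (const_le_pow hB.two_le 1)), h.congr rfl ?_⟩
  simp only [s, Nat.sub_self]

/-- The program that erases the memory cells with numbers below register `0`. -/
def clearProg : Prog :=
  .loop 0 (.seq (.const 6 1) (.seq (.sub 0 0 6) (.seq (.const 6 0) (.store 0 6))))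

theorem runs_clear (N a b c d e : ℕ) (m : ℕ → ℕ) (hm : ∀ i, N ≤ i → m i = 0) :
    ∃ t ≤ N * 6 + 1, Runs clearProg (sixReg N a b c d e m) t (sixReg 0 a b c d e fun _ => 0) := by
  let s : ℕ → RAMState := fun j => sixReg (N - j) a b c d e fun i => if i < N - j then m i else 0
  obtain ⟨t, ht, h⟩ := Runs.loop_of_states (i := 0) (T := N) (b := 4)
    (P := .seq (.const 6 1) (.seq (.sub 0 0 6) (.seq (.const 6 0) (.store 0 6)))) s (by
      intro j hj
      refine ⟨by simp [s, sixReg]; omega, 4, by omega, ((Runs.const _ _ _).seq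
        ((Runs.sub _ _ _ _).seq ((Runs.const _ _ _).seq (.store _ _ _)))).congr rfl
          (sixReg_ext ?_ ?_ ?_ ?_ ?_ ?_ (fun r => ?_) ?_)⟩
      case refine_7 => rcases r with _ | r <;> simp [s, sixReg, RAMState.setReg, RAMState.setMem]
      case refine_8 =>
        funext i
        simp only [s, sixReg, RAMState.setReg, RAMState.setMem, Function.update_apply]
        simp
        split_ifs <;> first | rfl | omega
      all_goals simp [s, sixReg, RAMState.setReg, RAMState.setMem, Nat.sub_sub])
    (by simp [s, sixReg])
  refine ⟨t, by omega, ?_⟩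
  have h0 : s 0 = sixReg N a b c d e m := by
    simp only [s, Nat.sub_zero]
    congr 1
    funext i
    split_ifs with h
    · rfl
    · exact (hm i (not_lt.1 h)).symm
  rw [h0] at h
  exact h.congr rfl (by simp [s])

/-- The body of `writeProg`. -/
def writeStep : Prog :=
  .seq (.half 6 5) (.seq (.add 7 6 6) (.seq (.sub 5 5 7) (.seq (.const 7 1) (.seq (.add 5 5 7)
    (.seq (.store 4 5) (.seq (.add 5 6 8) (.seq (.sub 2 2 7) (.seq (.add 4 4 7)
      (.seq (.const 6 0) (.const 7 0))))))))))

/-- The program that writes the binary digits of register `5` to the memory. -/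
def writeProg : Prog := .loop 2 writeStep

/-- The least significant digit is split off by halving. The value written is the digit plus one,
because `cell` reserves `0` for blank. Register `8` is always `0` and makes an addition a copy. -/
theorem runs_write (a b L d : ℕ) (bit : ℕ → ℕ) (hbit : ∀ i, bit i ≤ 1) :
    ∃ t ≤ L * 12 + 1, Runs writeProg
      (sixReg a b L d 0 (binTail bit L 0) fun _ => 0) t
      (sixReg a b 0 d L 0 fun i => if i < L then bit i + 1 else 0) := by
  let s : ℕ → RAMState := fun j => sixReg a b (L - j) d j (binTail bit (L - j) j)
    fun i => if i < j then bit i + 1 else 0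
  obtain ⟨t, ht, h⟩ := Runs.loop_of_states (i := 2) (T := L) (b := 11)
    (P := writeStep) s (by
      intro j hj
      have hb : binTail bit (L - j) j = bit j + 2 * binTail bit (L - (j + 1)) (j + 1) := by
        rw [show L - j = L - (j + 1) + 1 by omega]
        rfl
      have hd : (bit j + 2 * binTail bit (L - (j + 1)) (j + 1)) / 2 =
          binTail bit (L - (j + 1)) (j + 1) := by
        have := hbit j
        omega
      refine ⟨by simp [s, sixReg]; omega, 11, by omega, ((Runs.half _ _ _).seq
        ((Runs.add _ _ _ _).seq ((Runs.sub _ _ _ _).seq ((Runs.const _ _ _).seq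
        ((Runs.add _ _ _ _).seq ((Runs.store _ _ _).seq ((Runs.add _ _ _ _).seq
        ((Runs.sub _ _ _ _).seq ((Runs.add _ _ _ _).seq ((Runs.const _ _ _).seq
        (.const _ _ _))))))))))).congr rfl
          (sixReg_ext ?_ ?_ ?_ ?_ ?_ ?_ (fun r => ?_) ?_)⟩
      case refine_7 =>
        rcases r with _ | _ | r <;> simp [s, sixReg, RAMState.setReg, RAMState.setMem]
      case refine_8 =>
        funext i
        simp only [s, sixReg, RAMState.setReg, RAMState.setMem, Function.update_apply]
        simp [hb, hd]
        rcases lt_trichotomy i j with h | h | h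
        · simp [h, h.ne, h.le]
        · subst h
          simp
          omega
        · simp [h.ne', not_lt.2 h.le, h]
      all_goals simp [s, sixReg, RAMState.setReg, RAMState.setMem, Nat.sub_sub, hb, hd])
    (by simp [s, sixReg])
  refine ⟨t, by omega, ?_⟩
  have h0 : s 0 = sixReg a b L d 0 (binTail bit L 0) fun _ => 0 := by simp [s]
  rw [h0] at h
  exact h.congr rfl (by simp [s, binTail])

theorem runs_copy_length (N k L k' : ℕ) (m : ℕ → ℕ) :
    Runs (.add 4 2 5) (sixReg N k L k' 0 0 m) 1 (sixReg N k L k' L 0 m) :=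
  (Runs.add 4 2 5 _).congr rfl (sixReg_ext rfl rfl rfl rfl rfl rfl (fun _ => rfl) rfl)

theorem runs_set_length (k L k' W : ℕ) (m : ℕ → ℕ) :
    Runs (.add 0 2 6) (sixReg 0 k L k' 0 W m) 1 (sixReg L k L k' 0 W m) :=
  (Runs.add 0 2 6 _).congr rfl (sixReg_ext rfl rfl rfl rfl rfl rfl (fun _ => rfl) rfl)

theorem runs_set_param (k L L' k' : ℕ) (m : ℕ → ℕ) :
    Runs (.seq (.const 4 0) (.seq (.add 1 3 6) (.const 3 0))) (sixReg L k 0 k' L' 0 m) 3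
      (sixReg L k' 0 0 0 0 m) :=
  ((Runs.const 4 0 _).seq ((Runs.add 1 3 6 _).seq (.const 3 0 _))).congr rfl
    (sixReg_ext rfl rfl rfl rfl rfl rfl (fun _ => rfl) rfl)

/-- A structure whose size, bits and parameter are computed by programs is written by a program. -/
theorem exists_prog_of_rc {τ τ' : Vocab} {R : FinStruct τ × ℕ → FinStruct τ' × ℕ}
    {O : FinStruct τ × ℕ → ℕ → Prop}
    (hL : RC inputVar inputMem fun x => (R x).1.encode.length)
    (hk : RC inputVar inputMem fun x => (R x).2)
    (hO : RCP (extVar inputVar) (extMem inputMem) (fun a => O a.1 a.2))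
    (hR : ∀ x i, i < (R x).1.encode.length → ((R x).1.encode[i]? = some true ↔ O x i)) :
    ∃ (P : Prog) (c : ℕ), ∀ x, ∃ t ≤ (x.1.encode.length + x.2 + 2) ^ c,
      Runs P (instanceState x) t (instanceState (R x)) := by
  obtain ⟨P, c, hP⟩ := exists_collect hL hO
  obtain ⟨cL, hcL⟩ := hL.1
  let ρ : Bool → ℕ := fun b => if b then 0 else 1
  have hρ : ∀ b, ρ b < 2 := by rintro (_ | _) <;> simp [ρ]
  obtain ⟨P₁, c₁, hP₁⟩ := hL.2 2 ρ hρ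
  obtain ⟨P₂, c₂, hP₂⟩ := hk.2 3 ρ (fun b => (hρ b).trans (by norm_num))
  -- The output overwrites the input, but every output bit may depend on all of the input. So the
  -- bits are first packed into one number in a register, which the unit-cost machine allows; only
  -- then is the memory erased and rewritten. Registers `2` and `3` keep the new length and the new
  -- parameter.
  refine ⟨.seq P₁ (.seq P₂ (.seq (.add 4 2 5) (.seq P (.seq clearProg (.seq (.add 0 2 6) (.seq writeProg
    (.seq (.const 4 0) (.seq (.add 1 3 6) (.const 3 0))))))))),
    (c₁ + c₂ + 1) + (c + ((1 + 6) + (cL + 13) + 1) + 1) + 1 + 20 + 1, fun x => ?_⟩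
  set B := x.1.encode.length + x.2 + 2 with hBdef
  have hB := bounds_input x
  rw [← hBdef] at hB
  set N := x.1.encode.length with hN
  set L := (R x).1.encode.length with hLdef
  obtain ⟨t₁, ht₁, h₁⟩ := hP₁ x B (instanceState x) hB rfl (by rintro (_ | _) <;> rfl) (by
    rw [instanceState_eq]
    intro j hj
    rcases j with _ | _ | _ | _ | _ | _ | j <;> first | omega | rfl)
  have e₁ : (instanceState x).setReg 2 L = sixReg N x.2 L 0 0 0 (inputMem x) := by
    rw [instanceState_eq]
    exact sixReg_ext rfl rfl rfl rfl rfl rfl (fun _ => rfl) rfl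
  rw [e₁] at h₁
  obtain ⟨t₂, ht₂, h₂⟩ := hP₂ x B (sixReg N x.2 L 0 0 0 (inputMem x)) hB rfl
    (by rintro (_ | _) <;> rfl) (by
      intro j hj
      rcases j with _ | _ | _ | _ | _ | _ | j <;> first | omega | rfl)
  obtain ⟨t, ht, h⟩ := hP x (R x).2
  have hb : ∀ i, ind (O x i) ≤ 1 := by
    intro i
    unfold ind
    split_ifs <;> simp
  obtain ⟨t₃, ht₃, h₃⟩ := runs_clear N x.2 L (R x).2 0 (binTail (fun i => ind (O x i)) L 0)
    (inputMem x) (fun i hi => by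
      rw [inputMem, List.getElem?_eq_none hi]
      rfl)
  obtain ⟨t₄, ht₄, h₄⟩ := runs_write L x.2 L (R x).2 (fun i => ind (O x i)) hb
  have hm : (fun i => if i < L then ind (O x i) + 1 else 0) = inputMem (R x) := by
    funext i
    rw [inputMem]
    split_ifs with hi
    · have := hR x i hi
      rw [List.getElem?_eq_getElem hi] at this ⊢
      by_cases hO : O x i
      · rw [this.2 hO]
        simp [ind, hO, cell]
      · have h' : (R x).1.encode[i] = false := by simpa [hO] using this
        simp [h', ind, hO, cell]
    · rw [List.getElem?_eq_none (not_lt.1 hi)]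
      rfl
  have e₂ : (sixReg N x.2 L 0 0 0 (inputMem x)).setReg 3 (R x).2 =
      sixReg N x.2 L (R x).2 0 0 (inputMem x) :=
    sixReg_ext rfl rfl rfl rfl rfl rfl (fun _ => rfl) rfl
  rw [e₂] at h₂
  rw [hm] at h₄
  rw [instanceState_eq (R x)]
  have r₁ := h.seq (h₃.seq ((runs_set_length _ _ _ _ _).seq (h₄.seq (runs_set_param _ _ _ _ _))))
  have r₂ := h₁.seq (h₂.seq ((runs_copy_length _ _ _ _ _).seq r₁))
  refine ⟨_, ?_, r₂⟩
  have hNB : N ≤ B ^ 1 := by rw [pow_one]; omega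
  have hLB : L ≤ B ^ cL := hcL x B hB
  have key := add_le_pow hB.two_le (add_le_pow hB.two_le (add_le_pow hB.two_le ht₁ ht₂)
    (add_le_pow hB.two_le ht (add_le_pow hB.two_le
      (mul_le_pow hNB (const_le_pow hB.two_le 6))
      (mul_le_pow hLB (const_le_pow hB.two_le 13))))) (const_le_pow hB.two_le 20)
  refine le_trans ?_ key
  omega

/-! ### Composition of reductions -/

/-- Each step changes at most one memory cell, so the running time bounds the number of new
non-blank cells. -/
theorem Runs.exists_support {P : Prog} {σ σ' : RAMState} {t : ℕ} (h : Runs P σ t σ') :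
    ∀ s : Finset ℕ, (∀ j ∉ s, σ.mem j = 0) →
      ∃ s' : Finset ℕ, s'.card ≤ s.card + t ∧ ∀ j ∉ s', σ'.mem j = 0 := by
  induction h with
  | store i j σ =>
    intro s hs
    refine ⟨insert (σ.reg i) s, Finset.card_insert_le _ _, fun r hr => ?_⟩
    rw [Finset.mem_insert, not_or] at hr
    simpa [RAMState.setMem, hr.1] using hs r hr.2
  | seq _ _ ih ih' =>
    intro s hs
    obtain ⟨s', h, hs'⟩ := ih s hs
    obtain ⟨s'', h', hs''⟩ := ih' s' hs'
    exact ⟨s'', by omega, hs''⟩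
  | loop_step _ _ _ ih ih' =>
    intro s hs
    obtain ⟨s', h, hs'⟩ := ih s hs
    obtain ⟨s'', h', hs''⟩ := ih' s' hs'
    exact ⟨s'', by omega, hs''⟩
  | ite_pos _ _ ih =>
    intro s hs
    obtain ⟨s', h, hs'⟩ := ih s hs
    exact ⟨s', by omega, hs'⟩
  | ite_neg _ _ ih =>
    intro s hs
    obtain ⟨s', h, hs'⟩ := ih s hs
    exact ⟨s', by omega, hs'⟩
  | _ => exact fun s hs => ⟨s, by omega, hs⟩

/-- All cells of an encoding are non-blank. This bounds the length of the intermediate instance when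
reductions are composed. -/
theorem Runs.length_le {τ τ' : Vocab} {x : FinStruct τ × ℕ} {y : FinStruct τ' × ℕ} {P : Prog}
    {t : ℕ} (h : Runs P (instanceState x) t (instanceState y)) :
    y.1.encode.length ≤ x.1.encode.length + t := by
  obtain ⟨s, hs, hs'⟩ := h.exists_support (Finset.range x.1.encode.length) fun j hj => by
    change cell x.1.encode[j]? = 0
    rw [List.getElem?_eq_none (by simpa using hj)]
    rfl
  rw [Finset.card_range] at hs
  refine le_trans ?_ hs
  rw [← Finset.card_range y.1.encode.length]
  refine Finset.card_le_card fun j hj => by_contra fun hj' => ?_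
  have h0 : cell y.1.encode[j]? = 0 := hs' j hj'
  rw [List.getElem?_eq_getElem (by simpa using hj)] at h0
  revert h0
  generalize y.1.encode[j]'(by simpa using hj) = b
  cases b <;> simp [cell]

theorem two_le_length_encode {τ : Vocab} (S : FinStruct τ) : 2 ≤ S.encode.length := by
  have := S.card_pos
  rw [length_encode, structLen]
  omega

/-- Computable bounds need not be monotone; partial sums are a monotone computable majorant. -/
theorem computable_sum_range {f : ℕ → ℕ} (hf : Computable f) :
    Computable fun m => ∑ i ∈ Finset.range (m + 1), f i := by
  have h : Computable₂ fun (_ : ℕ) (p : ℕ × ℕ) => p.2 + f (p.1 + 1) :=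
    (Primrec.nat_add.to_comp.comp (Computable.snd.comp .snd)
      (hf.comp (Computable.succ.comp (Computable.fst.comp .snd))))
  refine (Computable.nat_rec .id (.const (f 0)) h).of_eq fun m => ?_
  simp only [id]
  induction m with
  | zero => simp
  | succ m ih => rw [Finset.sum_range_succ, ← ih]

/-- The second program is run on an instance of length at most `(f k + 1) * N ^ (c + 1)` and
parameter at most `g k`; the partial sums bound its dependence on that parameter. -/
theorem FPTReducible.trans {τ τ' τ'' : Vocab} {Q : Problem τ} {Q' : Problem τ'}
    {Q'' : Problem τ''} (h : FPTReducible Q Q') (h' : FPTReducible Q' Q'') :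
    FPTReducible Q Q'' := by
  obtain ⟨R, hR, ⟨P, f, c, hf, hP⟩, g, hg, hRg⟩ := h
  obtain ⟨R', hR', ⟨P', f', c', hf', hP'⟩, g', hg', hRg'⟩ := h'
  have le_sum : ∀ (f : ℕ → ℕ) {a b : ℕ}, a ≤ b → f a ≤ ∑ i ∈ Finset.range (b + 1), f i :=
    fun f a b hab => Finset.single_le_sum (f := f) (fun _ _ => Nat.zero_le _)
      (Finset.mem_range.2 (Nat.lt_succ_of_le hab))
  refine ⟨R' ∘ R, fun x => (hR x).trans (hR' _), ⟨.seq P P', fun k => f k +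
    (∑ i ∈ Finset.range (g k + 1), f' i) * (f k + 1) ^ c', c + (c + 1) * c', ?_, fun x => ?_⟩,
    fun k => ∑ i ∈ Finset.range (g k + 1), g' i, (computable_sum_range hg').comp hg, fun x =>
    (hRg' _).trans (le_sum g' (hRg x))⟩
  · have hp : Primrec fun k : ℕ => (k + 1) ^ c' := computable_pow .succ (.const c')
    exact Primrec.nat_add.to_comp.comp hf (Primrec.nat_mul.to_comp.comp
      ((computable_sum_range hf').comp hg) (hp.to_comp.comp hf))
  · obtain ⟨t, ht, hr⟩ := hP x
    obtain ⟨t', ht', hr'⟩ := hP' (R x)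
    refine ⟨t + t', ?_, hr.seq hr'⟩
    have hN : 1 ≤ x.1.encode.length := by have := two_le_length_encode x.1; omega
    have hlen := hr.length_le
    set N := x.1.encode.length
    have h1 : (R x).1.encode.length ≤ (f x.2 + 1) * N ^ (c + 1) := by
      have h2 : N ^ c ≤ N ^ (c + 1) := Nat.pow_le_pow_right hN (Nat.le_succ c)
      have h3 : N ≤ N ^ (c + 1) := Nat.le_self_pow (Nat.succ_ne_zero c) N
      have := Nat.mul_le_mul_left (f x.2) h2
      rw [add_mul]
      omega
    have h2 : t' ≤ (∑ i ∈ Finset.range (g x.2 + 1), f' i) * (f x.2 + 1) ^ c' *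
        N ^ ((c + 1) * c') := by
      refine ht'.trans ?_
      rw [mul_assoc, pow_mul, ← mul_pow]
      exact Nat.mul_le_mul (le_sum f' (hRg x)) (Nat.pow_le_pow_left h1 c')
    have h3 : N ^ c ≤ N ^ (c + (c + 1) * c') := Nat.pow_le_pow_right hN (by omega)
    have h4 : N ^ ((c + 1) * c') ≤ N ^ (c + (c + 1) * c') := Nat.pow_le_pow_right hN (by omega)
    calc t + t' ≤ _ := Nat.add_le_add (ht.trans (Nat.mul_le_mul_left _ h3))
          (h2.trans (Nat.mul_le_mul_left _ h4))
      _ = _ := by ring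

/-! ### Reductions to graph problems -/

open Classical in
/-- The digraph with the vertices `0, …, n - 1` and the edges given by `A`. -/
noncomputable def mkGraph (n : ℕ) (hn : 0 < n) (A : ℕ → ℕ → Prop) : FinStruct digraphVocab where
  card := n
  card_pos := hn
  rel := fun _ (v : Fin 2 → Fin n) => decide (A (v 0) (v 1))

theorem mkGraph_adj {n : ℕ} {hn : 0 < n} {A : ℕ → ℕ → Prop} (x y : Fin n) :
    (mkGraph n hn A).Adj x y ↔ A x y := by
  simp only [FinStruct.Adj, mkGraph]
  exact @decide_eq_true_iff _ (Classical.propDecidable _)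

theorem length_encode_digraph (G : FinStruct digraphVocab) :
    G.encode.length = G.card + 1 + G.card ^ 2 := by
  rw [length_encode, structLen]
  exact congrArg _ (Fin.sum_univ_one _)

theorem encode_digraph (G : FinStruct digraphVocab) {t : ℕ} (ht : t < G.card ^ 2) :
    G.encode[G.card + 1 + t]? = some (G.rel (0 : Fin 1)
      (![⟨t % G.card, Nat.mod_lt _ G.card_pos⟩,
        ⟨t / G.card, Nat.div_lt_of_lt_mul (by rwa [pow_two] at ht)⟩] : Fin 2 → Fin G.card)) := by
  let v : Fin 2 → Fin G.card := ![⟨t % G.card, Nat.mod_lt _ G.card_pos⟩,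
    ⟨t / G.card, Nat.div_lt_of_lt_mul (by rwa [pow_two] at ht)⟩]
  have h : G.encode[relPos digraphVocab G.card (0 : Fin 1) + (finFunctionFinEquiv v : ℕ)]? =
    some (G.rel (0 : Fin 1) v) := encode_getElem?_rel G (0 : Fin 1) v
  have hpos : relPos digraphVocab G.card (0 : Fin 1) = G.card + 1 := by
    change G.card + 1 + (∑ j : Fin 1, if j < 0 then G.card ^ 2 else 0) = _
    simp
  have e : (finFunctionFinEquiv v : ℕ) = t := by
    rw [finFunctionFinEquiv_apply, Fin.sum_univ_two]
    simpa [v] using Nat.mod_add_div' t G.card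
  rwa [hpos, e] at h

theorem encode_mkGraph {n : ℕ} {hn : 0 < n} {A : ℕ → ℕ → Prop} {i : ℕ}
    (hi : i < (mkGraph n hn A).encode.length) : (mkGraph n hn A).encode[i]? = some true ↔
      i < n ∨ n < i ∧ A ((i - (n + 1)) % n) ((i - (n + 1)) / n) := by
  rcases lt_trichotomy i n with h | rfl | h
  · have := encode_getElem?_lt (mkGraph n hn A) h
    simp [this, h]
  · have := encode_getElem?_card (mkGraph i hn A)
    change (mkGraph i hn A).encode[i]? = some false at this
    simp [this]
  · rw [length_encode_digraph] at hi
    change i < n + 1 + n ^ 2 at hi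
    have := encode_digraph (mkGraph n hn A) (t := i - (n + 1)) (by
      change _ < n ^ 2
      omega)
    change (mkGraph n hn A).encode[n + 1 + (i - (n + 1))]? = _ at this
    rw [show n + 1 + (i - (n + 1)) = i by omega] at this
    rw [this, Option.some_inj]
    simp only [mkGraph, h, not_lt.2 h.le, false_or, true_and]
    exact @decide_eq_true_iff _ (Classical.propDecidable _)

theorem RC.rename {α β ι κ : Type} {V : ι → α → ℕ} {M : α → ℕ → ℕ} {W : κ → β → ℕ}
    {N : β → ℕ → ℕ} {F : α → ℕ} (hF : RC V M F) (h : β → α) (e : ι → κ)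
    (hV : ∀ i b, W (e i) b = V i (h b)) (hM : ∀ b, N b = M (h b)) :
    RC W N (fun b => F (h b)) := by
  have hB : ∀ b B, Bounds W N b B → Bounds V M (h b) B := fun b B hb =>
    ⟨hb.two_le, fun i => hV i b ▸ hb.var (e i), fun j => hM b ▸ hb.mem j⟩
  obtain ⟨⟨c, hc⟩, hP⟩ := hF
  refine ⟨⟨c, fun b B hb => hc _ _ (hB b B hb)⟩, fun f ρ hρ => ?_⟩
  obtain ⟨P, c, hP⟩ := hP f (fun i => ρ (e i)) (fun i => hρ _)
  exact ⟨P, c, fun b B σ hb hm hv h0 => hP (h b) B σ (hB b B hb) (hm.trans (hM b))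
    (fun i => (hv (e i)).trans (hV i b)) h0⟩

/-- A polynomial-time reduction to a graph problem, given by the order of the graph, the adjacency
relation, and the parameter. -/
theorem fptReducible_of_mkGraph {τ : Vocab} {Q : Problem τ} {Q' : Problem digraphVocab}
    {n k : FinStruct τ × ℕ → ℕ} (hn : ∀ x, 0 < n x) {A : FinStruct τ × ℕ → ℕ → ℕ → Prop}
    (hnc : RC inputVar inputMem n) (hkc : RC inputVar inputMem k)
    (hA : RCP (extVar (extVar inputVar)) (extMem (extMem inputMem))
      (fun a => A a.1.1 a.1.2 a.2))
    {g : ℕ → ℕ} (hg : Computable g) (hk : ∀ x, k x ≤ g x.2)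
    (hQ : ∀ x, x ∈ Q ↔ (mkGraph (n x) (hn x) (A x), k x) ∈ Q') : FPTReducible Q Q' := by
  have hO : RCP (extVar inputVar) (extMem inputMem) (fun a : (FinStruct τ × ℕ) × ℕ =>
      a.2 < n a.1 ∨ n a.1 < a.2 ∧ A a.1 ((a.2 - (n a.1 + 1)) % n a.1)
        ((a.2 - (n a.1 + 1)) / n a.1)) := by
    have ht : RC (extVar inputVar) (extMem inputMem) (fun a : (FinStruct τ × ℕ) × ℕ =>
      a.2 - (n a.1 + 1)) := RC.newVar.sub (hnc.weaken.add (.const 1))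
    refine (RC.newVar.lt hnc.weaken).or ((hnc.weaken.lt RC.newVar).and ?_)
    -- Row and column of the current bit are computed and substituted, one after the other, into the
    -- adjacency relation.
    refine RC.bind (H := fun a v => ind (A a.1 v ((a.2 - (n a.1 + 1)) / n a.1))) ?_
      (ht.mod hnc.weaken)
    refine RC.bind (H := fun a w => ind (A a.1.1 a.2 w)) ?_ (ht.div hnc.weaken).weaken
    refine RC.rename hA (fun a : (((FinStruct τ × ℕ) × ℕ) × ℕ) × ℕ => ((a.1.1.1, a.1.2), a.2))
      (fun o => o.map fun o => o.map some) ?_ (fun _ => rfl)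
    rintro (_ | _ | i) a <;> rfl
  obtain ⟨P, c, hP⟩ := exists_prog_of_rc (R := fun x => (mkGraph (n x) (hn x) (A x), k x))
    (((hnc.add (.const 1)).add (hnc.pow 2)).congr fun x =>
      (length_encode_digraph (mkGraph (n x) (hn x) (A x))).symm) hkc hO
    (fun x i hi => encode_mkGraph hi)
  refine ⟨_, hQ, ⟨P, fun k => (k + 2) ^ c, c, ?_, fun x => ?_⟩, g, hg, hk⟩
  · exact (computable_pow (Primrec.nat_add.comp .id (.const 2)) (.const c)).to_comp
  · obtain ⟨t, ht, h⟩ := hP x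
    refine ⟨t, ht.trans ?_, h⟩
    rw [← mul_pow]
    refine Nat.pow_le_pow_left ?_ c
    -- With length `N ≥ 2` one has `N + k + 2 ≤ (k + 2) * N`, which separates the parameter from the
    -- length.
    have := two_le_length_encode x.1
    nlinarith

/-! ### Selections given by increasing sequences -/

/-- The pairs of graphs and numbers `k` such that the graph has a clique with `k` elements. -/
def cliqueProblem : Problem digraphVocab :=
  {x | ∃ T : Finset (Fin x.1.card), T.card = x.2 ∧ ∀ a ∈ T, ∀ b ∈ T, a ≠ b → x.1.Adj a b}

/-- The truth value of a quantifier-free formula in the structure that is encoded in a memory. -/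
def QForm.evalNat {τ : Vocab} {s : ℕ} {V : Type} (n : ℕ) (M : ℕ → ℕ) (y : V → ℕ)
    (Y : (Fin s → V) → Prop) : QForm τ s V → Prop
  | .fls => False
  | .eq i j => y i = y j
  | .rel i v => M (relPos τ n i + ∑ j, y (v j) * n ^ (j : ℕ)) = 2
  | .mem v => Y v
  | .imp φ ψ => φ.evalNat n M y Y → ψ.evalNat n M y Y

theorem QForm.evalNat_iff {τ : Vocab} {s : ℕ} {V : Type} (S : FinStruct τ) (k : ℕ)
    (x : V → Fin S.card) {Y Y' : (Fin s → V) → Prop} (hY : ∀ v, Y v ↔ Y' v) (ψ : QForm τ s V) :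
    ψ.evalNat S.card (inputMem (S, k)) (fun j => x j) Y ↔ ψ.eval S x Y' := by
  induction ψ with
  | fls => exact Iff.rfl
  | eq i j => exact Fin.val_inj
  | rel i v =>
    have h := encode_getElem?_rel S i (x ∘ v)
    rw [finFunctionFinEquiv_apply] at h
    simp only [QForm.evalNat, QForm.eval, inputMem]
    simp only [Function.comp_apply] at h
    rw [h]
    cases S.rel i (x ∘ v) <;> simp [cell]
  | mem v => exact hY v
  | imp φ ψ ih ih' => exact imp_congr ih ih'

/-- The coordinates of the tuple `v` with respect to the variables that `A` selects, as one number;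
tuples of elements are read as base-`n` numbers. -/
def subcode {s l : ℕ} (n : ℕ) (A : Fin s → Fin l) (v : ℕ) : ℕ :=
  ∑ j, v / n ^ (A j : ℕ) % n * n ^ (j : ℕ)

/-- All assignments for which the positions `p`, which have the indices `I`, determine the truth
values of the atoms of the relation variable satisfy `ψ`. -/
def LocallyTrue {τ : Vocab} {s l q : ℕ} (ψ : QForm τ s (Fin l)) (n : ℕ) (M : ℕ → ℕ)
    (I p : Fin q → ℕ) : Prop :=
  ∀ v < n ^ l, (∀ A : Fin s → Fin l, (∃ r, p r = subcode n A v + 1) ∨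
      ∃ r r', I r' = I r + 1 ∧ p r < subcode n A v + 1 ∧ subcode n A v + 1 < p r') →
    ψ.evalNat n M (fun j : Fin l => v / n ^ (j : ℕ) % n) (fun A => ∃ r, p r = subcode n A v + 1)

/-- `c` increases on `0, …, k + 1` from `0` to `m + 1`. -/
structure IsSelection (k m : ℕ) (c : ℕ → ℕ) : Prop where
  lt : ∀ i j, i < j → j ≤ k + 1 → c i < c j
  zero : c 0 = 0
  last : c (k + 1) = m + 1

theorem IsSelection.lt_iff {k m : ℕ} {c : ℕ → ℕ} (h : IsSelection k m c) {i j : ℕ}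
    (hi : i ≤ k + 1) (hj : j ≤ k + 1) : i < j ↔ c i < c j := by
  refine ⟨fun hij => h.lt i j hij hj, fun hc => ?_⟩
  rcases lt_trichotomy i j with h' | rfl | h'
  · exact h'
  · exact (lt_irrefl _ hc).elim
  · exact (lt_asymm hc (h.lt j i h' hi)).elim

theorem IsSelection.le {k m : ℕ} {c : ℕ → ℕ} (h : IsSelection k m c) {i : ℕ} (hi : i ≤ k + 1) :
    c i ≤ m + 1 := by
  rcases hi.lt_or_eq with hi | rfl
  · exact h.last ▸ (h.lt i _ hi le_rfl).le
  · exact h.last.le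

theorem IsSelection.exists_between {k m : ℕ} {c : ℕ → ℕ} (h : IsSelection k m c) {a : ℕ}
    (ha : a ≤ m) : ∃ i ≤ k, c i ≤ a ∧ a < c (i + 1) := by
  refine ⟨Nat.findGreatest (fun i => c i ≤ a) k, Nat.findGreatest_le k,
    Nat.findGreatest_spec (P := fun i => c i ≤ a) (Nat.zero_le k) (by simp [h.zero]), ?_⟩
  rcases (Nat.findGreatest_le (P := fun i => c i ≤ a) k).lt_or_eq with hlt | heq
  · exact not_le.1 (Nat.findGreatest_is_greatest (P := fun i => c i ≤ a) (Nat.lt_succ_self _) hlt)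
  · rw [heq, h.last]
    exact Nat.lt_succ_of_le ha

/-- The sequence enumerates `s` in increasing order with the sentinels `0` and `m + 1` added; thanks
to them every number between has a neighbour on both sides. -/
theorem exists_isSelection {k m : ℕ} {s : Finset ℕ} (hs : s.card = k)
    (h1 : ∀ a ∈ s, 1 ≤ a ∧ a ≤ m) : ∃ c, IsSelection k m c ∧
      ∀ a, 1 ≤ a → a ≤ m → (a ∈ s ↔ ∃ i ≤ k + 1, c i = a) := by
  let t : Finset ℕ := insert 0 (insert (m + 1) s)
  have ht : t.card = k + 2 := by
    rw [Finset.card_insert_of_notMem, Finset.card_insert_of_notMem, hs]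
    · exact fun h => by have := h1 _ h; omega
    · rw [Finset.mem_insert, not_or]
      exact ⟨by omega, fun h => by have := h1 _ h; omega⟩
  let e := t.orderEmbOfFin ht
  have hmem : ∀ a, a ∈ t ↔ ∃ i, e i = a := by
    intro a
    rw [← Finset.mem_coe, ← Finset.range_orderEmbOfFin t ht]
    rfl
  have hle : ∀ i, e i ≤ m + 1 := by
    intro i
    have h := (hmem (e i)).2 ⟨i, rfl⟩
    rw [Finset.mem_insert, Finset.mem_insert] at h
    rcases h with h | h | h
    · omega
    · omega
    · have := h1 _ h
      omega
  let c : ℕ → ℕ := fun i => if h : i < k + 2 then e ⟨i, h⟩ else 0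
  have hc : ∀ i (h : i < k + 2), c i = e ⟨i, h⟩ := fun i h => dif_pos h
  refine ⟨c, ⟨fun i j hij hj => ?_, ?_, ?_⟩, fun a ha ha' => ?_⟩
  · rw [hc i (by omega), hc j (by omega)]
    exact e.strictMono hij
  · obtain ⟨i, hi⟩ := (hmem 0).1 (Finset.mem_insert_self _ _)
    rw [hc 0 (by omega), ← Nat.le_zero]
    exact (e.monotone (Fin.zero_le i)).trans hi.le
  · obtain ⟨i, hi⟩ := (hmem (m + 1)).1 (Finset.mem_insert_of_mem (Finset.mem_insert_self _ _))
    rw [hc (k + 1) (by omega)]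
    refine le_antisymm (hle _) (hi ▸ e.monotone ?_)
    exact Fin.le_last i
  · have : a ∈ s ↔ a ∈ t := by
      simp only [t, Finset.mem_insert]
      constructor
      · exact fun h => .inr (.inr h)
      · rintro (h | h | h)
        · omega
        · omega
        · exact h
    rw [this, hmem]
    constructor
    · rintro ⟨i, rfl⟩
      exact ⟨i, by omega, hc i i.2⟩
    · rintro ⟨i, hi, rfl⟩
      exact ⟨_, (hc i (by omega)).symm⟩

theorem subcode_eq {s l n : ℕ} (A : Fin s → Fin l) (x : Fin l → Fin n) :
    subcode n A (finFunctionFinEquiv x) = finFunctionFinEquiv (x ∘ A) := by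
  rw [subcode, finFunctionFinEquiv_apply (x ∘ A)]
  refine Finset.sum_congr rfl fun j _ => ?_
  rw [← finFunctionFinEquiv_symm_apply_val, Equiv.symm_apply_apply]
  rfl

/-- The selected tuples correspond to the inner indices `1, …, k`; the sentinels lie outside the
range of codes shifted by one. -/
theorem IsSelection.card_eq {k s n : ℕ} {c : ℕ → ℕ} (h : IsSelection k (n ^ s) c)
    [DecidablePred fun y : Fin s → Fin n => ∃ i ≤ k + 1, c i = finFunctionFinEquiv y + 1] :
    (Finset.univ.filter fun y : Fin s → Fin n =>
      ∃ i ≤ k + 1, c i = finFunctionFinEquiv y + 1).card = k := by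
  have hpos : ∀ i ∈ Finset.Icc 1 k, 1 ≤ c i ∧ c i - 1 < n ^ s := by
    intro i hi
    rw [Finset.mem_Icc] at hi
    have h1 := h.lt 0 i hi.1 (by omega)
    have h2 := h.lt i (k + 1) (by omega) le_rfl
    rw [h.last] at h2
    omega
  refine Eq.trans (Eq.symm ?_) (show (Finset.Icc 1 k).card = k by simp)
  refine Finset.card_bij
    (fun i hi => finFunctionFinEquiv.symm (⟨c i - 1, (hpos i hi).2⟩ : Fin (n ^ s))) ?_ ?_ ?_
  · intro i hi
    have := (hpos i hi).1
    simp only [Finset.mem_filter, Finset.mem_univ, true_and, Equiv.apply_symm_apply]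
    rw [Finset.mem_Icc] at hi
    exact ⟨i, by omega, by omega⟩
  · intro i hi j hj hij
    have h1 := (hpos i hi).1
    have h2 := (hpos j hj).1
    rw [finFunctionFinEquiv.symm.injective.eq_iff, Fin.mk.injEq] at hij
    rw [Finset.mem_Icc] at hi hj
    have h3 := h.lt_iff (i := i) (j := j) (by omega) (by omega)
    have h4 := h.lt_iff (i := j) (j := i) (by omega) (by omega)
    omega
  · intro y hy
    simp only [Finset.mem_filter, Finset.mem_univ, true_and] at hy
    obtain ⟨i, hi, hy⟩ := hy
    have hlt := (finFunctionFinEquiv y).2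
    have h0 : i ≠ 0 := by
      rintro rfl
      rw [h.zero] at hy
      omega
    have hk : i ≠ k + 1 := by
      rintro rfl
      rw [h.last] at hy
      omega
    refine ⟨i, Finset.mem_Icc.2 (by omega), ?_⟩
    rw [Equiv.symm_apply_eq]
    exact Fin.ext (by simp only [hy]; omega)

/-- A set of `k` tuples that satisfies `∀x₁…∀xₗ ψ` exists iff there is an increasing sequence of
which all parts of bounded length look right. -/
theorem exists_set_iff_exists_isSelection {τ : Vocab} {s l q : ℕ}
    (e : Option ((Fin s → Fin l) × Bool) ≃ Fin q) (ψ : QForm τ s (Fin l)) (S : FinStruct τ) (k : ℕ) :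
    (∃ C : Finset (Fin s → Fin S.card), C.card = k ∧ ∀ x : Fin l → Fin S.card,
      ψ.eval S x (fun v => x ∘ v ∈ C)) ↔
    ∃ c, IsSelection k (S.card ^ s) c ∧ ∀ I : Fin q → ℕ, (∀ r, I r ≤ k + 1) →
      LocallyTrue ψ S.card (inputMem (S, k)) I (c ∘ I) := by
  classical
  constructor
  · rintro ⟨C, hC, h⟩
    obtain ⟨c, hc, hmem⟩ := exists_isSelection (k := k) (m := S.card ^ s)
      (s := C.image fun y => (finFunctionFinEquiv y : ℕ) + 1) (by
        rw [Finset.card_image_of_injective _ ?_, hC]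
        intro y y' hy
        exact finFunctionFinEquiv.injective (Fin.ext (Nat.succ_injective hy))) (by
        intro a ha
        obtain ⟨y, -, rfl⟩ := Finset.mem_image.1 ha
        exact ⟨Nat.le_add_left _ _, (finFunctionFinEquiv y).2⟩)
    have hmem' : ∀ y, y ∈ C ↔ ∃ i ≤ k + 1, c i = finFunctionFinEquiv y + 1 := by
      intro y
      rw [← hmem _ (Nat.le_add_left _ _) (finFunctionFinEquiv y).2, Finset.mem_image]
      constructor
      · exact fun hy => ⟨y, hy, rfl⟩
      · rintro ⟨y', hy', h⟩
        rwa [← finFunctionFinEquiv.injective (Fin.ext (Nat.succ_injective h))]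
    refine ⟨c, hc, fun I hI v hv ha => ?_⟩
    obtain ⟨x, hx⟩ := finFunctionFinEquiv.surjective (⟨v, hv⟩ : Fin (S.card ^ l))
    obtain rfl : (finFunctionFinEquiv x : ℕ) = v := by rw [hx]
    simp only [← finFunctionFinEquiv_symm_apply_val, Equiv.symm_apply_apply, subcode_eq,
      Function.comp_apply] at ha ⊢
    refine (QForm.evalNat_iff S k x (fun A => ?_) ψ).2 (h x)
    rw [hmem']
    constructor
    · rintro ⟨r, hr⟩
      exact ⟨I r, hI r, hr⟩
    -- An atom recorded as lying between two terms of consecutive indices cannot be selected: its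
    -- index would lie strictly between them.
    · rintro ⟨i, hi, hia⟩
      refine (ha A).resolve_right ?_
      rintro ⟨r, r', hrr, h1, h2⟩
      rw [← hia, ← hc.lt_iff (hI r) hi] at h1
      rw [← hia, ← hc.lt_iff hi (hI r')] at h2
      omega
  · rintro ⟨c, hc, h⟩
    refine ⟨_, hc.card_eq, fun x => ?_⟩
    have hlt : ∀ A : Fin s → Fin l, (finFunctionFinEquiv (x ∘ A) : ℕ) + 1 ≤ S.card ^ s :=
      fun A => (finFunctionFinEquiv (x ∘ A)).2
    choose i hik hi hi' using fun A : Fin s → Fin l => hc.exists_between (hlt A)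
    -- Each atom `A` reserves two slots: the index of the last term not above its number, and the
    -- following index. The slot `none` is padding.
    let I : Fin q → ℕ := fun r => (e.symm r).elim 0 fun Ab => i Ab.1 + if Ab.2 then 1 else 0
    have hI : ∀ r, I r ≤ k + 1 := by
      intro r
      simp only [I]
      rcases e.symm r with _ | ⟨A, _ | _⟩
      · simp
      · have := hik A
        simp only [Option.elim]
        simp
        omega
      · have := hik A
        simpa using this
    have hI0 : ∀ A, I (e (some (A, false))) = i A := fun A => by simp [I]
    have hI1 : ∀ A, I (e (some (A, true))) = i A + 1 := fun A => by simp [I]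
    have h := h I hI (finFunctionFinEquiv x) (finFunctionFinEquiv x).2
    simp only [← finFunctionFinEquiv_symm_apply_val, Equiv.symm_apply_apply, subcode_eq,
      Function.comp_apply] at h
    refine (QForm.evalNat_iff S k x (fun A => ?_) ψ).1 (h fun A => ?_)
    · simp only [Finset.mem_filter, Finset.mem_univ, true_and]
      constructor
      · rintro ⟨r, hr⟩
        exact ⟨I r, hI r, hr⟩
      · rintro ⟨j, hj, hja⟩
        have h1 := hi A
        have h2 := hi' A
        rw [← hja] at h1 h2
        rw [← hc.lt_iff hj (by have := hik A; omega)] at h2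
        rw [← not_lt, ← hc.lt_iff hj (by have := hik A; omega)] at h1
        exact ⟨e (some (A, false)), by rw [hI0, ← hja, show j = i A by omega]⟩
    · rcases (hi A).lt_or_eq with h' | h'
      · exact .inr ⟨e (some (A, false)), e (some (A, true)), by rw [hI0, hI1], by rwa [hI0],
          by rw [hI1]; exact hi' A⟩
      · exact .inl ⟨e (some (A, false)), by rw [hI0, h']⟩

/-! ### The reduction to the clique problem -/

/-- The index of the `r`-th position of the tuple of positions `v`. -/
def tupleIdx (k m v r : ℕ) : ℕ := v / ((k + 2) * (m + 2)) ^ r % ((k + 2) * (m + 2)) % (k + 2)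

/-- The `r`-th position of the tuple of positions `v`. -/
def tuplePos (k m v r : ℕ) : ℕ := v / ((k + 2) * (m + 2)) ^ r % ((k + 2) * (m + 2)) / (k + 2)

theorem tupleIdx_lt (k m v r : ℕ) : tupleIdx k m v r < k + 2 := Nat.mod_lt _ (by omega)

theorem tuple_ext {k m q : ℕ} {v w : Fin (((k + 2) * (m + 2)) ^ q)}
    (h : ∀ r : Fin q, tupleIdx k m v r = tupleIdx k m w r)
    (h' : ∀ r : Fin q, tuplePos k m v r = tuplePos k m w r) : v = w := by
  refine finFunctionFinEquiv.symm.injective (funext fun r => Fin.ext ?_)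
  rw [finFunctionFinEquiv_symm_apply_val, finFunctionFinEquiv_symm_apply_val]
  rw [← Nat.mod_add_div (v / _ % _) (k + 2), ← Nat.mod_add_div (w / _ % _) (k + 2)]
  exact congrArg₂ _ (h r) (congrArg _ (h' r))

theorem exists_tuple {k m q : ℕ} (I p : Fin q → ℕ) (hI : ∀ r, I r ≤ k + 1)
    (hp : ∀ r, p r ≤ m + 1) : ∃ v : Fin (((k + 2) * (m + 2)) ^ q),
      (∀ r : Fin q, tupleIdx k m v r = I r) ∧ ∀ r : Fin q, tuplePos k m v r = p r := by
  have hlt : ∀ r, I r + (k + 2) * p r < (k + 2) * (m + 2) := by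
    intro r
    calc I r + (k + 2) * p r < (k + 2) + (k + 2) * p r :=
          Nat.add_lt_add_right (Nat.lt_succ_of_le (hI r)) _
      _ = (k + 2) * (p r + 1) := by ring
      _ ≤ _ := Nat.mul_le_mul_left _ (by have := hp r; omega)
  let d : Fin q → Fin ((k + 2) * (m + 2)) := fun r => ⟨I r + (k + 2) * p r, hlt r⟩
  have hd : ∀ r : Fin q, (finFunctionFinEquiv d : ℕ) / ((k + 2) * (m + 2)) ^ (r : ℕ) %
      ((k + 2) * (m + 2)) = I r + (k + 2) * p r := by
    intro r
    rw [← finFunctionFinEquiv_symm_apply_val, Equiv.symm_apply_apply]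
  have hI' : ∀ r, I r < k + 2 := fun r => Nat.lt_succ_of_le (hI r)
  refine ⟨finFunctionFinEquiv d, fun r => ?_, fun r => ?_⟩
  · rw [tupleIdx, hd, Nat.add_mul_mod_self_left, Nat.mod_eq_of_lt (hI' r)]
  · rw [tuplePos, hd, Nat.add_mul_div_left _ _ (by omega), Nat.div_eq_of_lt (hI' r), zero_add]

/-- The tuples `v` and `w` belong to a common increasing sequence. -/
def TupleCompat (q k m v w : ℕ) : Prop :=
  ∀ r r' : Fin q, (tupleIdx k m v r < tupleIdx k m w r' ↔ tuplePos k m v r < tuplePos k m w r') ∧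
    (tupleIdx k m w r' < tupleIdx k m v r ↔ tuplePos k m w r' < tuplePos k m v r)

/-- The tuple `v` is part of an increasing sequence from `0` to `m + 1`, and it satisfies `P`. -/
def TupleValid (q k m : ℕ) (P : (Fin q → ℕ) → (Fin q → ℕ) → Prop) (v : ℕ) : Prop :=
  TupleCompat q k m v v ∧ (∀ r : Fin q, tupleIdx k m v r = 0 → tuplePos k m v r = 0) ∧
    (∀ r : Fin q, tupleIdx k m v r = k + 1 → tuplePos k m v r = m + 1) ∧
    P (fun r => tupleIdx k m v r) (fun r => tuplePos k m v r)

/-- The adjacency of tuples. -/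
def TupleAdj (q k m : ℕ) (P : (Fin q → ℕ) → (Fin q → ℕ) → Prop) (v w : ℕ) : Prop :=
  v ≠ w ∧ (TupleValid q k m P v ∧ TupleValid q k m P w) ∧ TupleCompat q k m v w

/-- Indices and positions are ordered in the same way, so equal indices exclude both strict orders
of the positions. -/
theorem TupleCompat.pos_eq {q k m v w : ℕ} (h : TupleCompat q k m v w) {r r' : Fin q}
    (hr : tupleIdx k m v r = tupleIdx k m w r') : tuplePos k m v r = tuplePos k m w r' := by
  have := h r r'
  omega

/-- Compatible vertices with the same index tuple coincide, and there are only `(k + 2) ^ q` index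
tuples. A clique of that size thus contains exactly one vertex for each of them, and pairwise
compatibility glues their positions to one increasing sequence. -/
theorem exists_isSelection_iff_clique {q k m : ℕ} (hq : q ≠ 0)
    {P : (Fin q → ℕ) → (Fin q → ℕ) → Prop} (hn : 0 < ((k + 2) * (m + 2)) ^ q) :
    (∃ c, IsSelection k m c ∧ ∀ I : Fin q → ℕ, (∀ r, I r ≤ k + 1) → P I (c ∘ I)) ↔
      (mkGraph (((k + 2) * (m + 2)) ^ q) hn (TupleAdj q k m P), (k + 2) ^ q) ∈ cliqueProblem := by
  classical
  constructor
  · rintro ⟨c, hc, hP⟩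
    have hI : ∀ (I : Fin q → Fin (k + 2)) r, (I r : ℕ) ≤ k + 1 := fun I r => by omega
    choose v hv hv' using fun I : Fin q → Fin (k + 2) =>
      exists_tuple (fun r => (I r : ℕ)) (fun r => c (I r)) (hI I) (fun r => hc.le (hI I r))
    have hinj : Function.Injective v := by
      intro I J h
      funext r
      refine Fin.ext ?_
      rw [← hv I r, ← hv J r, h]
    have hcompat : ∀ I J, TupleCompat q k m (v I) (v J) := by
      intro I J r r'
      rw [hv, hv, hv', hv']
      exact ⟨hc.lt_iff (hI I r) (hI J r'), hc.lt_iff (hI J r') (hI I r)⟩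
    have hvalid : ∀ I, TupleValid q k m P (v I) := by
      refine fun I => ⟨hcompat I I, fun r hr => ?_, fun r hr => ?_, ?_⟩
      · rw [hv] at hr
        rw [hv', hr, hc.zero]
      · rw [hv] at hr
        rw [hv', hr, hc.last]
      · simp only [hv, hv']
        exact hP (fun r => I r) (hI I)
    refine ⟨Finset.univ.image v, ?_, ?_⟩
    · exact (Finset.card_image_of_injective _ hinj).trans (by simp)
    · intro a ha b hb hab
      obtain ⟨I, -, rfl⟩ := Finset.mem_image.1 ha
      obtain ⟨J, -, rfl⟩ := Finset.mem_image.1 hb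
      exact (mkGraph_adj _ _).2 ⟨fun h => hab (Fin.ext h), ⟨hvalid I, hvalid J⟩, hcompat I J⟩
  · rintro ⟨T, hT, h⟩
    change Finset (Fin (((k + 2) * (m + 2)) ^ q)) at T
    change T.card = (k + 2) ^ q at hT
    replace h : ∀ a ∈ T, ∀ b ∈ T, a ≠ b → TupleAdj q k m P a b := fun a ha b hb hab =>
      (mkGraph_adj _ _).1 (h a ha b hb hab)
    -- Validity of a vertex is read off an edge, so every member of the clique needs a neighbour in
    -- it.
    have hT1 : 1 < T.card := by
      rw [hT]
      exact Nat.one_lt_pow hq (by omega)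
    have hvalid : ∀ a ∈ T, TupleValid q k m P a := by
      intro a ha
      obtain ⟨b, hb, hab⟩ := Finset.exists_mem_ne hT1 a
      exact (h a ha b hb hab.symm).2.1.1
    have hcompat : ∀ a ∈ T, ∀ b ∈ T, TupleCompat q k m a b := by
      intro a ha b hb
      by_cases hab : a = b
      · exact hab ▸ (hvalid a ha).1
      · exact (h a ha b hb hab).2.2
    let f : Fin (((k + 2) * (m + 2)) ^ q) → Fin q → Fin (k + 2) :=
      fun v r => ⟨tupleIdx k m v r, tupleIdx_lt _ _ _ _⟩
    have hinj : Set.InjOn f T := by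
      intro a ha b hb hab
      have hidx : ∀ r : Fin q, tupleIdx k m a r = tupleIdx k m b r := fun r =>
        congrArg Fin.val (congrFun hab r)
      exact tuple_ext hidx fun r => (hcompat a ha b hb).pos_eq (hidx r)
    have hsurj : ∀ I : Fin q → Fin (k + 2), ∃ v ∈ T, f v = I := by
      intro I
      have : T.image f = Finset.univ := by
        refine Finset.eq_univ_of_card _ ?_
        rw [Finset.card_image_of_injOn hinj, hT]
        simp
      have hI := Finset.mem_univ I
      rw [← this] at hI
      exact Finset.mem_image.1 hI
    choose v hv hf using hsurj
    have hidx : ∀ I (r : Fin q), tupleIdx k m (v I) r = I r := fun I r =>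
      congrArg Fin.val (congrFun (hf I) r)
    have r₀ : Fin q := ⟨0, Nat.pos_of_ne_zero hq⟩
    -- The term `c i` is taken from the vertex whose indices all equal `i`; by compatibility any
    -- other vertex of the clique that mentions `i` gives the same value.
    let c : ℕ → ℕ := fun i => tuplePos k m (v fun _ => Fin.ofNat (k + 2) i) r₀
    have hci : ∀ i (hi : i ≤ k + 1), tupleIdx k m (v fun _ => Fin.ofNat (k + 2) i) r₀ = i := by
      intro i hi
      rw [hidx]
      exact Nat.mod_eq_of_lt (by omega)
    refine ⟨c, ⟨fun i j hij hj => ?_, ?_, ?_⟩, fun I hI => ?_⟩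
    · refine ((hcompat _ (hv _) _ (hv _)) r₀ r₀).1.1 ?_
      rwa [hci i (by omega), hci j hj]
    · exact (hvalid _ (hv _)).2.1 r₀ (hci 0 (by omega))
    · exact (hvalid _ (hv _)).2.2.1 r₀ (hci (k + 1) le_rfl)
    · let J : Fin q → Fin (k + 2) := fun r => ⟨I r, Nat.lt_succ_of_le (hI r)⟩
      have := (hvalid _ (hv J)).2.2.2
      have h1 : (fun r : Fin q => tupleIdx k m (v J) r) = I := funext fun r => hidx J r
      have h2 : (fun r : Fin q => tuplePos k m (v J) r) = c ∘ I := funext fun r =>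
        (hcompat _ (hv J) _ (hv _)).pos_eq (by rw [hidx, hci _ (hI r)])
      rwa [h1, h2] at this

theorem tupleCompat_comm {q k m v w : ℕ} : TupleCompat q k m v w ↔ TupleCompat q k m w v :=
  ⟨fun h r r' => (h r' r).symm, fun h r r' => (h r' r).symm⟩

theorem isBasic_mkGraph {n : ℕ} {hn : 0 < n} {A : ℕ → ℕ → Prop}
    (h : ∀ v w, A v w → v ≠ w ∧ A w v) : (mkGraph n hn A).IsBasic := by
  intro x y hxy
  have := h _ _ ((mkGraph_adj (hn := hn) x y).1 hxy)
  exact ⟨fun h => this.1 (congrArg Fin.val h), (mkGraph_adj _ _).2 this.2⟩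

theorem TupleAdj.symm {q k m v w : ℕ} {P : (Fin q → ℕ) → (Fin q → ℕ) → Prop}
    (h : TupleAdj q k m P v w) : v ≠ w ∧ TupleAdj q k m P w v :=
  ⟨h.1, h.1.symm, h.2.1.symm, tupleCompat_comm.1 h.2.2⟩

/-! ### Programs for the reduction to clique -/

section

variable {α ι : Type} {V : ι → α → ℕ} {M : α → ℕ → ℕ} {K N W W' : α → ℕ}

theorem RC.tupleIdx (hK : RC V M K) (hN : RC V M N) (hW : RC V M W) (r : ℕ) :
    RC V M (fun a => tupleIdx (K a) (N a) (W a) r) :=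
  have hD := (hK.add (.const 2)).mul (hN.add (.const 2))
  ((hW.div (hD.pow r)).mod hD).mod (hK.add (.const 2))

theorem RC.tuplePos (hK : RC V M K) (hN : RC V M N) (hW : RC V M W) (r : ℕ) :
    RC V M (fun a => tuplePos (K a) (N a) (W a) r) :=
  have hD := (hK.add (.const 2)).mul (hN.add (.const 2))
  ((hW.div (hD.pow r)).mod hD).div (hK.add (.const 2))

theorem RC.tupleCompat (q : ℕ) (hK : RC V M K) (hN : RC V M N) (hW : RC V M W)
    (hW' : RC V M W') : RCP V M (fun a => TupleCompat q (K a) (N a) (W a) (W' a)) :=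
  RCP.all fun r => RCP.all fun r' =>
    (((hK.tupleIdx hN hW r).lt (hK.tupleIdx hN hW' r')).iff
      ((hK.tuplePos hN hW r).lt (hK.tuplePos hN hW' r'))).and
    (((hK.tupleIdx hN hW' r').lt (hK.tupleIdx hN hW r)).iff
      ((hK.tuplePos hN hW' r').lt (hK.tuplePos hN hW r)))

theorem RC.relPos {τ : Vocab} (hN : RC V M N) (i : Fin τ.num) :
    RC V M (fun a => relPos τ (N a) i) := by
  refine (hN.add (.const 1)).add (RC.finset_sum _ fun _ => ?_)
  split_ifs
  · exact hN.pow _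
  · exact .const 0

theorem RC.evalNat {τ : Vocab} {s : ℕ} {U : Type} {y : U → α → ℕ} {Y : (Fin s → U) → α → Prop}
    (hN : RC V M N) (hy : ∀ j, RC V M (y j)) (hY : ∀ v, RCP V M (Y v)) (ψ : QForm τ s U) :
    RCP V M (fun a => ψ.evalNat (N a) (M a) (fun j => y j a) (fun v => Y v a)) := by
  induction ψ with
  | fls => exact .const False
  | eq i j => exact (hy i).eq (hy j)
  | rel i v =>
    exact ((hN.relPos i).add (RC.finset_sum _ fun j => (hy (v j)).mul (hN.pow j))).mem.eq
      (.const 2)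
  | mem v => exact hY v
  | imp φ ψ ih ih' => exact ih.imp ih'

theorem RC.subcode {s l : ℕ} (hN : RC V M N) (A : Fin s → Fin l) (hW : RC V M W) :
    RC V M (fun a => subcode (N a) A (W a)) :=
  RC.finset_sum _ fun _ => ((hW.div (hN.pow _)).mod hN).mul (hN.pow _)

theorem RC.locallyTrue {τ : Vocab} {s l q : ℕ} (ψ : QForm τ s (Fin l)) (hN : RC V M N)
    {I p : Fin q → α → ℕ} (hI : ∀ r, RC V M (I r)) (hp : ∀ r, RC V M (p r)) :
    RCP V M (fun a => LocallyTrue ψ (N a) (M a) (fun r => I r a) (fun r => p r a)) := by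
  have hc : ∀ A : Fin s → Fin l, RC (extVar V) (extMem M)
      (fun a => ParamESO.subcode (N a.1) A a.2 + 1) :=
    fun A => (hN.weaken.subcode A .newVar).add (.const 1)
  have hY : ∀ A : Fin s → Fin l, RCP (extVar V) (extMem M)
      (fun a => ∃ r, p r a.1 = ParamESO.subcode (N a.1) A a.2 + 1) :=
    fun A => RCP.ex fun r => (hp r).weaken.eq (hc A)
  refine RCP.ball (hN.pow l) (RCP.imp (RCP.all fun A => (hY A).or (RCP.ex fun r => RCP.ex fun r' =>
    ((hI r').weaken.eq ((hI r).weaken.add (.const 1))).and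
      (((hp r).weaken.lt (hc A)).and ((hc A).lt (hp r').weaken)))) ?_)
  exact RC.evalNat (M := extMem M) (y := fun (j : Fin l) (a : α × ℕ) => a.2 / N a.1 ^ (j : ℕ) % N a.1)
    hN.weaken (fun j => (RC.newVar.div (hN.weaken.pow _)).mod hN.weaken) hY ψ

end

theorem RC.length {τ : Vocab} : RC (inputVar (τ := τ)) inputMem (fun x => x.1.encode.length) :=
  RC.var true

theorem RC.param {τ : Vocab} : RC (inputVar (τ := τ)) inputMem (fun x => x.2) := RC.var false

/-- The number of elements is the length of the initial run of ones in the encoding; it is obtained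
by counting the positions up to which all cells hold a one. -/
theorem RC.card {τ : Vocab} : RC (inputVar (τ := τ)) inputMem (fun x => x.1.card) := by
  have h : RCP (extVar (inputVar (τ := τ))) (extMem inputMem)
      (fun a : (FinStruct τ × ℕ) × ℕ => ∀ j < a.2 + 1, inputMem a.1 j = 2) :=
    RCP.ball (T := fun a : (FinStruct τ × ℕ) × ℕ => a.2 + 1)
      (r := fun (a : (FinStruct τ × ℕ) × ℕ) j => inputMem a.1 j = 2)
      (RC.newVar.add (.const 1)) ((RC.mem (M := extMem (extMem inputMem)) RC.newVar).eq (.const 2))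
  refine (RC.sum (H := fun x i => ind (∀ j < i + 1, inputMem x j = 2)) RC.length h).congr
    fun x => ?_
  have key : ∀ i, (∀ j < i + 1, inputMem x j = 2) ↔ i < x.1.card := by
    intro i
    constructor
    · intro h
      by_contra hi
      have := h x.1.card (by omega)
      rw [inputMem, encode_getElem?_card] at this
      simp [cell] at this
    · intro hi j hj
      rw [inputMem, encode_getElem?_lt x.1 (by omega)]
      rfl
  have hlen : x.1.card ≤ x.1.encode.length := by
    rw [length_encode, structLen]
    omega
  simp only [key, ind, Finset.sum_boole, Nat.cast_id]
  rw [show (Finset.range x.1.encode.length).filter (fun i => i < x.1.card) =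
    Finset.range x.1.card from ?_, Finset.card_range]
  ext i
  simp only [Finset.mem_filter, Finset.mem_range]
  omega

/-- Every weighted Fagin-definable problem of a universal formula can be reduced to each problem that
agrees with the clique problem on basic graphs. -/
theorem fptReducible_clique {τ : Vocab} {s l : ℕ} {Q : Problem τ}
    (hQ : Q ∈ FD τ s (List.replicate l Quant.a)) {Q' : Problem digraphVocab}
    (hQ' : ∀ G k, G.IsBasic → ((G, k) ∈ Q' ↔ (G, k) ∈ cliqueProblem)) : FPTReducible Q Q' := by
  obtain ⟨φ, hφ, rfl⟩ := hQ
  obtain ⟨ψ₀, hψ₀⟩ := exists_matrix_all φ hφ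
  let ψ : QForm τ s (Fin l) := ψ₀.map (Sum.elim Fin.elim0 id)
  have hψ : ∀ S C, realizeX S C φ Fin.elim0 ↔ ∀ y : Fin l → Fin S.card,
      ψ.eval S y (fun v => y ∘ v ∈ C) := by
    intro S C
    rw [hψ₀]
    refine forall_congr' fun y => ?_
    have : y ∘ (Sum.elim Fin.elim0 id) = Sum.elim Fin.elim0 y := by
      funext i
      rcases i with i | i
      · exact i.elim0
      · rfl
    rw [QForm.eval_map]
    simp only [← Function.comp_assoc, this]
  -- Two slots for every possible atom of `X`, and one more, so that `q` is positive even if there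
  -- are no atoms.
  let q := Fintype.card (Option ((Fin s → Fin l) × Bool))
  have hq : q ≠ 0 := Fintype.card_ne_zero
  have e : Option ((Fin s → Fin l) × Bool) ≃ Fin q := Fintype.equivFin _
  have hpos : ∀ x : FinStruct τ × ℕ, 0 < ((x.2 + 2) * (x.1.card ^ s + 2)) ^ q := fun x => by
    positivity
  have hm : RC (inputVar (τ := τ)) inputMem (fun x => x.1.card ^ s) := RC.card.pow s
  have hvalid : RCP (extVar inputVar) (extMem inputMem) (fun a : (FinStruct τ × ℕ) × ℕ =>
      TupleValid q a.1.2 (a.1.1.card ^ s) (LocallyTrue ψ a.1.1.card (inputMem a.1)) a.2) := by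
    have hk := (RC.param (τ := τ)).weaken
    have hm := hm.weaken
    have hi := hk.tupleIdx hm RC.newVar
    have hp := hk.tuplePos hm RC.newVar
    refine (hk.tupleCompat q hm .newVar .newVar).and ((RCP.all fun r : Fin q => ((hi r).eq (.const 0)).imp
      ((hp r).eq (.const 0))).and ((RCP.all fun r : Fin q => ((hi r).eq (hk.add (.const 1))).imp
      ((hp r).eq (hm.add (.const 1)))).and ?_))
    exact RC.locallyTrue (M := extMem inputMem) ψ (RC.card (τ := τ)).weaken (fun r : Fin q => hi r)
      (fun r => hp r)
  refine fptReducible_of_mkGraph (n := fun x => ((x.2 + 2) * (x.1.card ^ s + 2)) ^ q)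
    (k := fun x => (x.2 + 2) ^ q) hpos
    (A := fun x => TupleAdj q x.2 (x.1.card ^ s) (LocallyTrue ψ x.1.card (inputMem x)))
    ((((RC.param.add (.const 2)).mul (hm.add (.const 2)))).pow q)
    ((RC.param.add (.const 2)).pow q) ?_ (g := fun k => (k + 2) ^ q) ?_ (fun x => le_rfl) ?_
  · have hvalid' : RCP (extVar (extVar inputVar)) (extMem (extMem inputMem))
        (fun a : ((FinStruct τ × ℕ) × ℕ) × ℕ => TupleValid q a.1.1.2 (a.1.1.1.card ^ s)
          (LocallyTrue ψ a.1.1.1.card (inputMem a.1.1)) a.2) := by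
      refine RC.rename hvalid (fun a : ((FinStruct τ × ℕ) × ℕ) × ℕ => (a.1.1, a.2))
        (fun o => o.map some) ?_ (fun _ => rfl)
      rintro (_ | i) a <;> rfl
    exact (RC.newVar.weaken.eq RC.newVar).not.and ((hvalid.weaken.and hvalid').and
      ((RC.param.weaken.weaken).tupleCompat q hm.weaken.weaken RC.newVar.weaken .newVar))
  · exact (computable_pow (Primrec.nat_add.comp .id (.const 2)) (.const q)).to_comp
  · rintro ⟨S, k⟩
    rw [mem_modelsEq]
    simp only [hψ]
    rw [exists_set_iff_exists_isSelection e ψ S k, exists_isSelection_iff_clique hq (hpos (S, k))]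
    exact (hQ' _ _ (isBasic_mkGraph fun v w h => h.symm)).symm

/-! ### The reduction to the total domination problem -/

/-- The pairs of graphs and numbers `k` such that the graph has a total dominating set with `k`
elements. -/
def totalDominationProblem : Problem digraphVocab :=
  {x | ∃ T : Finset (Fin x.1.card), T.card = x.2 ∧ ∀ a, ∃ b ∈ T, x.1.Adj a b}

/-- The points `a` and `b`, which are pairs of an index and a vertex, do not fit together: one of
them has the spurious vertex `n`, or their vertices are not distinct and adjacent. -/
def PairBad (k n : ℕ) (E : ℕ → ℕ → Prop) (a b : ℕ) : Prop :=
  a / (k + 2) = n ∨ b / (k + 2) = n ∨ (a % (k + 2) ≠ b % (k + 2) ∧ a % (k + 2) < k ∧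
    b % (k + 2) < k ∧ ¬ (E (a / (k + 2)) (b / (k + 2)) ∧ a / (k + 2) ≠ b / (k + 2)))

/-- The point `d` excludes that both points of the pair `t` are selected, or the pair is not bad. -/
def PairDom (k n : ℕ) (E : ℕ → ℕ → Prop) (d t : ℕ) : Prop :=
  ¬ PairBad k n E (t % ((k + 2) * (n + 1))) (t / ((k + 2) * (n + 1))) ∨
    (d % (k + 2) = t % ((k + 2) * (n + 1)) % (k + 2) ∧
      d / (k + 2) ≠ t % ((k + 2) * (n + 1)) / (k + 2)) ∨
    (d % (k + 2) = t / ((k + 2) * (n + 1)) % (k + 2) ∧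
      d / (k + 2) ≠ t / ((k + 2) * (n + 1)) / (k + 2))

/-- The adjacency of the points, which come first, and the pairs of points. -/
def PairAdj (k n : ℕ) (E : ℕ → ℕ → Prop) (v w : ℕ) : Prop :=
  (v < (k + 2) * (n + 1) ∧ w < (k + 2) * (n + 1) ∧ v ≠ w) ∨
    (v < (k + 2) * (n + 1) ∧ (k + 2) * (n + 1) ≤ w ∧ PairDom k n E v (w - (k + 2) * (n + 1))) ∨
    (w < (k + 2) * (n + 1) ∧ (k + 2) * (n + 1) ≤ v ∧ PairDom k n E w (v - (k + 2) * (n + 1)))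

theorem PairAdj.symm {k n : ℕ} {E : ℕ → ℕ → Prop} {v w : ℕ} (h : PairAdj k n E v w) :
    v ≠ w ∧ PairAdj k n E w v := by
  rcases h with h | h | h
  · exact ⟨h.2.2, .inl ⟨h.2.1, h.1, h.2.2.symm⟩⟩
  · exact ⟨by omega, .inr (.inr h)⟩
  · exact ⟨by omega, .inr (.inl h)⟩

theorem point_lt {k n i u : ℕ} (hi : i < k + 2) (hu : u < n + 1) :
    i + (k + 2) * u < (k + 2) * (n + 1) :=
  calc i + (k + 2) * u < (k + 2) * (u + 1) := by rw [Nat.mul_succ]; omega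
    _ ≤ _ := Nat.mul_le_mul_left _ hu

/-- A bad pair `(a, b)` is adjacent exactly to the points that share the index of `a` or of `b` but
have a different vertex. The pairs `(a, a)` with spurious vertex force a selected point with a
genuine vertex for every index. Hence the budget `k + 2` allows one point per index, and then a bad
pair is dominated iff not both of its points are selected. The two additional indices, which carry
no constraint, keep at least two selected points available for dominating the points themselves,
even for `k ≤ 1`. -/
theorem exists_clique_iff_totalDomination {k n : ℕ} (hn : 0 < n) {E : ℕ → ℕ → Prop}
    (hN : 0 < (k + 2) * (n + 1) + (k + 2) * (n + 1) * ((k + 2) * (n + 1))) :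
    (∃ u : ℕ → ℕ, (∀ i < k, u i < n) ∧ ∀ i < k, ∀ j < k, i ≠ j → E (u i) (u j) ∧ u i ≠ u j) ↔
      (mkGraph ((k + 2) * (n + 1) + (k + 2) * (n + 1) * ((k + 2) * (n + 1))) hN (PairAdj k n E),
        k + 2) ∈ totalDominationProblem := by
  classical
  obtain ⟨D, hD⟩ : ∃ D, D = (k + 2) * (n + 1) := ⟨_, rfl⟩
  have hD0 : 0 < D := by rw [hD]; positivity
  have hmod : ∀ i u, i < k + 2 → (i + (k + 2) * u) % (k + 2) = i := fun i u hi => by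
    rw [Nat.add_mul_mod_self_left, Nat.mod_eq_of_lt hi]
  have hdiv : ∀ i u, i < k + 2 → (i + (k + 2) * u) / (k + 2) = u := fun i u hi => by
    rw [Nat.add_mul_div_left _ _ (by omega), Nat.div_eq_of_lt hi, zero_add]
  constructor
  · rintro ⟨u, hu, h⟩
    -- The two indices without constraints select the vertex `0`, which exists because `0 < n`.
    let u' : ℕ → ℕ := fun i => if i < k then u i else 0
    have hu' : ∀ i, u' i < n := by
      intro i
      simp only [u']
      split_ifs with hi
      · exact hu i hi
      · exact hn
    have hlt : ∀ i : Fin (k + 2), (i : ℕ) + (k + 2) * u' i < D := fun i =>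
      hD ▸ point_lt i.2 ((hu' i).trans (Nat.lt_succ_self n))
    let y : Fin (k + 2) → Fin ((k + 2) * (n + 1) + (k + 2) * (n + 1) * ((k + 2) * (n + 1))) :=
      fun i => ⟨i + (k + 2) * u' i, (hD ▸ hlt i).trans_le (Nat.le_add_right _ _)⟩
    have hy : ∀ i, (y i : ℕ) % (k + 2) = i ∧ (y i : ℕ) / (k + 2) = u' i ∧ (y i : ℕ) < D :=
      fun i => ⟨hmod _ _ i.2, hdiv _ _ i.2, hlt i⟩
    have hinj : Function.Injective y := by
      intro i j hij
      refine Fin.ext ?_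
      rw [← (hy i).1, ← (hy j).1, hij]
    refine ⟨Finset.univ.image y, ?_, fun v => ?_⟩
    · exact (Finset.card_image_of_injective _ hinj).trans (by simp)
    suffices ∃ i, PairAdj k n E v (y i) by
      obtain ⟨i, hi⟩ := this
      exact ⟨y i, Finset.mem_image_of_mem _ (Finset.mem_univ i), (mkGraph_adj _ _).2 hi⟩
    change Fin ((k + 2) * (n + 1) + (k + 2) * (n + 1) * ((k + 2) * (n + 1))) at v
    rcases lt_or_ge (v : ℕ) D with hv | hv
    -- Points are mutually adjacent, so it is enough to take a selected point with another index:
    -- `1` if `v` has index `0`, and `0` otherwise.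
    · by_cases h0 : (v : ℕ) % (k + 2) = 0
      · refine ⟨1, .inl ⟨hD ▸ hv, hD ▸ (hy 1).2.2, fun h => ?_⟩⟩
        have := (hy 1).1
        rw [← h, h0] at this
        simp at this
      · refine ⟨0, .inl ⟨hD ▸ hv, hD ▸ (hy 0).2.2, fun h => ?_⟩⟩
        have := (hy 0).1
        rw [← h] at this
        exact h0 this
    · suffices ∃ i, PairDom k n E (y i) (v - D) by
        obtain ⟨i, hi⟩ := this
        exact ⟨i, .inr (.inr ⟨hD ▸ (hy i).2.2, hD ▸ hv, hD ▸ hi⟩)⟩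
      obtain ⟨a, ha⟩ : ∃ a, a = ((v : ℕ) - D) % D := ⟨_, rfl⟩
      obtain ⟨b, hb⟩ : ∃ b, b = ((v : ℕ) - D) / D := ⟨_, rfl⟩
      simp only [PairDom, ← hD, ← ha, ← hb]
      by_cases hbad : PairBad k n E a b
      · have ha' : a % (k + 2) < k + 2 := Nat.mod_lt _ (by omega)
        have hb' : b % (k + 2) < k + 2 := Nat.mod_lt _ (by omega)
        have hya := hy ⟨_, ha'⟩
        have hyb := hy ⟨_, hb'⟩
        have hua := hu' (a % (k + 2))
        have hub := hu' (b % (k + 2))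
        rcases hbad with h1 | h1 | ⟨h1, h2, h3, h4⟩
        · refine ⟨⟨_, ha'⟩, .inr (.inl ⟨hya.1, ?_⟩)⟩
          rw [hya.2.1, h1]
          exact hua.ne
        · refine ⟨⟨_, hb'⟩, .inr (.inr ⟨hyb.1, ?_⟩)⟩
          rw [hyb.2.1, h1]
          exact hub.ne
        · by_cases h5 : u' (a % (k + 2)) = a / (k + 2)
          · by_cases h6 : u' (b % (k + 2)) = b / (k + 2)
            · refine (h4 ?_).elim
              have := h _ h2 _ h3 h1
              simp only [u', h2, h3, if_true] at h5 h6
              rwa [h5, h6] at this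
            · refine ⟨⟨_, hb'⟩, .inr (.inr ⟨hyb.1, ?_⟩)⟩
              rwa [hyb.2.1]
          · refine ⟨⟨_, ha'⟩, .inr (.inl ⟨hya.1, ?_⟩)⟩
            rwa [hya.2.1]
      · exact ⟨0, .inl hbad⟩
  · rintro ⟨T, hT, h⟩
    change Finset (Fin ((k + 2) * (n + 1) + (k + 2) * (n + 1) * ((k + 2) * (n + 1)))) at T
    change T.card = k + 2 at hT
    have hdom : ∀ a b, a < D → b < D → ∃ d ∈ T, (d : ℕ) < D ∧ (¬ PairBad k n E a b ∨
        ((d : ℕ) % (k + 2) = a % (k + 2) ∧ (d : ℕ) / (k + 2) ≠ a / (k + 2)) ∨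
        ((d : ℕ) % (k + 2) = b % (k + 2) ∧ (d : ℕ) / (k + 2) ≠ b / (k + 2))) := by
      intro a b ha hb
      have hlt : D + (a + D * b) < D + D * D := by
        have : D * (b + 1) ≤ D * D := Nat.mul_le_mul_left _ hb
        rw [Nat.mul_succ] at this
        omega
      -- The vertex for the pair `(a, b)` can be dominated only by a point, because pairs are not
      -- adjacent to each other.
      obtain ⟨d, hd, hadj⟩ := h ⟨D + (a + D * b), by rwa [hD] at hlt ⊢⟩
      replace hadj := (mkGraph_adj _ _).1 hadj
      simp only [PairAdj, PairDom, ← hD, Nat.add_sub_cancel_left, Nat.add_mul_mod_self_left,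
        Nat.mod_eq_of_lt ha, Nat.add_mul_div_left _ _ hD0, Nat.div_eq_of_lt ha, zero_add] at hadj
      refine ⟨d, hd, ?_⟩
      rcases hadj with hadj | hadj | hadj
      · omega
      · omega
      · exact ⟨hadj.1, hadj.2.2⟩
    have hex : ∀ i : Fin (k + 2), ∃ d ∈ T, (d : ℕ) < D ∧ (d : ℕ) % (k + 2) = i ∧
        (d : ℕ) / (k + 2) ≠ n := by
      intro i
      have ha : (i : ℕ) + (k + 2) * n < D := hD ▸ point_lt i.2 (Nat.lt_succ_self n)
      obtain ⟨d, hd, hdD, h⟩ := hdom _ _ ha ha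
      rw [hmod _ _ i.2, hdiv _ _ i.2, or_self] at h
      exact ⟨d, hd, hdD, h.resolve_left fun h => h (.inl (hdiv _ _ i.2))⟩
    choose y hyT hyD hyi hyn using hex
    -- The budget is used up by the `k + 2` points of different index, so `T` contains nothing else.
    have hsurj : ∀ d ∈ T, ∃ i, y i = d := by
      have hinj : Function.Injective y := fun i j hij => Fin.ext (by rw [← hyi i, ← hyi j, hij])
      have : Finset.univ.image y = T := by
        refine Finset.eq_of_subset_of_card_le (fun d hd => ?_) ?_
        · obtain ⟨i, -, rfl⟩ := Finset.mem_image.1 hd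
          exact hyT i
        · rw [Finset.card_image_of_injective _ hinj, hT]
          simp
      intro d hd
      rw [← this] at hd
      obtain ⟨i, -, h⟩ := Finset.mem_image.1 hd
      exact ⟨i, h⟩
    have hun : ∀ i, (y i : ℕ) / (k + 2) < n := by
      intro i
      have h1 : (y i : ℕ) / (k + 2) < n + 1 := Nat.div_lt_of_lt_mul (hD ▸ hyD i)
      have := hyn i
      omega
    have hgood : ∀ i j, ¬ PairBad k n E (y i) (y j) := by
      intro i j
      obtain ⟨d, hd, -, h⟩ := hdom _ _ (hyD i) (hyD j)
      obtain ⟨m, rfl⟩ := hsurj d hd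
      -- A dominator with the index of `y i` or `y j` is that very point, so it cannot have a
      -- different vertex.
      refine h.resolve_right ?_
      rintro (⟨h1, h2⟩ | ⟨h1, h2⟩)
      · rw [hyi, hyi, Fin.val_inj] at h1
        exact h2 (h1 ▸ rfl)
      · rw [hyi, hyi, Fin.val_inj] at h1
        exact h2 (h1 ▸ rfl)
    have hof : ∀ i < k, ((Fin.ofNat (k + 2) i : Fin (k + 2)) : ℕ) = i := fun i hi =>
      Nat.mod_eq_of_lt (by omega)
    refine ⟨fun i => (y (Fin.ofNat (k + 2) i) : ℕ) / (k + 2), fun i _ => hun _,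
      fun i hi j hj hij => ?_⟩
    by_contra hc
    refine hgood (Fin.ofNat (k + 2) i) (Fin.ofNat (k + 2) j) (.inr (.inr ?_))
    rw [hyi, hyi, hof i hi, hof j hj]
    exact ⟨hij, hi, hj, hc⟩

/-- Restates cliques through sequences of numbers and memory cells, the form in which the gadget
graph is computed from the input. -/
theorem mem_cliqueProblem_iff {G : FinStruct digraphVocab} {k : ℕ} : (G, k) ∈ cliqueProblem ↔
    ∃ u : ℕ → ℕ, (∀ i < k, u i < G.card) ∧ ∀ i < k, ∀ j < k, i ≠ j →
      inputMem (G, k) (G.card + 1 + (u i + u j * G.card)) = 2 ∧ u i ≠ u j := by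
  classical
  have key : ∀ a b : Fin G.card,
      inputMem (G, k) (G.card + 1 + (a + b * G.card)) = 2 ↔ G.Adj a b := by
    intro a b
    have hlt : (a : ℕ) + b * G.card < G.card ^ 2 := by
      have : (b + 1) * G.card ≤ G.card * G.card := Nat.mul_le_mul_right _ b.2
      rw [add_mul] at this
      rw [pow_two]
      omega
    rw [inputMem, encode_digraph G hlt, FinStruct.Adj]
    have ha : (⟨((a : ℕ) + b * G.card) % G.card, Nat.mod_lt _ G.card_pos⟩ : Fin G.card) = a :=
      Fin.ext (by simp [Nat.add_mul_mod_self_right, Nat.mod_eq_of_lt a.2])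
    have hb : ∀ h, (⟨((a : ℕ) + b * G.card) / G.card, h⟩ : Fin G.card) = b := fun h =>
      Fin.ext (by simp [Nat.add_mul_div_right _ _ G.card_pos, Nat.div_eq_of_lt a.2])
    rw [ha, hb]
    cases G.rel (0 : Fin 1) (![a, b] : Fin 2 → Fin G.card) <;> simp [cell]
  constructor
  · rintro ⟨T, hT, h⟩
    let e := (T.equivFinOfCardEq hT).symm
    refine ⟨fun i => if hi : i < k then (e ⟨i, hi⟩).1 else 0, fun i hi => ?_,
      fun i hi j hj hij => ?_⟩
    · simp only [hi, dif_pos]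
      exact (e ⟨i, hi⟩).1.2
    · simp only [hi, hj, dif_pos]
      have hne : (e ⟨i, hi⟩).1 ≠ (e ⟨j, hj⟩).1 := fun h =>
        hij (congrArg Fin.val (e.injective (Subtype.ext h)))
      exact ⟨(key _ _).2 (h _ (e ⟨i, hi⟩).2 _ (e ⟨j, hj⟩).2 hne), fun h => hne (Fin.ext h)⟩
  · rintro ⟨u, hu, h⟩
    let v : Fin k → Fin G.card := fun i => ⟨u i, hu i i.2⟩
    have hinj : Function.Injective v := by
      intro i j hij
      by_contra hne
      exact (h i i.2 j j.2 (fun h => hne (Fin.ext h))).2 (congrArg Fin.val hij)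
    refine ⟨Finset.univ.image v, ?_, ?_⟩
    · exact (Finset.card_image_of_injective _ hinj).trans (by simp)
    · intro a ha b hb hab
      obtain ⟨i, -, rfl⟩ := Finset.mem_image.1 ha
      obtain ⟨j, -, rfl⟩ := Finset.mem_image.1 hb
      exact (key _ _).1 (h i i.2 j j.2 (fun h => hab (congrArg v (Fin.ext h)))).1

/-! ### Programs for the reduction to total domination -/

section

variable {α ι : Type} {V : ι → α → ℕ} {M : α → ℕ → ℕ} {K N W W' : α → ℕ}

theorem RC.pairBad (hK : RC V M K) (hN : RC V M N) (hW : RC V M W) (hW' : RC V M W') :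
    RCP V M (fun a => PairBad (K a) (N a) (fun u w => M a (N a + 1 + (u + w * N a)) = 2)
      (W a) (W' a)) :=
  have hK2 := hK.add (.const 2)
  ((hW.div hK2).eq hN).or (((hW'.div hK2).eq hN).or
    (((hW.mod hK2).eq (hW'.mod hK2)).not.and (((hW.mod hK2).lt hK).and (((hW'.mod hK2).lt hK).and
      ((((((hN.add (.const 1)).add ((hW.div hK2).add ((hW'.div hK2).mul hN))).mem).eq
        (.const 2)).and ((hW.div hK2).eq (hW'.div hK2)).not).not)))))

theorem RC.pairDom (hK : RC V M K) (hN : RC V M N) (hW : RC V M W) (hW' : RC V M W') :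
    RCP V M (fun a => PairDom (K a) (N a) (fun u w => M a (N a + 1 + (u + w * N a)) = 2)
      (W a) (W' a)) :=
  have hK2 := hK.add (.const 2)
  have hD := hK2.mul (hN.add (.const 1))
  (hK.pairBad hN (hW'.mod hD) (hW'.div hD)).not.or
    ((((hW.mod hK2).eq ((hW'.mod hD).mod hK2)).and ((hW.div hK2).eq ((hW'.mod hD).div hK2)).not).or
    (((hW.mod hK2).eq ((hW'.div hD).mod hK2)).and ((hW.div hK2).eq ((hW'.div hD).div hK2)).not))

theorem RC.pairAdj (hK : RC V M K) (hN : RC V M N) (hW : RC V M W) (hW' : RC V M W') :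
    RCP V M (fun a => PairAdj (K a) (N a) (fun u w => M a (N a + 1 + (u + w * N a)) = 2)
      (W a) (W' a)) :=
  have hD := (hK.add (.const 2)).mul (hN.add (.const 1))
  ((hW.lt hD).and ((hW'.lt hD).and (hW.eq hW').not)).or
    (((hW.lt hD).and ((hD.le hW').and (hK.pairDom hN hW (hW'.sub hD)))).or
    ((hW'.lt hD).and ((hD.le hW).and (hK.pairDom hN hW' (hW.sub hD)))))

end

/-- The clique problem can be reduced to each problem that agrees with the total domination problem
on basic graphs. -/
theorem fptReducible_totalDomination {Q : Problem digraphVocab}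
    (hQ : ∀ G k, G.IsBasic → ((G, k) ∈ Q ↔ (G, k) ∈ totalDominationProblem)) :
    FPTReducible cliqueProblem Q := by
  have hD : RC (inputVar (τ := digraphVocab)) inputMem
      (fun x => (x.2 + 2) * (x.1.card + 1)) :=
    (RC.param.add (.const 2)).mul (RC.card.add (.const 1))
  refine fptReducible_of_mkGraph (n := fun x => (x.2 + 2) * (x.1.card + 1) +
    (x.2 + 2) * (x.1.card + 1) * ((x.2 + 2) * (x.1.card + 1))) (k := fun x => x.2 + 2)
    (fun x => by positivity) (A := fun x => PairAdj x.2 x.1.card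
      fun u w => inputMem x (x.1.card + 1 + (u + w * x.1.card)) = 2)
    (hD.add (hD.mul hD)) (RC.param.add (.const 2))
    (RC.pairAdj (M := extMem (extMem inputMem)) RC.param.weaken.weaken RC.card.weaken.weaken
      RC.newVar.weaken .newVar) (g := fun k => k + 2) ?_ (fun x => le_rfl) ?_
  · exact (Primrec.nat_add.comp .id (.const 2)).to_comp
  · rintro ⟨G, k⟩
    refine mem_cliqueProblem_iff.trans ((exists_clique_iff_totalDomination
      (E := fun u w => inputMem (G, k) (G.card + 1 + (u + w * G.card)) = 2) G.card_pos
      (by positivity)).trans ?_)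
    exact (hQ _ _ (isBasic_mkGraph fun v w h => h.symm)).symm

/-! ### Hardness -/

/-- A unary relation is formally a set of functions on `Fin 1`; this identifies it with a set of
elements. -/
theorem exists_finset_fun_iff {U : Type} (k : ℕ) (P : (U → Prop) → Prop) :
    (∃ C : Finset (Fin 1 → U), C.card = k ∧ P fun y => (fun _ => y) ∈ C) ↔
      ∃ T : Finset U, T.card = k ∧ P fun y => y ∈ T := by
  let e := Equiv.funUnique (Fin 1) U
  have he : ∀ (y : U), e.symm y = fun _ => y := fun y => rfl
  constructor
  · rintro ⟨C, hC, h⟩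
    refine ⟨C.map e.toEmbedding, by rwa [Finset.card_map], ?_⟩
    simpa only [Finset.mem_map_equiv, he] using h
  · rintro ⟨T, hT, h⟩
    refine ⟨T.map e.symm.toEmbedding, by rwa [Finset.card_map], ?_⟩
    simpa only [Finset.mem_map_equiv, Equiv.symm_symm, show ∀ y : U, e (fun _ => y) = y from
      fun y => rfl] using h

theorem exists_sentence_aa : ∃ φ : (digraphVocab.langX 1).Sentence,
    HasPattern [Quant.a, Quant.a] φ ∧ modelsEq φ = cliqueProblem := by
  obtain ⟨φ, hφ, h⟩ := exists_isQF (.imp (.mem ![0]) (.imp (.mem ![1])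
    (.imp (.imp (.eq 0 1) .fls) (.edge 1 0 1))) : QForm digraphVocab 1 (Fin 2))
  refine ⟨φ.all.all, .all (.all (.qf hφ)), ?_⟩
  ext ⟨G, k⟩
  rw [mem_modelsEq]
  refine Iff.trans ?_ (exists_finset_fun_iff k fun (X : Fin G.card → Prop) =>
    ∀ a, X a → ∀ b, X b → a ≠ b → G.Adj a b)
  refine exists_congr fun C => and_congr Iff.rfl ?_
  simp only [realizeX_all, h, QForm.eval, QForm.eval_edge]
  refine forall_congr' fun a => ?_
  have e0 : ∀ b, (Fin.snoc (Fin.snoc Fin.elim0 a : Fin 1 → Fin G.card) b : Fin 2 → Fin G.card) 0 =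
    a := fun b => rfl
  have e1 : ∀ b, (Fin.snoc (Fin.snoc Fin.elim0 a : Fin 1 → Fin G.card) b : Fin 2 → Fin G.card) 1 =
    b := fun b => rfl
  have e0' : ∀ b, (Fin.snoc (Fin.snoc Fin.elim0 a : Fin 1 → Fin G.card) b : Fin 2 → Fin G.card) ∘
    ![0] = fun _ => a := fun b => funext fun i => by fin_cases i; rfl
  have e1' : ∀ b, (Fin.snoc (Fin.snoc Fin.elim0 a : Fin 1 → Fin G.card) b : Fin 2 → Fin G.card) ∘
    ![1] = fun _ => b := fun b => funext fun i => by fin_cases i; rfl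
  simp only [e0, e1, e0', e1']
  exact ⟨fun h h1 b => h b h1, fun h b h1 => h h1 b⟩

theorem exists_sentence_ae : ∃ φ : (digraphVocab.langX 1).Sentence,
    HasPattern [Quant.a, Quant.e] φ ∧ modelsEq φ = totalDominationProblem := by
  obtain ⟨φ, hφ, h⟩ := exists_isQF (.imp (.imp (.mem ![1]) (.imp (.edge 1 0 1) .fls)) .fls :
    QForm digraphVocab 1 (Fin 2))
  refine ⟨φ.ex.all, .all (.ex (.qf hφ)), ?_⟩
  ext ⟨G, k⟩
  rw [mem_modelsEq]
  refine Iff.trans ?_ (exists_finset_fun_iff k fun (X : Fin G.card → Prop) =>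
    ∀ a, ∃ b, X b ∧ G.Adj a b)
  refine exists_congr fun C => and_congr Iff.rfl ?_
  simp only [realizeX_all, realizeX_ex, h, QForm.eval, QForm.eval_edge]
  refine forall_congr' fun a => exists_congr fun b => ?_
  have e0 : (Fin.snoc (Fin.snoc Fin.elim0 a : Fin 1 → Fin G.card) b : Fin 2 → Fin G.card) 0 =
    a := rfl
  have e1 : (Fin.snoc (Fin.snoc Fin.elim0 a : Fin 1 → Fin G.card) b : Fin 2 → Fin G.card) 1 =
    b := rfl
  have e1' : (Fin.snoc (Fin.snoc Fin.elim0 a : Fin 1 → Fin G.card) b : Fin 2 → Fin G.card) ∘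
    ![1] = fun _ => b := funext fun i => by fin_cases i; rfl
  simp only [e0, e1, e1']
  tauto

/-- A reduction that produces only basic graphs cannot tell a problem from its restriction to
undirected or basic graphs, so one hardness proof covers all three classes. -/
theorem exists_w1Hard {p q : List Quant} (hp : q.Sublist p) {φ : (digraphVocab.langX 1).Sentence}
    (hφ : HasPattern q φ) (hard : ∀ (τ : Vocab) (Q : Problem τ), InW1 Q →
      ∀ Q' : Problem digraphVocab, (∀ G k, G.IsBasic → ((G, k) ∈ Q' ↔ (G, k) ∈ modelsEq φ)) →
        FPTReducible Q Q') :
    (∃ τ : Vocab, ∃ Q ∈ FD τ 1 p, W1Hard Q) ∧ (∃ Q ∈ FDUndirected 1 p, W1Hard Q) ∧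
      (∃ Q ∈ FDBasic 1 p, W1Hard Q) := by
  obtain ⟨φ', hφ', h⟩ := exists_pattern_of_sublist hp φ hφ (Fin.elim0 : Fin 0 → Fin 0)
  have e : modelsEq φ' = modelsEq φ := by
    ext ⟨S, k⟩
    simp only [mem_modelsEq, h, Subsingleton.elim (Fin.elim0 ∘ Fin.elim0) (Fin.elim0 : Fin 0 → _)]
  refine ⟨⟨digraphVocab, _, ⟨φ', hφ', rfl⟩, fun τ Q hQ => hard τ Q hQ _ fun G k _ => by rw [e]⟩,
    ⟨_, ⟨φ', hφ', rfl⟩, fun τ Q hQ => hard τ Q hQ _ fun G k hG => ?_⟩,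
    ⟨_, ⟨φ', hφ', rfl⟩, fun τ Q hQ => hard τ Q hQ _ fun G k hG => ?_⟩⟩
  · rw [e]
    exact and_iff_left fun x y hxy => (hG x y hxy).2
  · rw [e]
    exact and_iff_left hG

end ParamESO

/-! ### The dichotomy -/

theorem mainTheorem5 (p : List ParamESO.Quant) :
    ((∃ m : ℕ, p.Sublist (List.replicate m ParamESO.Quant.e ++ [ParamESO.Quant.a])) →
      (∀ τ : ParamESO.Vocab, ∀ Q ∈ ParamESO.FD τ 1 p, ParamESO.InParaAC0 Q) ∧
      (∀ Q ∈ ParamESO.FDUndirected 1 p, ParamESO.InParaAC0 Q) ∧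
      (∀ Q ∈ ParamESO.FDBasic 1 p, ParamESO.InParaAC0 Q)) ∧
    (([ParamESO.Quant.a, ParamESO.Quant.a].Sublist p ∨
        [ParamESO.Quant.a, ParamESO.Quant.e].Sublist p) →
      (∃ τ : ParamESO.Vocab, ∃ Q ∈ ParamESO.FD τ 1 p, ParamESO.W1Hard Q) ∧
      (∃ Q ∈ ParamESO.FDUndirected 1 p, ParamESO.W1Hard Q) ∧
      (∃ Q ∈ ParamESO.FDBasic 1 p, ParamESO.W1Hard Q)) := by
  refine ⟨fun ⟨m, hp⟩ => ParamESO.inParaAC0_of_sublist hp, ?_⟩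
  rintro (hp | hp)
  · obtain ⟨φ, hφ, h⟩ := ParamESO.exists_sentence_aa
    refine ParamESO.exists_w1Hard hp hφ fun τ Q hQ Q' hQ' => ?_
    obtain ⟨-, τ', s, l, Q₀, hQ₀, hred⟩ := hQ
    exact hred.trans (ParamESO.fptReducible_clique hQ₀ (by rwa [h] at hQ'))
  · obtain ⟨φ, hφ, h⟩ := ParamESO.exists_sentence_ae
    refine ParamESO.exists_w1Hard hp hφ fun τ Q hQ Q' hQ' => ?_
    obtain ⟨-, τ', s, l, Q₀, hQ₀, hred⟩ := hQ
    exact hred.trans ((ParamESO.fptReducible_clique hQ₀ fun _ _ _ => Iff.rfl).trans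
      (ParamESO.fptReducible_totalDomination (by rwa [h] at hQ')))
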